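/- Fix an integer $d\ge 1$ and a probability space. Let $\{(X_{t,T},R_{t,T}):1\le t\le T\}_{T\ge1}$ be a triangular array of random variables with values in $\mathbb R^d\times\mathbb R$. For sub-$\sigma$-algebras put $\alpha(\mathcal B,\mathcal C)=\sup_{B\in\mathcal B,\,C\in\mathcal C}|\mathbb P(B\cap C)-\mathbb P(B)\mathbb P(C)|$, and for $k\ge1$ let $$\alpha(k)=\sup_{T\ge1}\ \sup_{1\le t\le T-k}\alpha\big(\sigma((X_{r,T},R_{r,T}):1\le r\le t),\ \sigma((X_{r,T},R_{r,T}):t+k\le r\le T)\big).$$ Assume that for some real numbers $s>2$ and $\beta$: (K1) There is $C<\infty$ with $\mathbb E|R_{t,T}|^s\le C$ for all $1\le t\le T$. (K2) $\beta>\frac{2s-2}{s-2}$ and there is $A<\infty$ with $\alpha(k)\le A\,k^{-\beta}$ for all $k\ge 1$. (K3) Each $X_{t,T}$ has a Lebesgue density $f_{X_{t,T}}$. For every compact $S'\subseteq\mathbb R^d$ there are $C=C(S')<\infty$ and an integer $l^*=l^*(S')<\infty$ such that, for all $1\le t\le T$ and $x\in S'$, $$f_{X_{t,T}}(x)\le C,\qquad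 \mathbb E\big[|R_{t,T}|^s\mid X_{t,T}=x\big]f_{X_{t,T}}(x)\le C,$$ and such that, for all $l\ge l^*$ and $t\geq 1$ with $t+l\le T$, the pair $(X_{t,T},X_{t+l,T})$ has a joint Lebesgue density $f_{X_{t,T},X_{t+l,T}}$ and, for all $x,x'\in S'$, $$\mathbb E\big[|R_{t,T}||R_{t+l,T}|\mid X_{t,T}=x,\,X_{t+l,T}=x'\big]f_{X_{t,T},X_{t+l,T}}(x,x')\le C.$$ (Densities and conditional expectations are determined only up to null sets; the bounds are required for almost all $x$, respectively $(x,x')$.) Assume further that $$\beta>\frac{2+s(1+(d+1))}{s-2},$$ which implies $\beta>d+2$. Let $K:\mathbb R\to\mathbb R$ be symmetric about $0$, bounded, Lipschitz continuous and nonnegative, with $K(v)=0$ for $|v|>C_1$, where $C_1<\infty$. Let $h=h_T>0$ be bandwidths such that $h_T\le C\,T^{-\xi}$ for some constants $C,\xi>0$, and $$\frac{\log\log T\cdot\log T}{T^{\theta}h^{d+1}}=o(1),\qquad \theta=\frac{\beta(1-2/s)-2/s-1-(d+1)}{\beta+3-(d+1)}$$ as $T\to\infty$ (here $\theta>0$ by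 the condition on $\beta$). Let $S\subset\mathbb R^d$ be a compact set such that, for some $c_S>0$, $$\inf_{x\in S}\ \liminf_{\eta\downarrow0}\ \eta^{-d}\,\mathrm{Leb}\big(S\cap(x+(-C_1\eta,C_1\eta)^d)\big)\ \ge\ c_S.$$ For $u\in[0,1]$ and $x=(x^1,\dots,x^d)\in\mathbb R^d$ let $K_h(v)=h^{-1}K(v/h)$, let $\mathbf D$ be the $T\times(d+2)$ matrix whose $t$-th row is $$\Big(1,\ \frac{t/T-u}{h},\ \frac{X^1_{t,T}-x^1}{h},\dots,\frac{X^d_{t,T}-x^d}{h}\Big),$$ let $\mathbf W$ be the $T\times T$ diagonal matrix with entries $K_h(u-t/T)\prod_{j=1}^dK_h(x^j-X^j_{t,T})$, $t=1,\dots,T$, let $\mathbf R_T=(R_{1,T},\dots,R_{T,T})^\top$, and put $\hat\Psi(u,x)=\frac1T\mathbf D^\top\mathbf W\mathbf R_T\in\mathbb R^{d+2}$. Then, as $T\to\infty$, $$\sup_{u\in[0,1],\,x\in S}\big\|\hat\Psi(u,x)-\mathbb E[\hat\Psi(u,x)]\big\|_2=O_P\Big(\sqrt{\frac{\log T}{T\,h^{d+1}}}\Big),$$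 where $\|\cdot\|_2$ is the Euclidean norm on $\mathbb R^{d+2}$; that is, for every $\varepsilon>0$ there is $M>0$ such that for all sufficiently large $T$ the probability that the left-hand side exceeds $M\sqrt{\log T/(T h^{d+1})}$ is at most $\varepsilon$. -/

import Mathlib

open MeasureTheory ProbabilityTheory Filter Topology
open scoped ENNReal Matrix

namespace LocLin

/-! Triangular arrays are written `X T t`, the paper's `X_{t,T}`; only the entries with
`1 ≤ t ≤ T` are ever used. Covariates take values in `Fin d → ℝ`, i.e. in `ℝ^d` with Lebesgue
measure; no norm on this space is used. -/

/-- The rescaled kernel `K_h(v) = h⁻¹ K(v / h)`. -/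
noncomputable def scaledKernel (K : ℝ → ℝ) (h v : ℝ) : ℝ :=
  1 / h * K (v / h)

/-- The `T × (d+2)` matrix `D` of local regressors at `(u, x)`: the row of the observation at time
`t` is `(1, (t/T - u)/h, (X_t^1 - x^1)/h, …, (X_t^d - x^d)/h)`. The row with index `i : Fin T`
belongs to time `t = i + 1`. -/
noncomputable def designMatrix {d : ℕ} (T : ℕ) (h : ℝ) (X : ℕ → Fin d → ℝ) (u : ℝ)
    (x : Fin d → ℝ) : Matrix (Fin T) (Fin (d + 2)) ℝ :=
  Matrix.of fun i =>
    Matrix.vecCons 1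
      (Matrix.vecCons ((((i : ℕ) + 1 : ℕ) / (T : ℝ) - u) / h)
        fun j : Fin d => (X ((i : ℕ) + 1) j - x j) / h)

/-- The `T × T` diagonal matrix `W` of product kernel weights at `(u, x)`. -/
noncomputable def weightMatrix {d : ℕ} (K : ℝ → ℝ) (T : ℕ) (h : ℝ) (X : ℕ → Fin d → ℝ) (u : ℝ)
    (x : Fin d → ℝ) : Matrix (Fin T) (Fin T) ℝ :=
  Matrix.diagonal fun i =>
    scaledKernel K h (u - ((i : ℕ) + 1 : ℕ) / (T : ℝ)) *
      ∏ j : Fin d, scaledKernel K h (x j - X ((i : ℕ) + 1) j)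

/-- The kernel average `T⁻¹ Dᵀ W R_T` at `(u, x)`, with `R_T = (R_1, …, R_T)`, as a vector in
Euclidean `(d+2)`-space. -/
noncomputable def kernelAverage {d : ℕ} (K : ℝ → ℝ) (T : ℕ) (h : ℝ) (X : ℕ → Fin d → ℝ)
    (R : ℕ → ℝ) (u : ℝ) (x : Fin d → ℝ) : EuclideanSpace ℝ (Fin (d + 2)) :=
  WithLp.toLp 2 ((1 / (T : ℝ)) •
    (((designMatrix T h X u x)ᵀ * weightMatrix K T h X u x) *ᵥ
      fun i : Fin T => R ((i : ℕ) + 1)))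

/-- `K` is symmetric, bounded, Lipschitz continuous, nonnegative and vanishes outside
`[-C₁, C₁]`. -/
structure IsKernel (K : ℝ → ℝ) (C₁ : ℝ) : Prop where
  symm : ∀ v, K (-v) = K v
  nonneg : ∀ v, 0 ≤ K v
  bounded : ∃ C : ℝ, ∀ v, |K v| ≤ C
  lipschitz : ∃ C : ℝ, ∀ v w, |K v - K w| ≤ C * |v - w|
  support : ∀ v, C₁ < |v| → K v = 0

/-- The regularity condition on the set `S`: for some `c > 0`,
`inf_{x ∈ S} liminf_{η ↓ 0} η^{-d} Leb (S ∩ (x + (-C₁ η, C₁ η)^d)) ≥ c`. -/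
def SetRegular {d : ℕ} (S : Set (Fin d → ℝ)) (C₁ : ℝ) : Prop :=
  ∃ c : ℝ, 0 < c ∧
    ENNReal.ofReal c ≤ ⨅ x ∈ S,
      liminf (fun η : ℝ => ENNReal.ofReal ((η ^ d)⁻¹) *
        volume (S ∩ Set.univ.pi fun j => Set.Ioo (x j - C₁ * η) (x j + C₁ * η))) (𝓝[>] 0)

section Probability

variable {Ω : Type*} [MeasurableSpace Ω]

/-- The strong mixing coefficient `sup_{B, C} |P(B ∩ C) - P(B) P(C)|` between two σ-algebras. -/
noncomputable def alphaCoeff (P : Measure Ω) (m₁ m₂ : MeasurableSpace Ω) : ℝ≥0∞ :=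
  ⨆ (B : Set Ω) (_ : MeasurableSet[m₁] B) (C : Set Ω) (_ : MeasurableSet[m₂] C),
    ENNReal.ofReal |P.real (B ∩ C) - P.real B * P.real C|

/-- The σ-algebra generated by `V_s` for `a ≤ s ≤ b`. -/
abbrev sigmaBetween {E : Type*} [MeasurableSpace E] (V : ℕ → Ω → E) (a b : ℕ) :
    MeasurableSpace Ω :=
  ⨆ (s : ℕ) (_ : a ≤ s ∧ s ≤ b), MeasurableSpace.comap (V s) inferInstance

/-- The mixing coefficient `α(k)` of a triangular array `V`:
`sup_{T ≥ 1} sup_{1 ≤ t ≤ T - k} α (σ(V_{s,T} : 1 ≤ s ≤ t), σ(V_{s,T} : t + k ≤ s ≤ T))`. -/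
noncomputable def arrayAlpha {E : Type*} [MeasurableSpace E] (P : Measure Ω)
    (V : ℕ → ℕ → Ω → E) (k : ℕ) : ℝ≥0∞ :=
  ⨆ (T : ℕ) (t : ℕ) (_ : 1 ≤ t ∧ t + k ≤ T),
    alphaCoeff P (sigmaBetween (V T) 1 t) (sigmaBetween (V T) (t + k) T)

/-- The conditional expectation `x ↦ E[Y | Z = x]` of a nonnegative random variable `Y`, as the
mean of the regular conditional distribution of `Y` given `Z`; it is determined up to null sets of
the law of `Z`. -/
noncomputable def condMean {E : Type*} [MeasurableSpace E] (P : Measure Ω) [IsFiniteMeasure P]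
    (Y : Ω → ℝ≥0∞) (Z : Ω → E) (x : E) : ℝ≥0∞ :=
  ∫⁻ y, y ∂(condDistrib Y Z P x)

/-- Uniformly bounded moments: `s > 2` and `E |R_{t,T}|^s ≤ C` for all `1 ≤ t ≤ T`. -/
def MomentCondition (P : Measure Ω) (R : ℕ → ℕ → Ω → ℝ) (s : ℝ) : Prop :=
  2 < s ∧ ∃ C : ℝ, ∀ T t, 1 ≤ t → t ≤ T → ∫⁻ ω, ‖R T t ω‖ₑ ^ s ∂P ≤ ENNReal.ofReal C

/-- The array `(X_{t,T}, R_{t,T})` is strongly mixing with `α(k) ≤ A k^{-β}` for `k ≥ 1`, where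
`β > (2s - 2)/(s - 2)`. -/
def MixingCondition {d : ℕ} (P : Measure Ω) (X : ℕ → ℕ → Ω → Fin d → ℝ) (R : ℕ → ℕ → Ω → ℝ)
    (s β : ℝ) : Prop :=
  (2 * s - 2) / (s - 2) < β ∧
  ∃ A : ℝ, ∀ k : ℕ, 1 ≤ k →
    arrayAlpha P (fun T t ω => (X T t ω, R T t ω)) k ≤ ENNReal.ofReal (A * (k : ℝ) ^ (-β))

/-- The density conditions: each `X_{t,T}` has a density, and for every compact set `S` there are
`C` and `l*` such that the densities and the functions `E[|R_{t,T}|^s | X_{t,T} = x] f(x)` are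
bounded by `C` on `S`, and, for `l ≥ l*`, the pair `(X_{t,T}, X_{t+l,T})` has a joint density `f`
with `E[|R_{t,T}| |R_{t+l,T}| | X_{t,T} = x, X_{t+l,T} = x'] f(x, x') ≤ C` on `S × S`.
Densities and conditional expectations are determined only almost everywhere, and the
suprema are understood accordingly (equivalently, the bounds hold everywhere on `S` for suitable
versions). -/
structure DensityCondition {d : ℕ} (P : Measure Ω) [IsFiniteMeasure P]
    (X : ℕ → ℕ → Ω → Fin d → ℝ) (R : ℕ → ℕ → Ω → ℝ) (s : ℝ) : Prop where
  hasPDF : ∀ T t, 1 ≤ t → t ≤ T → HasPDF (X T t) P volume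
  bounds : ∀ S : Set (Fin d → ℝ), IsCompact S → ∃ (C : ℝ) (lstar : ℕ),
    (∀ T t, 1 ≤ t → t ≤ T → ∀ᵐ x, x ∈ S →
      pdf (X T t) P volume x ≤ ENNReal.ofReal C) ∧
    (∀ T t, 1 ≤ t → t ≤ T → ∀ᵐ x, x ∈ S →
      condMean P (fun ω => ‖R T t ω‖ₑ ^ s) (X T t) x * pdf (X T t) P volume x
        ≤ ENNReal.ofReal C) ∧
    (∀ T t l, 1 ≤ t → lstar ≤ l → t + l ≤ T →
      HasPDF (fun ω => (X T t ω, X T (t + l) ω)) P volume ∧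
      ∀ᵐ z : (Fin d → ℝ) × (Fin d → ℝ), z.1 ∈ S → z.2 ∈ S →
        condMean P (fun ω => ‖R T t ω‖ₑ * ‖R T (t + l) ω‖ₑ)
            (fun ω => (X T t ω, X T (t + l) ω)) z *
          pdf (fun ω => (X T t ω, X T (t + l) ω)) P volume z ≤ ENNReal.ofReal C)

/-- `Z_T = O_P(a_T)` as `T → ∞`, for `[0, ∞]`-valued `Z_T`. -/
def IsBigOInProb (P : Measure Ω) (Z : ℕ → Ω → ℝ≥0∞) (a : ℕ → ℝ) : Prop :=
  ∀ ε : ℝ, 0 < ε → ∃ M : ℝ, 0 < M ∧ ∀ᶠ T in atTop,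
    P {ω | ENNReal.ofReal (M * a T) < Z T ω} ≤ ENNReal.ofReal ε

end Probability

/-- The exponent `θ` in the bandwidth condition. -/
noncomputable def theta (d : ℕ) (s β : ℝ) : ℝ :=
  (β * (1 - 2 / s) - 2 / s - 1 - (d + 1)) / (β + 3 - (d + 1))

end LocLin

/-! Each coordinate of the kernel average is `1 / (T h^(d+1))` times a sum over `t` of a product of
bounded Lipschitz factors times `R_t`. With `n = T h^(d+1)` and `a = √(log T / n)`, the sum must
stay within a multiple of `a n` of its mean, uniformly in `(u, x)`.

Responses are cut at `τ = (ρ T)^(1/s)` with `ρ = log log T`. Some response exceeds `τ` with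
probability `O(1/ρ)` by Markov's inequality, and the mean of the part cut off is `O(τ^(1-s) n) = O(a
n)`. The parameter set is covered by a net of mesh `a h`. Moving to a nearby centre changes the
weights by `O(a)`, and only inside a slightly larger window, so a nonnegative envelope sum,
controlled on the same net, bounds the discretisation error
(`LocalMoments.abs_sum_localWeight_sub_le`).

At a centre, a Bernstein inequality for mixing sequences applies (`measureReal_lt_abs_sum_le`).
Times are grouped into blocks of length `m = ⌊1/(a τ)⌋`, and even and odd blocks are treated
separately, which leaves gaps of length `m`. Block sums are replaced by independent copies one at a
time inside a bounded Lipschitz test function. The cost is proportional to the Lipschitz constant,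
so mixing errors add up and are never multiplied by an exponential moment. Variances are controlled
by covariances of order `h^d l^(-κ)` with `κ > 1`, obtained by interpolating between Davydov's
inequality and the joint density bound (`DependenceLE.abs_cov_le_interpolate`).

The exponential part is `T^(-(d+3))` per centre, against at most a multiple of `T^(d+2)` centres.
The mixing part summed over the net is `O((log T)^(-2))`; the exponent `θ` is the one for which the
powers of `T` cancel there (`mixing_error_le`). -/

namespace LocLin

/-! ### Decoupling and covariance inequalities under strong mixing -/

section Mixing

variable {Ω : Type*} {m₁ m₂ m₁' m₂' : MeasurableSpace Ω} {mΩ : MeasurableSpace Ω} {P : Measure Ω}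

/-- The strong mixing coefficient of two σ-algebras is at most `a`. -/
def DependenceLE (P : Measure Ω) (m₁ m₂ : MeasurableSpace Ω) (a : ℝ) : Prop :=
  ∀ B C : Set Ω, MeasurableSet[m₁] B → MeasurableSet[m₂] C →
    |P.real (B ∩ C) - P.real B * P.real C| ≤ a

theorem DependenceLE.mono {a : ℝ}
    (h : DependenceLE P m₁ m₂ a) (h₁ : m₁' ≤ m₁) (h₂ : m₂' ≤ m₂) : DependenceLE P m₁' m₂' a :=
  fun B C hB hC => h B C (h₁ B hB) (h₂ C hC)

theorem DependenceLE.symm {a : ℝ}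
    (h : DependenceLE P m₁ m₂ a) : DependenceLE P m₂ m₁ a := fun B C hB hC => by
  rw [Set.inter_comm, mul_comm]; exact h C B hC hB

theorem integrable_of_abs_le [IsFiniteMeasure P] {f : Ω → ℝ} {M : ℝ} (hf : Measurable f)
    (h : ∀ ω, |f ω| ≤ M) : Integrable f P :=
  Integrable.of_bound hf.aestronglyMeasurable M (Eventually.of_forall h)

/-- Decoupling of a primitive `∫_{-b}^X F` whose integrand is nearly uncorrelated with the
superlevel sets of `X`. -/
theorem abs_integral_primitive_sub_le [IsProbabilityMeasure P] {F : ℝ → Ω → ℝ} {X : Ω → ℝ}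
    {b L κ : ℝ} (hF : Measurable (Function.uncurry F)) (hFL : ∀ v ω, |F v ω| ≤ L)
    (hX : Measurable X) (hXb : ∀ ω, |X ω| ≤ b)
    (hκ : ∀ v, |∫ ω in {ω | v ≤ X ω}, F v ω ∂P - P.real {ω | v ≤ X ω} * ∫ ω, F v ω ∂P| ≤ κ) :
    |∫ ω, (∫ v in (-b)..(X ω), F v ω) ∂P - ∫ ω', ∫ ω, (∫ v in (-b)..(X ω'), F v ω) ∂P ∂P|
      ≤ 2 * b * κ := by
  have hb : 0 ≤ b := by
    obtain ⟨ω⟩ : Nonempty Ω := nonempty_of_isProbabilityMeasure P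
    exact (abs_nonneg _).trans (hXb ω)
  set ν : Measure ℝ := volume.restrict (Set.Ioc (-b) b) with hν
  -- Written over the fixed interval `(-b, b]` with the indicator of `v ≤ X`, the primitive can be
  -- averaged by Fubini. Both expectations become integrals over `v` whose integrands differ by at
  -- most `κ`, on a set of length `2 b`.
  have hprim : ∀ ω ω', ∫ v in (-b)..(X ω'), F v ω =
      ∫ v, (if v ≤ X ω' then F v ω else 0) ∂ν := by
    intro ω ω'
    have h1 := abs_le.1 (hXb ω')
    rw [intervalIntegral.integral_of_le h1.1]
    have : Set.Ioc (-b) (X ω') = Set.Ioc (-b) b ∩ {v | v ≤ X ω'} := by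
      ext v; simp only [Set.mem_Ioc, Set.mem_inter_iff, Set.mem_ofPred_eq]
      constructor
      · rintro ⟨h2, h3⟩; exact ⟨⟨h2, h3.trans h1.2⟩, h3⟩
      · rintro ⟨⟨h2, _⟩, h3⟩; exact ⟨h2, h3⟩
    have hms : MeasurableSet {v | v ≤ X ω'} := measurableSet_Iic
    rw [this, Set.inter_comm, ← Measure.restrict_restrict hms,
      ← integral_indicator hms]
    rfl
  have hm1 : Measurable (fun p : Ω × ℝ => if p.2 ≤ X p.1 then F p.2 p.1 else 0) :=
    Measurable.ite (measurableSet_le measurable_snd (hX.comp measurable_fst))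
      (hF.comp measurable_swap) measurable_const
  have hL : 0 ≤ L := by
    obtain ⟨ω⟩ : Nonempty Ω := nonempty_of_isProbabilityMeasure P
    exact (abs_nonneg _).trans (hFL 0 ω)
  have hi1 : Integrable (fun p : Ω × ℝ => if p.2 ≤ X p.1 then F p.2 p.1 else 0) (P.prod ν) := by
    refine integrable_of_abs_le (M := L) hm1 fun p => ?_
    split_ifs
    · exact hFL _ _
    · simpa using hL
  have e1 : ∫ ω, (∫ v in (-b)..(X ω), F v ω) ∂P = ∫ v, ∫ ω in {ω | v ≤ X ω}, F v ω ∂P ∂ν := by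
    simp_rw [hprim]
    rw [integral_integral_swap hi1]
    refine integral_congr_ae (Eventually.of_forall fun v => ?_)
    simp only
    rw [← integral_indicator (measurableSet_le measurable_const hX)]
    rfl
  have e2 : ∫ ω', ∫ ω, (∫ v in (-b)..(X ω'), F v ω) ∂P ∂P =
      ∫ v, P.real {ω | v ≤ X ω} * ∫ ω, F v ω ∂P ∂ν := by
    have hG : Measurable (fun v => ∫ ω, F v ω ∂P) :=
      (hF.stronglyMeasurable.integral_prod_right).measurable
    have hGL : ∀ v, |∫ ω, F v ω ∂P| ≤ L := fun v => by
      simpa using norm_integral_le_of_norm_le_const (μ := P) (f := F v) (C := L)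
        (Eventually.of_forall (hFL v))
    have h3 : ∀ ω', ∫ ω, (∫ v in (-b)..(X ω'), F v ω) ∂P =
        ∫ v, (if v ≤ X ω' then ∫ ω, F v ω ∂P else 0) ∂ν := by
      intro ω'
      simp_rw [hprim]
      rw [integral_integral_swap]
      · refine integral_congr_ae (Eventually.of_forall fun v => ?_)
        simp only
        split_ifs <;> simp
      · refine integrable_of_abs_le (M := L) ?_ fun p => ?_
        · exact Measurable.ite (measurableSet_le measurable_snd measurable_const)
            (hF.comp measurable_swap) measurable_const
        · simp only [Function.uncurry]
          split_ifs
          · exact hFL _ _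
          · simpa using hL
    simp_rw [h3]
    rw [integral_integral_swap]
    · refine integral_congr_ae (Eventually.of_forall fun v => ?_)
      simp only
      have : (fun ω' => if v ≤ X ω' then ∫ ω, F v ω ∂P else 0) =
          {ω | v ≤ X ω}.indicator (fun _ => ∫ ω, F v ω ∂P) := rfl
      rw [this, integral_indicator (measurableSet_le measurable_const hX)]
      simp [Measure.real]
    · refine integrable_of_abs_le (M := L) ?_ fun p => ?_
      · exact Measurable.ite (measurableSet_le measurable_snd (hX.comp measurable_fst))
          (hG.comp measurable_snd) measurable_const
      · simp only [Function.uncurry]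
        split_ifs
        · exact hGL _
        · simpa using hL
  have hA : Integrable (fun v => ∫ ω in {ω | v ≤ X ω}, F v ω ∂P) ν := by
    have := hi1.integral_prod_right
    refine this.congr (Eventually.of_forall fun v => ?_)
    simp only
    rw [← integral_indicator (measurableSet_le measurable_const hX)]
    rfl
  have hB : Integrable (fun v => P.real {ω | v ≤ X ω} * ∫ ω, F v ω ∂P) ν := by
    have hG : Measurable (fun v => ∫ ω, F v ω ∂P) :=
      (hF.stronglyMeasurable.integral_prod_right).measurable
    have hanti : Antitone (fun v => P.real {ω | v ≤ X ω}) := fun v w hvw =>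
      measureReal_mono (μ := P) (fun ω (hω : w ≤ X ω) => hvw.trans hω)
    refine integrable_of_abs_le (M := L) (hanti.measurable.mul hG) fun v => ?_
    rw [abs_mul, abs_of_nonneg measureReal_nonneg]
    have hGL : |∫ ω, F v ω ∂P| ≤ L := by
      simpa using norm_integral_le_of_norm_le_const (μ := P) (f := F v) (C := L)
        (Eventually.of_forall (hFL v))
    have := measureReal_le_one (μ := P) (s := {ω | v ≤ X ω})
    nlinarith [measureReal_nonneg (μ := P) (s := {ω | v ≤ X ω}), abs_nonneg (∫ ω, F v ω ∂P)]
  rw [e1, e2, ← integral_sub hA hB]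
  have := norm_integral_le_of_norm_le_const (μ := ν)
    (f := fun v => ∫ ω in {ω | v ≤ X ω}, F v ω ∂P - P.real {ω | v ≤ X ω} * ∫ ω, F v ω ∂P)
    (Eventually.of_forall hκ)
  refine this.trans (le_of_eq ?_)
  rw [hν, measureReal_restrict_apply_univ, Real.volume_real_Ioc_of_le (by linarith)]
  ring

/-- A bounded variable `f` nearly uncorrelated with the superlevel sets of the bounded variable `g`
is nearly uncorrelated with `g`. -/
theorem abs_integral_mul_sub_le_of_superlevel [IsProbabilityMeasure P] {f g : Ω → ℝ}
    {L M κ : ℝ} (hf : Measurable f) (hfL : ∀ ω, |f ω| ≤ L)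
    (hg : Measurable g) (hgM : ∀ ω, |g ω| ≤ M)
    (hκ : ∀ v, |∫ ω in {ω | v ≤ g ω}, f ω ∂P - P.real {ω | v ≤ g ω} * ∫ ω, f ω ∂P| ≤ κ) :
    |∫ ω, f ω * g ω ∂P - (∫ ω, f ω ∂P) * ∫ ω, g ω ∂P| ≤ 2 * M * κ := by
  -- For an integrand constant in `v` the primitive from `-M` to `g` is `(g + M) f`, and the shift
  -- by `M` drops out of the covariance.
  have h := abs_integral_primitive_sub_le (P := P) (F := fun _ => f) (hf.comp measurable_snd)
    (fun _ => hfL) hg hgM hκ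
  have hfi := integrable_of_abs_le (P := P) hf hfL
  have hgi := integrable_of_abs_le (P := P) hg hgM
  have hfg : Integrable (fun ω => f ω * g ω) P :=
    integrable_of_abs_le (M := L * M) (hf.mul hg) fun ω => by
      rw [abs_mul]
      exact mul_le_mul (hfL ω) (hgM ω) (abs_nonneg _) ((abs_nonneg _).trans (hfL ω))
  simp only [intervalIntegral.integral_const, smul_eq_mul, sub_neg_eq_add, integral_const_mul,
    integral_mul_const] at h
  have e1 : ∫ ω, (g ω + M) * f ω ∂P = ∫ ω, f ω * g ω ∂P + M * ∫ ω, f ω ∂P := by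
    rw [← integral_const_mul, ← integral_add hfg (hfi.const_mul M)]
    congr 1; ext ω; ring
  have e2 : ∫ ω, (g ω + M) ∂P = ∫ ω, g ω ∂P + M := by
    rw [integral_add hgi (integrable_const M)]; simp
  rw [e1, e2] at h
  convert h using 2
  ring

/-- Covariance inequality for an event and a bounded variable. -/
theorem DependenceLE.setIntegral_sub_le [IsProbabilityMeasure P]
    {a L : ℝ} (h : DependenceLE P m₁ m₂ a) (h₁ : m₁ ≤ mΩ) (h₂ : m₂ ≤ mΩ) {f : Ω → ℝ}
    (hf : Measurable[m₁] f) (hfL : ∀ ω, |f ω| ≤ L) {C : Set Ω} (hC : MeasurableSet[m₂] C) :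
    |∫ ω in C, f ω ∂P - P.real C * ∫ ω, f ω ∂P| ≤ 2 * L * a := by
  have hC' := h₂ C hC
  have hm : Measurable (C.indicator (fun _ => (1 : ℝ))) := measurable_const.indicator hC'
  -- The indicator of `C` is the decoupled factor, so that the hypothesis on superlevel sets of `f`
  -- concerns only pairs of events and is the mixing bound itself.
  have key := abs_integral_mul_sub_le_of_superlevel (P := P) (f := C.indicator (fun _ => (1 : ℝ)))
    (g := f) (L := 1) (M := L) (κ := a) hm
    (fun ω => by by_cases hω : ω ∈ C <;> simp [hω]) (hf.mono h₁ le_rfl) hfL (fun v => by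
      have hB : MeasurableSet[m₁] {ω | v ≤ f ω} := hf measurableSet_Ici
      rw [setIntegral_indicator hC', integral_indicator hC']
      simpa [Measure.real] using h _ _ hB hC)
  have e1 : ∫ ω, C.indicator (fun _ => (1 : ℝ)) ω * f ω ∂P = ∫ ω in C, f ω ∂P := by
    rw [← integral_indicator hC']
    congr 1; ext ω
    by_cases hω : ω ∈ C <;> simp [hω]
  rw [e1, integral_indicator hC'] at key
  simpa [Measure.real] using key

/-- Covariance inequality for two bounded variables. -/
theorem DependenceLE.integral_mul_sub_le [IsProbabilityMeasure P]
    {a L M : ℝ} (h : DependenceLE P m₁ m₂ a) (h₁ : m₁ ≤ mΩ) (h₂ : m₂ ≤ mΩ) {f g : Ω → ℝ}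
    (hf : Measurable[m₁] f) (hfL : ∀ ω, |f ω| ≤ L) (hg : Measurable[m₂] g)
    (hgM : ∀ ω, |g ω| ≤ M) :
    |∫ ω, f ω * g ω ∂P - (∫ ω, f ω ∂P) * ∫ ω, g ω ∂P| ≤ 4 * a * L * M := by
  refine (abs_integral_mul_sub_le_of_superlevel (P := P) (κ := 2 * L * a) (hf.mono h₁ le_rfl) hfL
    (hg.mono h₂ le_rfl) hgM fun v => ?_).trans (le_of_eq (by ring))
  exact h.setIntegral_sub_le h₁ h₂ hf hfL (hg measurableSet_Ici)

/-- Replacing a summand by an independent copy inside a Lipschitz function. -/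
theorem DependenceLE.integral_comp_add_sub_le [IsProbabilityMeasure P]
    {a b : ℝ} (h : DependenceLE P m₁ m₂ a) (h₁ : m₁ ≤ mΩ) (h₂ : m₂ ≤ mΩ) {Y X : Ω → ℝ}
    (hY : Measurable[m₁] Y) (hX : Measurable[m₂] X) (hXb : ∀ ω, |X ω| ≤ b)
    {φ : ℝ → ℝ} {L : NNReal} (hφ : LipschitzWith L φ) (hφ1 : ∀ y, |φ y| ≤ 1) :
    |∫ ω, φ (Y ω + X ω) ∂P - ∫ ω, ∫ ω', φ (Y ω + X ω') ∂P ∂P| ≤ 4 * L * b * a := by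
  have hYm := hY.mono h₁ le_rfl
  have hXm := hX.mono h₂ le_rfl
  have hφm := hφ.continuous.measurable
  have hdL : ∀ y, |deriv φ y| ≤ L := fun y => norm_deriv_le_of_lipschitz hφ
  have hF : Measurable (Function.uncurry fun (v : ℝ) (ω : Ω) => deriv φ (Y ω + v)) :=
    (measurable_deriv φ).comp ((hYm.comp measurable_snd).add measurable_fst)
  -- `φ (Y + X) - φ (Y - b)` is the primitive of `v ↦ φ' (Y + v)` from `-b` to `X`. For fixed `v`
  -- this integrand is `m₁`-measurable and bounded by `L`, which gives `κ = 2 L a`.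
  have key := abs_integral_primitive_sub_le (P := P) (F := fun v ω => deriv φ (Y ω + v))
    (X := X) (κ := 2 * L * a) hF (fun v ω => hdL _) hXm hXb (fun v =>
      h.setIntegral_sub_le h₁ h₂ ((measurable_deriv φ).comp (hY.add_const v)) (fun ω => hdL _)
        (hX measurableSet_Ici))
  -- Lipschitz functions are absolutely continuous, so the default value of `deriv` at points of
  -- non-differentiability does no harm.
  have hftc : ∀ y x, ∫ v in (-b)..x, deriv φ (y + v) = φ (y + x) - φ (y - b) := by
    intro y x
    rw [intervalIntegral.integral_comp_add_left (fun v => deriv φ v) y]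
    rw [AbsolutelyContinuousOnInterval.integral_deriv_eq_sub]
    · rfl
    · exact (hφ.lipschitzOnWith).absolutelyContinuousOnInterval
  simp only [hftc] at key
  have hi1 : Integrable (fun ω => φ (Y ω + X ω)) P :=
    integrable_of_abs_le (hφm.comp (hYm.add hXm)) (fun ω => hφ1 _)
  have hi2 : Integrable (fun ω => φ (Y ω - b)) P :=
    integrable_of_abs_le (hφm.comp (hYm.sub_const b)) (fun ω => hφ1 _)
  have hi3 : ∀ ω', Integrable (fun ω => φ (Y ω + X ω')) P := fun ω' =>
    integrable_of_abs_le (hφm.comp (hYm.add_const _)) (fun ω => hφ1 _)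
  have hi4 : Integrable (fun p : Ω × Ω => φ (Y p.1 + X p.2)) (P.prod P) :=
    integrable_of_abs_le (hφm.comp ((hYm.comp measurable_fst).add (hXm.comp measurable_snd)))
      (fun ω => hφ1 _)
  rw [integral_sub hi1 hi2] at key
  simp_rw [fun ω' => integral_sub (hi3 ω') hi2] at key
  rw [integral_sub hi4.integral_prod_right (integrable_const _),
    ← integral_integral_swap hi4] at key
  simp only [integral_const, probReal_univ, one_smul, sub_sub_sub_cancel_right] at key
  exact key.trans (le_of_eq (by ring))

end Mixing

end LocLin

/-! ### Davydov's inequality and an exponential bound for weakly dependent sums -/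

namespace LocLin

section Mixing

variable {Ω : Type*} {m₁ m₂ m₁' m₂' : MeasurableSpace Ω} {mΩ : MeasurableSpace Ω} {P : Measure Ω}

/-- Truncation of a real number at level `M`. -/
noncomputable def trunc (M x : ℝ) : ℝ := if |x| ≤ M then x else 0

theorem measurable_trunc (M : ℝ) : Measurable (trunc M) :=
  Measurable.ite (measurableSet_le measurable_id.abs measurable_const) measurable_id
    measurable_const

theorem abs_trunc_le {M : ℝ} (hM : 0 ≤ M) (x : ℝ) : |trunc M x| ≤ M := by
  unfold trunc; split_ifs with h
  · exact h
  · simpa using hM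

theorem abs_trunc_le_abs (M x : ℝ) : |trunc M x| ≤ |x| := by
  unfold trunc; split_ifs with h
  · exact le_rfl
  · simp

/-- The product changes only if a factor exceeds `M`. It is then at most the sum of the squares of
the factors exceeding `M`, and `|z|^2 ≤ M^(2-s) |z|^s` for `|z| > M` because `s > 2`. -/
theorem abs_mul_sub_trunc_mul_le {M s : ℝ} (hM : 0 < M) (hs : 2 < s) (x y : ℝ) :
    |x * y - trunc M x * trunc M y| ≤ M ^ (2 - s) * (|x| ^ s + |y| ^ s) := by
  have key : ∀ z : ℝ, M < |z| → |z| * |z| ≤ M ^ (2 - s) * |z| ^ s := by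
    intro z hz
    have hz0 : 0 < |z| := hM.trans hz
    have h1 : |z| ^ (2 - s) ≤ M ^ (2 - s) :=
      Real.rpow_le_rpow_of_nonpos hM hz.le (by linarith)
    have h2 : |z| * |z| = |z| ^ (2 - s) * |z| ^ s := by
      rw [← Real.rpow_add hz0, sub_add_cancel]; norm_num [sq]
    rw [h2]
    exact mul_le_mul_of_nonneg_right h1 (by positivity)
  have hnx : 0 ≤ M ^ (2 - s) * |x| ^ s := by positivity
  have hny : 0 ≤ M ^ (2 - s) * |y| ^ s := by positivity
  rw [mul_add]
  by_cases hx : |x| ≤ M <;> by_cases hy : |y| ≤ M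
  · simp only [trunc, hx, hy, if_true, sub_self, abs_zero]; positivity
  · have := key y (not_le.1 hy)
    simp only [trunc, hx, hy, if_true, if_false, mul_zero, sub_zero, abs_mul]
    have h3 : |x| * |y| ≤ |y| * |y| :=
      mul_le_mul_of_nonneg_right (hx.trans (not_le.1 hy).le) (abs_nonneg _)
    linarith
  · have := key x (not_le.1 hx)
    simp only [trunc, hx, hy, if_true, if_false, zero_mul, sub_zero, abs_mul]
    have h3 : |x| * |y| ≤ |x| * |x| :=
      mul_le_mul_of_nonneg_left (hy.trans (not_le.1 hx).le) (abs_nonneg _)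
    linarith
  · have h1 := key x (not_le.1 hx)
    have h2 := key y (not_le.1 hy)
    simp only [trunc, hx, hy, if_false, zero_mul, sub_zero, abs_mul]
    nlinarith [sq_nonneg (|x| - |y|)]

/-- A form of Davydov's covariance inequality. -/
theorem DependenceLE.abs_cov_le_of_moment [IsProbabilityMeasure P] {a K L M s : ℝ}
    (h : DependenceLE P m₁ m₂ a) (h₁ : m₁ ≤ mΩ) (h₂ : m₂ ≤ mΩ) {f g : Ω → ℝ}
    (hf : Measurable[m₁] f) (hfL : ∀ ω, |f ω| ≤ L) (hg : Measurable[m₂] g)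
    (hgL : ∀ ω, |g ω| ≤ L) (hM : 0 < M) (hs : 2 < s) (hfK : ∫ ω, |f ω| ^ s ∂P ≤ K)
    (hgK : ∫ ω, |g ω| ^ s ∂P ≤ K) :
    |∫ ω, f ω * g ω ∂P - (∫ ω, f ω ∂P) * ∫ ω, g ω ∂P| ≤ 4 * a * M ^ 2 + 4 * K * M ^ (2 - s) := by
  have hfm := hf.mono h₁ le_rfl
  have hgm := hg.mono h₂ le_rfl
  have hs0 : 0 ≤ s := by linarith
  have hfsm : Measurable fun ω => |f ω| ^ s := (hfm.abs).pow_const s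
  have hgsm : Measurable fun ω => |g ω| ^ s := (hgm.abs).pow_const s
  have hfs : Integrable (fun ω => |f ω| ^ s) P := integrable_of_abs_le (M := L ^ s) hfsm fun ω => by
    rw [abs_of_nonneg (by positivity)]
    exact Real.rpow_le_rpow (abs_nonneg _) (hfL ω) hs0
  have hgs : Integrable (fun ω => |g ω| ^ s) P := integrable_of_abs_le (M := L ^ s) hgsm fun ω => by
    rw [abs_of_nonneg (by positivity)]
    exact Real.rpow_le_rpow (abs_nonneg _) (hgL ω) hs0
  set f₁ : Ω → ℝ := fun ω => trunc M (f ω)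
  set g₁ : Ω → ℝ := fun ω => trunc M (g ω)
  have hf₁ : Measurable[m₁] f₁ := (measurable_trunc M).comp hf
  have hg₁ : Measurable[m₂] g₁ := (measurable_trunc M).comp hg
  have hf₁m := hf₁.mono h₁ le_rfl
  have hg₁m := hg₁.mono h₂ le_rfl
  have hf₁b : ∀ ω, |f₁ ω| ≤ M := fun ω => abs_trunc_le hM.le _
  have hg₁b : ∀ ω, |g₁ ω| ≤ M := fun ω => abs_trunc_le hM.le _
  have hcov := h.integral_mul_sub_le h₁ h₂ hf₁ hf₁b hg₁ hg₁b
  have hfg : Integrable (fun ω => f ω * g ω) P :=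
    integrable_of_abs_le (M := L * L) (hfm.mul hgm) fun ω => by
      rw [abs_mul]
      exact mul_le_mul (hfL ω) (hgL ω) (abs_nonneg _) ((abs_nonneg _).trans (hfL ω))
  have hfg₁ : Integrable (fun ω => f₁ ω * g₁ ω) P :=
    integrable_of_abs_le (M := M * M) (hf₁m.mul hg₁m) fun ω => by
      rw [abs_mul]
      exact mul_le_mul (hf₁b ω) (hg₁b ω) (abs_nonneg _) hM.le
  have e1 : |∫ ω, f ω * g ω ∂P - ∫ ω, f₁ ω * g₁ ω ∂P| ≤ M ^ (2 - s) * (K + K) := by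
    rw [← integral_sub hfg hfg₁]
    have hint : Integrable (fun ω => M ^ (2 - s) * (|f ω| ^ s + |g ω| ^ s)) P :=
      (hfs.add hgs).const_mul _
    refine (norm_integral_le_of_norm_le (f := fun ω => f ω * g ω - f₁ ω * g₁ ω) hint
      (Eventually.of_forall fun ω => abs_mul_sub_trunc_mul_le hM hs _ _)).trans ?_
    rw [integral_const_mul, integral_add hfs hgs]
    gcongr
  have e2 : |(∫ ω, f ω ∂P) * (∫ ω, g ω ∂P) - (∫ ω, f₁ ω ∂P) * ∫ ω, g₁ ω ∂P|
      ≤ M ^ (2 - s) * (K + K) := by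
    -- The product of the means is an integral over `P.prod P`, so the same pointwise truncation
    -- bound applies to it.
    have hi1 : Integrable (fun p : Ω × Ω => f p.1 * g p.2) (P.prod P) :=
      (integrable_of_abs_le hfm hfL).mul_prod (integrable_of_abs_le hgm hgL)
    have hi2 : Integrable (fun p : Ω × Ω => f₁ p.1 * g₁ p.2) (P.prod P) :=
      (integrable_of_abs_le hf₁m hf₁b).mul_prod (integrable_of_abs_le hg₁m hg₁b)
    rw [← integral_prod_mul f g, ← integral_prod_mul f₁ g₁, ← integral_sub hi1 hi2]
    have hi3 : Integrable (fun p : Ω × Ω => |f p.1| ^ s) (P.prod P) := hfs.comp_fst P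
    have hi4 : Integrable (fun p : Ω × Ω => |g p.2| ^ s) (P.prod P) := hgs.comp_snd P
    have hint : Integrable (fun p : Ω × Ω => M ^ (2 - s) * (|f p.1| ^ s + |g p.2| ^ s))
      (P.prod P) := (hi3.add hi4).const_mul _
    refine (norm_integral_le_of_norm_le
      (f := fun p : Ω × Ω => f p.1 * g p.2 - f₁ p.1 * g₁ p.2) hint
      (Eventually.of_forall fun p => abs_mul_sub_trunc_mul_le hM hs _ _)).trans ?_
    rw [integral_const_mul, integral_add hi3 hi4, integral_fun_fst (fun ω => |f ω| ^ s),
      integral_fun_snd (fun ω => |g ω| ^ s)]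
    simp only [probReal_univ, one_smul]
    gcongr
  rw [abs_le] at *
  constructor <;> nlinarith [e1.1, e1.2, e2.1, e2.2, hcov.1, hcov.2]

/-- For `|x| ≤ 1` one has `exp x ≤ 1 + x + x^2`; the linear term has mean zero, which leaves `1 +
lam^2 v`. -/
theorem integral_exp_le_of_sq [IsProbabilityMeasure P] {S : Ω → ℝ} {b v lam : ℝ}
    (hS : Measurable S) (hb : ∀ ω, |S ω| ≤ b) (h0 : ∫ ω, S ω ∂P = 0)
    (hv : ∫ ω, S ω ^ 2 ∂P ≤ v) (hlam : 0 ≤ lam) (hlb : lam * b ≤ 1) :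
    ∫ ω, Real.exp (lam * S ω) ∂P ≤ Real.exp (lam ^ 2 * v) := by
  have hle : ∀ ω, |lam * S ω| ≤ 1 := fun ω => by
    rw [abs_mul, abs_of_nonneg hlam]
    exact (mul_le_mul_of_nonneg_left (hb ω) hlam).trans hlb
  have hi : Integrable S P := integrable_of_abs_le hS hb
  have hi2 : Integrable (fun ω => S ω ^ 2) P :=
    integrable_of_abs_le (M := b ^ 2) (hS.pow_const 2) fun ω => by
      rw [abs_pow]; exact pow_le_pow_left₀ (abs_nonneg _) (hb ω) 2
  have hie : Integrable (fun ω => Real.exp (lam * S ω)) P :=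
    integrable_of_abs_le (M := Real.exp 1) ((hS.const_mul lam).exp) fun ω => by
      rw [Real.abs_exp]; exact Real.exp_le_exp.2 ((le_abs_self _).trans (hle ω))
  have hib : Integrable (fun ω => 1 + lam * S ω + lam ^ 2 * S ω ^ 2) P :=
    ((integrable_const 1).add (hi.const_mul lam)).add (hi2.const_mul _)
  calc ∫ ω, Real.exp (lam * S ω) ∂P ≤ ∫ ω, (1 + lam * S ω + lam ^ 2 * S ω ^ 2) ∂P := by
        refine integral_mono hie hib fun ω => ?_
        have := (abs_le.1 (Real.abs_exp_sub_one_sub_id_le (hle ω))).2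
        simp only
        nlinarith
    _ = 1 + lam ^ 2 * ∫ ω, S ω ^ 2 ∂P := by
        have hi1 : Integrable (fun ω => 1 + lam * S ω) P :=
          (integrable_const 1).add (hi.const_mul lam)
        rw [integral_add hi1 (hi2.const_mul _), integral_add (integrable_const 1) (hi.const_mul lam),
          integral_const_mul, integral_const_mul, h0]
        simp
    _ ≤ lam ^ 2 * v + 1 := by nlinarith [sq_nonneg lam]
    _ ≤ Real.exp (lam ^ 2 * v) := Real.add_one_le_exp _

/-- Averaging over an independent summand keeps the Lipschitz constant, so an averaged test function
is again admissible when summands are removed one by one. -/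
theorem lipschitzWith_integral_comp_add [IsProbabilityMeasure P] {S : Ω → ℝ} (hS : Measurable S)
    {φ : ℝ → ℝ} {L : NNReal} (hφ : LipschitzWith L φ) (hφ1 : ∀ y, |φ y| ≤ 1) :
    LipschitzWith L fun y => ∫ ω, φ (y + S ω) ∂P := by
  have hi : ∀ y, Integrable (fun ω => φ (y + S ω)) P := fun y =>
    integrable_of_abs_le (hφ.continuous.measurable.comp (hS.const_add y)) fun ω => hφ1 _
  refine LipschitzWith.of_dist_le_mul fun y z => ?_
  rw [Real.dist_eq, ← integral_sub (hi y) (hi z)]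
  have := norm_integral_le_of_norm_le_const (μ := P)
    (f := fun ω => φ (y + S ω) - φ (z + S ω)) (C := L * dist y z) (Eventually.of_forall fun ω => by
      simpa [Real.dist_eq] using hφ.dist_le_mul (y + S ω) (z + S ω))
  simpa using this

/-- An exponential bound for a Lipschitz function of a sum of weakly dependent variables. -/
theorem integral_comp_sum_le [IsProbabilityMeasure P] {S : ℕ → Ω → ℝ} {b v : ℕ → ℝ} {a lam : ℝ}
    {𝓐 𝓑 : ℕ → MeasurableSpace Ω} (h𝓐 : ∀ j, 𝓐 j ≤ mΩ) (h𝓑 : ∀ j, 𝓑 j ≤ mΩ)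
    (hdep : ∀ j, DependenceLE P (𝓐 j) (𝓑 j) a) (hSA : ∀ i j, i < j → Measurable[𝓐 j] (S i))
    (hSB : ∀ j, Measurable[𝓑 j] (S j)) (hb : ∀ j ω, |S j ω| ≤ b j)
    (h0 : ∀ j, ∫ ω, S j ω ∂P = 0) (hv : ∀ j, ∫ ω, S j ω ^ 2 ∂P ≤ v j) (hlam : 0 ≤ lam)
    (hlb : ∀ j, lam * b j ≤ 1) {L : NNReal} (q : ℕ) :
    ∀ (φ : ℝ → ℝ) (c : ℝ), LipschitzWith L φ → (∀ y, |φ y| ≤ 1) → 0 ≤ c →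
      (∀ y, φ y ≤ c * Real.exp (lam * y)) →
      ∫ ω, φ (∑ j ∈ Finset.range q, S j ω) ∂P ≤
        c * Real.exp (lam ^ 2 * ∑ j ∈ Finset.range q, v j) +
          4 * L * a * ∑ j ∈ Finset.range q, b j := by
  induction q with
  | zero =>
    intro φ c _ _ _ hφe
    simpa using hφe 0
  | succ q ih =>
    intro φ c hφ hφ1 hc hφe
    have hSm : Measurable (S q) := (hSB q).mono (h𝓑 q) le_rfl
    have hYA : Measurable[𝓐 q] fun ω => ∑ j ∈ Finset.range q, S j ω :=
      Finset.measurable_fun_sum _ fun i hi => hSA i q (Finset.mem_range.1 hi)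
    have hrep := (hdep q).integral_comp_add_sub_le (h𝓐 q) (h𝓑 q) hYA (hSB q) (hb q) hφ hφ1
    have hie : Integrable (fun ω => Real.exp (lam * S q ω)) P :=
      integrable_of_abs_le (M := Real.exp 1) ((hSm.const_mul lam).exp) fun ω => by
        rw [Real.abs_exp]
        refine Real.exp_le_exp.2 (le_trans ?_ (hlb q))
        exact mul_le_mul_of_nonneg_left ((le_abs_self _).trans (hb q ω)) hlam
    -- The last summand has been replaced by an independent copy (`hrep`) and is integrated into the
    -- test function. Lipschitz constant and sup bound are unchanged, and the exponential majorant
    -- gains the factor `exp (lam^2 v_q)`.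
    have hstep := ih (fun y => ∫ ω, φ (y + S q ω) ∂P) (c * Real.exp (lam ^ 2 * v q))
      (lipschitzWith_integral_comp_add hSm hφ hφ1)
      (fun y => by
        simpa using norm_integral_le_of_norm_le_const (μ := P) (f := fun ω => φ (y + S q ω))
          (C := 1) (Eventually.of_forall fun ω => hφ1 _))
      (by positivity)
      (fun y => by
        calc ∫ ω, φ (y + S q ω) ∂P ≤ ∫ ω, c * Real.exp (lam * y) * Real.exp (lam * S q ω) ∂P := by
              refine integral_mono ?_ (hie.const_mul _) fun ω => ?_
              · exact integrable_of_abs_le (hφ.continuous.measurable.comp (hSm.const_add y))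
                  fun ω => hφ1 _
              · refine (hφe _).trans (le_of_eq ?_)
                rw [mul_add, Real.exp_add, mul_assoc]
          _ = c * Real.exp (lam * y) * ∫ ω, Real.exp (lam * S q ω) ∂P := integral_const_mul _ _
          _ ≤ c * Real.exp (lam * y) * Real.exp (lam ^ 2 * v q) := by
              gcongr
              exact integral_exp_le_of_sq hSm (hb q) (h0 q) (hv q) hlam (hlb q)
          _ = _ := by ring)
    rw [mul_assoc c, ← Real.exp_add] at hstep
    simp only [Finset.sum_range_succ]
    have h1 := (abs_le.1 hrep).2
    have e : lam ^ 2 * v q + lam ^ 2 * ∑ j ∈ Finset.range q, v j =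
      lam ^ 2 * (∑ j ∈ Finset.range q, v j + v q) := by ring
    rw [e] at hstep
    nlinarith

/-- A Bernstein inequality for a sum of weakly dependent bounded variables. -/
theorem measureReal_le_sum_le [IsProbabilityMeasure P] {S : ℕ → Ω → ℝ} {b v : ℕ → ℝ}
    {a lam ε : ℝ} {𝓐 𝓑 : ℕ → MeasurableSpace Ω} (h𝓐 : ∀ j, 𝓐 j ≤ mΩ) (h𝓑 : ∀ j, 𝓑 j ≤ mΩ)
    (hdep : ∀ j, DependenceLE P (𝓐 j) (𝓑 j) a) (hSA : ∀ i j, i < j → Measurable[𝓐 j] (S i))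
    (hSB : ∀ j, Measurable[𝓑 j] (S j)) (hb : ∀ j ω, |S j ω| ≤ b j)
    (h0 : ∀ j, ∫ ω, S j ω ∂P = 0) (hv : ∀ j, ∫ ω, S j ω ^ 2 ∂P ≤ v j) (hlam : 0 ≤ lam)
    (hlb : ∀ j, lam * b j ≤ 1) (hε : 0 < ε) (q : ℕ) :
    P.real {ω | ε ≤ ∑ j ∈ Finset.range q, S j ω} ≤
      Real.exp (lam ^ 2 * ∑ j ∈ Finset.range q, v j - lam * ε / 2) +
        8 * a * (∑ j ∈ Finset.range q, b j) / ε := by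
  -- A ramp from `0` at `ε / 2` to `1` at `ε`: it dominates the indicator of `[ε, ∞)` and is
  -- dominated by `exp (lam (y - ε / 2))`. Its Lipschitz constant `2 / ε` produces the factor `8 /
  -- ε` in front of the mixing error.
  set φ : ℝ → ℝ := fun x => max 0 (min 1 (2 / ε * x - 1)) with hφdef
  have hφ : LipschitzWith (Real.toNNReal (2 / ε)) φ := by
    have h1 : LipschitzWith (Real.toNNReal (2 / ε)) fun x : ℝ => 2 / ε * x - 1 :=
      LipschitzWith.of_dist_le_mul fun x y => by
        rw [Real.dist_eq, Real.dist_eq, Real.coe_toNNReal _ (by positivity)]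
        rw [show 2 / ε * x - 1 - (2 / ε * y - 1) = 2 / ε * (x - y) by ring, abs_mul,
          abs_of_pos (by positivity : 0 < 2 / ε)]
    exact (h1.const_min 1).const_max 0
  have hφ0 : ∀ y, 0 ≤ φ y := fun y => le_max_left _ _
  have hφle : ∀ y, φ y ≤ 1 := fun y => max_le zero_le_one (min_le_left _ _)
  have hφ1 : ∀ y, |φ y| ≤ 1 := fun y => by rw [abs_of_nonneg (hφ0 y)]; exact hφle y
  have hφe : ∀ y, φ y ≤ Real.exp (-(lam * ε / 2)) * Real.exp (lam * y) := by
    intro y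
    rw [← Real.exp_add]
    by_cases hy : y ≤ ε / 2
    · have : φ y = 0 := by
        have : 2 / ε * y - 1 ≤ 0 := by
          have : 2 / ε * y ≤ 2 / ε * (ε / 2) := by gcongr
          have e : 2 / ε * (ε / 2) = 1 := by field_simp
          linarith
        simp only [hφdef]
        exact max_eq_left ((min_le_right _ _).trans this)
      rw [this]; positivity
    · refine (hφle y).trans (Real.one_le_exp ?_)
      nlinarith [not_le.1 hy]
  have key := integral_comp_sum_le h𝓐 h𝓑 hdep hSA hSB hb h0 hv hlam hlb q φ _ hφ hφ1
    (Real.exp_pos _).le hφe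
  have hYm : Measurable fun ω => ∑ j ∈ Finset.range q, S j ω :=
    Finset.measurable_fun_sum _ fun i _ => (hSB i).mono (h𝓑 i) le_rfl
  have hms : MeasurableSet {ω | ε ≤ ∑ j ∈ Finset.range q, S j ω} :=
    measurableSet_le measurable_const hYm
  have hmarkov : P.real {ω | ε ≤ ∑ j ∈ Finset.range q, S j ω} ≤
      ∫ ω, φ (∑ j ∈ Finset.range q, S j ω) ∂P := by
    have : P.real {ω | ε ≤ ∑ j ∈ Finset.range q, S j ω} =
        ∫ ω, {ω | ε ≤ ∑ j ∈ Finset.range q, S j ω}.indicator (fun _ => (1 : ℝ)) ω ∂P := by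
      rw [integral_indicator hms]; simp
    rw [this]
    refine integral_mono ((integrable_const 1).indicator hms)
      (integrable_of_abs_le (hφ.continuous.measurable.comp hYm) fun ω => hφ1 _) fun ω => ?_
    by_cases hω : ε ≤ ∑ j ∈ Finset.range q, S j ω
    · have : φ (∑ j ∈ Finset.range q, S j ω) = 1 := by
        have h1 : 1 ≤ 2 / ε * ∑ j ∈ Finset.range q, S j ω - 1 := by
          have : 2 / ε * ε ≤ 2 / ε * ∑ j ∈ Finset.range q, S j ω := by gcongr
          have e : 2 / ε * ε = 2 := by field_simp
          linarith
        simp only [hφdef, min_eq_left h1]; simp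
      simp only [this]
      exact Set.indicator_le_self' (fun _ _ => zero_le_one) ω
    · simp only
      rw [Set.indicator_of_notMem (s := {ω | ε ≤ ∑ j ∈ Finset.range q, S j ω}) hω]; exact hφ0 _
  refine (hmarkov.trans key).trans (le_of_eq ?_)
  rw [← Real.exp_add, Real.coe_toNNReal _ (by positivity)]
  congr 1
  · congr 1; ring
  · ring

end Mixing

end LocLin

/-! ### Blocking and a Bernstein inequality for mixing sequences -/

namespace LocLin

section Mixing

variable {Ω : Type*} {m₁ m₂ m₁' m₂' : MeasurableSpace Ω} {mΩ : MeasurableSpace Ω} {P : Measure Ω}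

theorem dependenceLE_bot_left [IsProbabilityMeasure P] {a : ℝ} (ha : 0 ≤ a) :
    DependenceLE P ⊥ m₂ a := by
  intro B C hB _
  rcases MeasurableSpace.measurableSet_bot_iff.1 hB with rfl | rfl <;> simpa using ha

theorem dependenceLE_bot_right [IsProbabilityMeasure P] {a : ℝ} (ha : 0 ≤ a) :
    DependenceLE P m₁ ⊥ a :=
  (dependenceLE_bot_left ha).symm

/-- With truncated subtraction `(t - t') + (t' - t)` is the distance `|t - t'|`, and each distance
occurs at most once on either side of `t`. -/
theorem sum_dist_le {w : ℕ → ℝ} {W : ℝ} (hw : ∀ l, 0 ≤ w l)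
    (hW : ∀ n, ∑ l ∈ Finset.range n, w l ≤ W) (A : Finset ℕ) (t : ℕ) :
    ∑ t' ∈ A, w ((t - t') + (t' - t)) ≤ 2 * W := by
  have hsub : ∀ B : Finset ℕ, ∑ l ∈ B, w l ≤ W := fun B => by
    obtain ⟨n, hn⟩ := B.exists_nat_subset_range
    exact (Finset.sum_le_sum_of_subset_of_nonneg hn fun l _ _ => hw l).trans (hW n)
  rw [← Finset.sum_filter_add_sum_filter_not A (fun t' => t' ≤ t)]
  have h1 : ∑ t' ∈ A with t' ≤ t, w ((t - t') + (t' - t)) ≤ W := by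
    refine le_trans (le_of_eq ?_) (hsub ((A.filter (fun t' => t' ≤ t)).image fun t' => t - t'))
    rw [Finset.sum_image]
    · refine Finset.sum_congr rfl fun t' ht' => ?_
      have := (Finset.mem_filter.1 ht').2
      congr 1; omega
    · intro x hx y hy hxy
      have h1 := (Finset.mem_filter.1 hx).2
      have h2 := (Finset.mem_filter.1 hy).2
      simp only at hxy
      omega
  have h2 : ∑ t' ∈ A with ¬ t' ≤ t, w ((t - t') + (t' - t)) ≤ W := by
    refine le_trans (le_of_eq ?_) (hsub ((A.filter (fun t' => ¬ t' ≤ t)).image fun t' => t' - t))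
    rw [Finset.sum_image]
    · refine Finset.sum_congr rfl fun t' ht' => ?_
      have := (Finset.mem_filter.1 ht').2
      congr 1; omega
    · intro x hx y hy hxy
      have h1 := (Finset.mem_filter.1 hx).2
      have h2 := (Finset.mem_filter.1 hy).2
      simp only at hxy
      omega
  linarith

/-- Variance of a sum with summable covariances, when only the indices in `𝒜` contribute. -/
theorem integral_sq_sum_centered_le [IsProbabilityMeasure P] {Z : ℕ → Ω → ℝ} {B 𝒜 : Finset ℕ}
    {b D W : ℝ} {w : ℕ → ℝ} (hZ : ∀ t ∈ B, Measurable (Z t)) (hb : ∀ t ∈ B, ∀ ω, |Z t ω| ≤ b)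
    (h𝒜 : ∀ t ∈ B, t ∉ 𝒜 → ∀ ω, Z t ω = 0) (hD : 0 ≤ D) (hw : ∀ l, 0 ≤ w l)
    (hW : ∀ n, ∑ l ∈ Finset.range n, w l ≤ W)
    (hcov : ∀ t ∈ B, ∀ t' ∈ B, |∫ ω, Z t ω * Z t' ω ∂P - (∫ ω, Z t ω ∂P) * ∫ ω, Z t' ω ∂P| ≤
      D * w ((t - t') + (t' - t))) :
    ∫ ω, (∑ t ∈ B, (Z t ω - ∫ ω', Z t ω' ∂P)) ^ 2 ∂P ≤ (B ∩ 𝒜).card * (2 * D * W) := by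
  have hi : ∀ t ∈ B, Integrable (Z t) P := fun t ht => integrable_of_abs_le (hZ t ht) (hb t ht)
  have hij : ∀ t ∈ B, ∀ t' ∈ B, Integrable (fun ω => Z t ω * Z t' ω) P := fun t ht t' ht' =>
    integrable_of_abs_le (M := b * b) ((hZ t ht).mul (hZ t' ht')) fun ω => by
      rw [abs_mul]
      exact mul_le_mul (hb t ht ω) (hb t' ht' ω) (abs_nonneg _)
        ((abs_nonneg _).trans (hb t ht ω))
  have hexp : ∀ t t' ω, (Z t ω - ∫ ω', Z t ω' ∂P) * (Z t' ω - ∫ ω', Z t' ω' ∂P) =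
      Z t ω * Z t' ω - (∫ ω', Z t' ω' ∂P) * Z t ω - (∫ ω', Z t ω' ∂P) * Z t' ω +
        (∫ ω', Z t ω' ∂P) * ∫ ω', Z t' ω' ∂P := fun t t' ω => by ring
  have hint2 : ∀ t ∈ B, ∀ t' ∈ B, Integrable (fun ω => Z t ω * Z t' ω -
      (∫ ω', Z t' ω' ∂P) * Z t ω - (∫ ω', Z t ω' ∂P) * Z t' ω) P := fun t ht t' ht' =>
    ((hij t ht t' ht').sub ((hi t ht).const_mul _)).sub ((hi t' ht').const_mul _)
  have hprod : ∀ t ∈ B, ∀ t' ∈ B,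
      Integrable (fun ω => (Z t ω - ∫ ω', Z t ω' ∂P) * (Z t' ω - ∫ ω', Z t' ω' ∂P)) P := by
    intro t ht t' ht'
    simp_rw [hexp]
    exact (hint2 t ht t' ht').add (integrable_const _)
  have hval : ∀ t ∈ B, ∀ t' ∈ B,
      ∫ ω, (Z t ω - ∫ ω', Z t ω' ∂P) * (Z t' ω - ∫ ω', Z t' ω' ∂P) ∂P =
        ∫ ω, Z t ω * Z t' ω ∂P - (∫ ω, Z t ω ∂P) * ∫ ω, Z t' ω ∂P := by
    intro t ht t' ht'
    simp_rw [hexp]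
    have i1 := hij t ht t' ht'
    have i2 := (hi t ht).const_mul (∫ ω', Z t' ω' ∂P)
    have i3 := (hi t' ht').const_mul (∫ ω', Z t ω' ∂P)
    have i4 : Integrable (fun ω => Z t ω * Z t' ω - (∫ ω', Z t' ω' ∂P) * Z t ω) P := i1.sub i2
    rw [integral_add (hint2 t ht t' ht') (integrable_const _), integral_sub i4 i3,
      integral_sub i1 i2, integral_const_mul, integral_const_mul]
    simp only [integral_const, probReal_univ, one_smul]
    ring
  simp_rw [sq, Finset.sum_mul_sum]
  rw [integral_finsetSum _ fun t ht => integrable_finsetSum _ fun t' ht' => hprod t ht t' ht']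
  -- The variance is the sum of the rows of the covariance matrix. A row with `t ∈ 𝒜` costs at most
  -- `2 D W`; outside `𝒜` the variable is identically zero. Hence the count of active times, rather
  -- than of all of `B`.
  have hrow : ∀ t ∈ B, ∫ ω, ∑ t' ∈ B, (Z t ω - ∫ ω', Z t ω' ∂P) * (Z t' ω - ∫ ω', Z t' ω' ∂P) ∂P ≤
      if t ∈ 𝒜 then 2 * D * W else 0 := by
    intro t ht
    split_ifs with hA
    · rw [integral_finsetSum _ fun t' ht' => hprod t ht t' ht']
      calc ∑ t' ∈ B, ∫ ω, (Z t ω - ∫ ω', Z t ω' ∂P) * (Z t' ω - ∫ ω', Z t' ω' ∂P) ∂P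
          ≤ ∑ t' ∈ B, D * w ((t - t') + (t' - t)) := by
            refine Finset.sum_le_sum fun t' ht' => ?_
            rw [hval t ht t' ht']
            exact (le_abs_self _).trans (hcov t ht t' ht')
        _ ≤ D * (2 * W) := by
            rw [← Finset.mul_sum]
            exact mul_le_mul_of_nonneg_left (sum_dist_le hw hW B t) hD
        _ = _ := by ring
    · simp [h𝒜 t ht hA]
  refine (Finset.sum_le_sum hrow).trans (le_of_eq ?_)
  rw [← Finset.sum_filter, Finset.sum_const, Finset.filter_mem_eq_inter, nsmul_eq_mul]

/-- The times of `{1, …, T}` in the block with index `i` of length `m`. -/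
def timeBlock (T m i : ℕ) : Finset ℕ := {t ∈ Finset.Icc 1 T | (t - 1) / m = i}

theorem mem_timeBlock {T m i t : ℕ} (hm : 1 ≤ m) :
    t ∈ timeBlock T m i ↔ (1 ≤ t ∧ t ≤ T) ∧ i * m + 1 ≤ t ∧ t ≤ i * m + m := by
  simp only [timeBlock, Finset.mem_filter, Finset.mem_Icc]
  refine and_congr_right fun ⟨h1, h2⟩ => ?_
  rw [Nat.div_eq_iff (by omega)]
  omega

theorem card_timeBlock_le {T m i : ℕ} (hm : 1 ≤ m) : (timeBlock T m i).card ≤ m := by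
  refine (Finset.card_le_card (t := Finset.Icc (i * m + 1) (i * m + m)) fun t ht => ?_).trans
    (by simp)
  exact Finset.mem_Icc.2 ((mem_timeBlock hm).1 ht).2

/-- The block index `(t - 1) / m` is split by parity. Since it is at most `T`, the range `T + 1` of
half-indices suffices; indices beyond the last block contribute empty sums. -/
theorem sum_timeBlock {T m : ℕ} (f : ℕ → ℝ) :
    ∑ t ∈ Finset.Icc 1 T, f t = ∑ j ∈ Finset.range (T + 1), ∑ t ∈ timeBlock T m (2 * j), f t +
      ∑ j ∈ Finset.range (T + 1), ∑ t ∈ timeBlock T m (2 * j + 1), f t := by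
  rw [← Finset.sum_filter_add_sum_filter_not _ (fun t => ((t - 1) / m) % 2 = 0)]
  have hdiv : ∀ t ∈ Finset.Icc 1 T, (t - 1) / m ≤ T := fun t ht =>
    (Nat.div_le_self _ _).trans (by have := Finset.mem_Icc.1 ht; omega)
  congr 1
  · rw [← Finset.sum_fiberwise_of_maps_to (g := fun t => ((t - 1) / m) / 2)
      (t := Finset.range (T + 1))]
    · refine Finset.sum_congr rfl fun j _ => Finset.sum_congr ?_ fun _ _ => rfl
      ext t
      simp only [timeBlock, Finset.mem_filter, and_assoc]
      refine and_congr_right fun _ => ?_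
      omega
    · intro t ht
      have := hdiv t (Finset.mem_filter.1 ht).1
      simp only [Finset.mem_range]; omega
  · rw [← Finset.sum_fiberwise_of_maps_to (g := fun t => ((t - 1) / m) / 2)
      (t := Finset.range (T + 1))]
    · refine Finset.sum_congr rfl fun j _ => Finset.sum_congr ?_ fun _ _ => rfl
      ext t
      simp only [timeBlock, Finset.mem_filter, and_assoc]
      refine and_congr_right fun _ => ?_
      omega
    · intro t ht
      have := hdiv t (Finset.mem_filter.1 ht).1
      simp only [Finset.mem_range]; omega

theorem sum_timeBlock_parity_le {T m p : ℕ} (hp : p ≤ 1) {f : ℕ → ℝ} (hf : ∀ t, 0 ≤ f t) :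
    ∑ j ∈ Finset.range (T + 1), ∑ t ∈ timeBlock T m (2 * j + p), f t ≤
      ∑ t ∈ Finset.Icc 1 T, f t := by
  have h := sum_timeBlock (T := T) (m := m) f
  have hn : ∀ p, 0 ≤ ∑ j ∈ Finset.range (T + 1), ∑ t ∈ timeBlock T m (2 * j + p), f t :=
    fun p => Finset.sum_nonneg fun _ _ => Finset.sum_nonneg fun t _ => hf t
  interval_cases p
  · simp only [add_zero]; linarith [hn 1]
  · have := hn 0
    simp only [add_zero] at this; linarith

variable {E : Type*} [MeasurableSpace E]

theorem sigmaBetween_le {V : ℕ → Ω → E} {a b T : ℕ} (hV : ∀ t, 1 ≤ t → t ≤ T → Measurable (V t))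
    (ha : 1 ≤ a) (hb : b ≤ T) : sigmaBetween V a b ≤ mΩ :=
  iSup₂_le fun t ht => (hV t (ha.trans ht.1) (ht.2.trans hb)).comap_le

theorem sigmaBetween_mono {V : ℕ → Ω → E} {a b a' b' : ℕ} (ha : a' ≤ a) (hb : b ≤ b') :
    sigmaBetween V a b ≤ sigmaBetween V a' b' :=
  iSup₂_le fun t ht => le_iSup₂_of_le t ⟨ha.trans ht.1, ht.2.trans hb⟩ le_rfl

theorem comap_le_sigmaBetween {V : ℕ → Ω → E} {a b t : ℕ} (ha : a ≤ t) (hb : t ≤ b) :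
    MeasurableSpace.comap (V t) inferInstance ≤ sigmaBetween V a b :=
  le_iSup₂_of_le t ⟨ha, hb⟩ le_rfl

theorem sigmaBetween_eq_bot {V : ℕ → Ω → E} {a b : ℕ} (h : b < a) : sigmaBetween V a b = ⊥ :=
  le_bot_iff.1 (iSup₂_le fun _ ht => absurd (ht.1.trans ht.2) (not_le.2 h))

/-- Upper deviations of every other block of a mixing sequence. -/
theorem measureReal_le_sum_parity_le [IsProbabilityMeasure P] {V : ℕ → Ω → E} {T m p : ℕ}
    (hp : p ≤ 1) (hm : 1 ≤ m) (hV : ∀ t, 1 ≤ t → t ≤ T → Measurable (V t)) {Z : ℕ → Ω → ℝ}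
    (hZ : ∀ t ∈ Finset.Icc 1 T, Measurable[MeasurableSpace.comap (V t) inferInstance] (Z t))
    {a b D W lam ε : ℝ} {w : ℕ → ℝ} {𝒜 : Finset ℕ} (hb0 : 0 ≤ b)
    (hb : ∀ t ∈ Finset.Icc 1 T, ∀ ω, |Z t ω| ≤ b)
    (h𝒜 : ∀ t ∈ Finset.Icc 1 T, t ∉ 𝒜 → ∀ ω, Z t ω = 0) (hD : 0 ≤ D) (hw : ∀ l, 0 ≤ w l)
    (hW : ∀ n, ∑ l ∈ Finset.range n, w l ≤ W)
    (hcov : ∀ t ∈ Finset.Icc 1 T, ∀ t' ∈ Finset.Icc 1 T,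
      |∫ ω, Z t ω * Z t' ω ∂P - (∫ ω, Z t ω ∂P) * ∫ ω, Z t' ω ∂P| ≤
        D * w ((t - t') + (t' - t)))
    (ha : 0 ≤ a) (hdep : ∀ t, 1 ≤ t → t + m ≤ T →
      DependenceLE P (sigmaBetween V 1 t) (sigmaBetween V (t + m) T) a)
    (hlam : 0 ≤ lam) (hlb : lam * (2 * b * m) ≤ 1) (hε : 0 < ε) :
    P.real {ω | ε ≤ ∑ j ∈ Finset.range (T + 1), ∑ t ∈ timeBlock T m (2 * j + p),
        (Z t ω - ∫ ω', Z t ω' ∂P)} ≤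
      Real.exp (lam ^ 2 * (𝒜.card * (2 * D * W)) - lam * ε / 2) + 16 * a * b * T / ε := by
  have hB : ∀ i t, t ∈ timeBlock T m i → t ∈ Finset.Icc 1 T := fun i t ht =>
    (Finset.mem_filter.1 ht).1
  have hW0 : 0 ≤ W := by simpa using hW 0
  have hZm : ∀ t ∈ Finset.Icc 1 T, Measurable (Z t) := fun t ht =>
    (hZ t ht).mono (hV t (Finset.mem_Icc.1 ht).1 (Finset.mem_Icc.1 ht).2).comap_le le_rfl
  have hEb : ∀ t ∈ Finset.Icc 1 T, |∫ ω, Z t ω ∂P| ≤ b := fun t ht => by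
    simpa using norm_integral_le_of_norm_le_const (μ := P) (f := Z t) (C := b)
      (Eventually.of_forall (hb t ht))
  set S : ℕ → Ω → ℝ := fun j ω =>
    ∑ t ∈ timeBlock T m (2 * j + p), (Z t ω - ∫ ω', Z t ω' ∂P) with hS
  have key := measureReal_le_sum_le (P := P) (S := S) (a := a) (lam := lam) (ε := ε)
    (b := fun j => ∑ t ∈ timeBlock T m (2 * j + p), 2 * b)
    (v := fun j => ∑ t ∈ timeBlock T m (2 * j + p), if t ∈ 𝒜 then 2 * D * W else 0)
    -- The preceding block of the same parity ends at time `(2 j + p - 1) m`, and the present one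
    -- starts at `(2 j + p) m + 1`, so more than `m` steps separate them. For `j = 0` the end point
    -- is `0` (by truncated subtraction if `p = 0`), and the past is trivial.
    (𝓐 := fun j => sigmaBetween V 1 (min T ((2 * j + p - 1) * m)))
    (𝓑 := fun j => sigmaBetween V ((2 * j + p) * m + 1) T)
    (fun j => sigmaBetween_le hV le_rfl (min_le_left _ _))
    (fun j => sigmaBetween_le hV (by omega) le_rfl) ?_ ?_ ?_ ?_ ?_ ?_ hlam ?_ hε (T + 1)
  · refine key.trans (add_le_add (Real.exp_le_exp.2 ?_) ?_)
    · have : ∑ j ∈ Finset.range (T + 1), ∑ t ∈ timeBlock T m (2 * j + p),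
          (if t ∈ 𝒜 then 2 * D * W else 0) ≤ 𝒜.card * (2 * D * W) := by
        refine (sum_timeBlock_parity_le hp fun t => by split_ifs <;> positivity).trans ?_
        rw [← Finset.sum_filter, Finset.sum_const, nsmul_eq_mul]
        gcongr
        intro t ht; exact (Finset.mem_filter.1 ht).2
      gcongr
    · have : ∑ j ∈ Finset.range (T + 1), ∑ t ∈ timeBlock T m (2 * j + p), 2 * b ≤ T * (2 * b) := by
        refine (sum_timeBlock_parity_le hp fun _ => by positivity).trans ?_
        simp
      calc 8 * a * (∑ j ∈ Finset.range (T + 1), ∑ t ∈ timeBlock T m (2 * j + p), 2 * b) / ε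
          ≤ 8 * a * (T * (2 * b)) / ε := by gcongr
        _ = _ := by ring
  · intro j
    by_cases h0 : (2 * j + p - 1) * m = 0
    · rw [h0, Nat.min_zero, sigmaBetween_eq_bot (by omega)]
      exact dependenceLE_bot_left ha
    · have hq : 2 * j + p - 1 + 1 = 2 * j + p := by
        have : 2 * j + p - 1 ≠ 0 := fun h => h0 (by rw [h, zero_mul])
        omega
      have hq' : (2 * j + p) * m = (2 * j + p - 1) * m + m := by
        rw [← hq]; simp only [Nat.add_sub_cancel]; ring
      by_cases h1 : (2 * j + p - 1) * m + m ≤ T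
      · rw [min_eq_right (by omega)]
        exact (hdep _ (by omega) h1).mono le_rfl (sigmaBetween_mono (by omega) le_rfl)
      · rw [sigmaBetween_eq_bot (a := (2 * j + p) * m + 1) (by omega)]
        exact dependenceLE_bot_right ha
  · intro i j hij
    refine Finset.measurable_fun_sum _ fun t ht => Measurable.sub_const ?_ _
    have h1 := (mem_timeBlock hm).1 ht
    refine (hZ t (hB _ t ht)).mono (comap_le_sigmaBetween h1.1.1 (le_min h1.1.2 ?_)) le_rfl
    have h2 : (2 * i + p + 1) * m ≤ (2 * j + p - 1) * m := Nat.mul_le_mul_right _ (by omega)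
    have h3 : (2 * i + p + 1) * m = (2 * i + p) * m + m := by ring
    omega
  · intro j
    refine Finset.measurable_fun_sum _ fun t ht => Measurable.sub_const ?_ _
    have h1 := (mem_timeBlock hm).1 ht
    exact (hZ t (hB _ t ht)).mono (comap_le_sigmaBetween h1.2.1 h1.1.2) le_rfl
  · intro j ω
    refine (Finset.abs_sum_le_sum_abs _ _).trans (Finset.sum_le_sum fun t ht => ?_)
    refine (abs_sub _ _).trans ?_
    have := hb t (hB _ t ht) ω
    have := hEb t (hB _ t ht)
    linarith
  · intro j
    have hi : ∀ t ∈ timeBlock T m (2 * j + p), Integrable (Z t) P := fun t ht =>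
      integrable_of_abs_le (hZm t (hB _ t ht)) (hb t (hB _ t ht))
    have hi' : ∀ t ∈ timeBlock T m (2 * j + p),
        Integrable (fun ω => Z t ω - ∫ ω', Z t ω' ∂P) P := fun t ht =>
      (hi t ht).sub (integrable_const _)
    rw [hS]
    simp only
    rw [integral_finsetSum _ hi']
    refine Finset.sum_eq_zero fun t ht => ?_
    rw [integral_sub (hi t ht) (integrable_const _)]
    simp
  · intro j
    refine (integral_sq_sum_centered_le (𝒜 := 𝒜) (D := D) (W := W) (w := w)
      (fun t ht => hZm t (hB _ t ht)) (fun t ht => hb t (hB _ t ht))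
      (fun t ht => h𝒜 t (hB _ t ht)) hD hw hW
      (fun t ht t' ht' => hcov t (hB _ t ht) t' (hB _ t' ht'))).trans (le_of_eq ?_)
    rw [← Finset.sum_filter, Finset.sum_const, Finset.filter_mem_eq_inter, nsmul_eq_mul]
  · intro j
    refine le_trans ?_ hlb
    refine mul_le_mul_of_nonneg_left ?_ hlam
    rw [Finset.sum_const, nsmul_eq_mul, mul_comm]
    have : ((timeBlock T m (2 * j + p)).card : ℝ) ≤ m := by exact_mod_cast card_timeBlock_le hm
    gcongr

/-- A Bernstein inequality for sums of a mixing sequence with summable covariances. -/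
theorem measureReal_lt_abs_sum_le [IsProbabilityMeasure P] {V : ℕ → Ω → E} {T m : ℕ}
    (hm : 1 ≤ m) (hV : ∀ t, 1 ≤ t → t ≤ T → Measurable (V t)) {Z : ℕ → Ω → ℝ}
    (hZ : ∀ t ∈ Finset.Icc 1 T, Measurable[MeasurableSpace.comap (V t) inferInstance] (Z t))
    {a b D W lam ε : ℝ} {w : ℕ → ℝ} {𝒜 : Finset ℕ} (hb0 : 0 ≤ b)
    (hb : ∀ t ∈ Finset.Icc 1 T, ∀ ω, |Z t ω| ≤ b)
    (h𝒜 : ∀ t ∈ Finset.Icc 1 T, t ∉ 𝒜 → ∀ ω, Z t ω = 0) (hD : 0 ≤ D) (hw : ∀ l, 0 ≤ w l)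
    (hW : ∀ n, ∑ l ∈ Finset.range n, w l ≤ W)
    (hcov : ∀ t ∈ Finset.Icc 1 T, ∀ t' ∈ Finset.Icc 1 T,
      |∫ ω, Z t ω * Z t' ω ∂P - (∫ ω, Z t ω ∂P) * ∫ ω, Z t' ω ∂P| ≤
        D * w ((t - t') + (t' - t)))
    (ha : 0 ≤ a) (hdep : ∀ t, 1 ≤ t → t + m ≤ T →
      DependenceLE P (sigmaBetween V 1 t) (sigmaBetween V (t + m) T) a)
    (hlam : 0 ≤ lam) (hlb : lam * (2 * b * m) ≤ 1) (hε : 0 < ε) :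
    P.real {ω | ε < |∑ t ∈ Finset.Icc 1 T, (Z t ω - ∫ ω', Z t ω' ∂P)|} ≤
      4 * Real.exp (lam ^ 2 * (𝒜.card * (2 * D * W)) - lam * ε / 4) + 128 * a * b * T / ε := by
  have hε2 : 0 < ε / 2 := by positivity
  have hpos := fun (p : ℕ) (hp : p ≤ 1) => measureReal_le_sum_parity_le hp hm hV hZ hb0 hb h𝒜 hD
    hw hW hcov ha hdep hlam hlb hε2
  have hneg := fun (p : ℕ) (hp : p ≤ 1) => measureReal_le_sum_parity_le (Z := fun t ω => -Z t ω)
    (𝒜 := 𝒜) (D := D) (W := W) (w := w) hp hm hV (fun t ht => (hZ t ht).neg) hb0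
    (fun t ht ω => by rw [abs_neg]; exact hb t ht ω)
    (fun t ht hA ω => by rw [h𝒜 t ht hA ω, neg_zero]) hD
    hw hW (fun t ht t' ht' => by
      simpa only [neg_mul_neg, integral_neg] using hcov t ht t' ht') ha hdep hlam hlb hε2
  -- A deviation of the whole sum beyond `ε` forces one parity class to deviate by at least `ε / 2`
  -- in one direction; this gives four events.
  have hsub : {ω | ε < |∑ t ∈ Finset.Icc 1 T, (Z t ω - ∫ ω', Z t ω' ∂P)|} ⊆
      (({ω | ε / 2 ≤ ∑ j ∈ Finset.range (T + 1), ∑ t ∈ timeBlock T m (2 * j + 0),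
        (Z t ω - ∫ ω', Z t ω' ∂P)} ∪ {ω | ε / 2 ≤ ∑ j ∈ Finset.range (T + 1),
          ∑ t ∈ timeBlock T m (2 * j + 1), (Z t ω - ∫ ω', Z t ω' ∂P)}) ∪
      ({ω | ε / 2 ≤ ∑ j ∈ Finset.range (T + 1), ∑ t ∈ timeBlock T m (2 * j + 0),
        (-Z t ω - ∫ ω', -Z t ω' ∂P)} ∪ {ω | ε / 2 ≤ ∑ j ∈ Finset.range (T + 1),
          ∑ t ∈ timeBlock T m (2 * j + 1), (-Z t ω - ∫ ω', -Z t ω' ∂P)})) := by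
    intro ω hω
    simp only [Set.mem_union, Set.mem_ofPred_eq, integral_neg] at hω ⊢
    by_contra! hcon
    have hn : ∀ i, ∑ t ∈ timeBlock T m i, (-Z t ω - -∫ ω', Z t ω' ∂P) =
        -∑ t ∈ timeBlock T m i, (Z t ω - ∫ ω', Z t ω' ∂P) := fun i => by
      rw [← Finset.sum_neg_distrib]; exact Finset.sum_congr rfl fun t _ => by ring
    simp only [hn, Finset.sum_neg_distrib] at hcon
    rw [sum_timeBlock (m := m)] at hω
    simp only [add_zero] at hcon
    refine absurd hω (not_lt.2 (abs_le.2 ⟨?_, ?_⟩)) <;> linarith [hcon.1.1, hcon.1.2, hcon.2.1,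
      hcon.2.2]
  refine (measureReal_mono hsub).trans ((measureReal_union_le _ _).trans (((add_le_add
    (measureReal_union_le _ _) (measureReal_union_le _ _)).trans (add_le_add
    (add_le_add (hpos 0 zero_le_one) (hpos 1 le_rfl))
    (add_le_add (hneg 0 zero_le_one) (hneg 1 le_rfl)))).trans (le_of_eq ?_)))
  have e : lam ^ 2 * (𝒜.card * (2 * D * W)) - lam * (ε / 2) / 2 =
    lam ^ 2 * (𝒜.card * (2 * D * W)) - lam * ε / 4 := by ring
  rw [e]
  field_simp
  ring

end Mixing

end LocLin

/-! ### Small-ball moments from the densities, and interpolated covariance bounds -/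

namespace LocLin

section Moments

variable {Ω : Type*} {mΩ : MeasurableSpace Ω} {P : Measure Ω}

/-- Disintegrating the joint law of `(Z, Y)` along `Z`, whose law has density `pdf`, turns the
expectation into the integral of `condMean * pdf` over `Q`. -/
theorem setLIntegral_preimage_le_of_condMean [IsProbabilityMeasure P] {E : Type*}
    [MeasurableSpace E] {μ : Measure E} {Z : Ω → E} {Y : Ω → ℝ≥0∞} [HasPDF Z P μ]
    (hZ : Measurable Z) (hY : Measurable Y) {Q : Set E} (hQ : MeasurableSet Q) {c : ℝ≥0∞}
    (h : ∀ᵐ z ∂μ, z ∈ Q → condMean P Y Z z * pdf Z P μ z ≤ c) :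
    ∫⁻ ω in Z ⁻¹' Q, Y ω ∂P ≤ c * μ Q := by
  have hcm : Measurable (condMean P Y Z) := by
    unfold condMean
    exact measurable_id.lintegral_kernel
  have e1 : ∫⁻ ω in Z ⁻¹' Q, Y ω ∂P =
      ∫⁻ p in Q ×ˢ Set.univ, p.2 ∂(P.map fun ω => (Z ω, Y ω)) := by
    rw [setLIntegral_map (hQ.prod MeasurableSet.univ) measurable_snd (hZ.prodMk hY)]
    congr 2
    ext ω; simp
  rw [e1, ← compProd_map_condDistrib hY.aemeasurable,
    Measure.setLIntegral_compProd measurable_snd hQ MeasurableSet.univ]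
  simp only [Measure.restrict_univ]
  change ∫⁻ z in Q, condMean P Y Z z ∂(P.map Z) ≤ _
  rw [map_eq_withDensity_pdf Z P μ, setLIntegral_withDensity_eq_setLIntegral_mul _
    (measurable_pdf Z P μ) hcm hQ]
  refine (setLIntegral_mono_ae' (g := fun _ => c) hQ (h.mono fun z hz hzQ => ?_)).trans ?_
  · rw [Pi.mul_apply, mul_comm]; exact hz hzQ
  · rw [setLIntegral_const]

/-- Bounds for the probabilities and moments localised to small balls inside the ball of radius
`ρ` around the origin. -/
structure LocalMoments {d : ℕ} (P : Measure Ω) (X : ℕ → ℕ → Ω → Fin d → ℝ) (R : ℕ → ℕ → Ω → ℝ)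
    (s ρ C : ℝ) (lstar : ℕ) : Prop where
  nonneg : 0 ≤ C
  prob : ∀ T t x r, 1 ≤ t → t ≤ T → 0 ≤ r → Metric.closedBall x r ⊆ Metric.closedBall 0 ρ →
    P (X T t ⁻¹' Metric.closedBall x r) ≤ ENNReal.ofReal (C * (2 * r) ^ d)
  moment : ∀ T t x r, 1 ≤ t → t ≤ T → 0 ≤ r → Metric.closedBall x r ⊆ Metric.closedBall 0 ρ →
    ∫⁻ ω in X T t ⁻¹' Metric.closedBall x r, ‖R T t ω‖ₑ ^ s ∂P ≤ ENNReal.ofReal (C * (2 * r) ^ d)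
  joint : ∀ T t l x r, 1 ≤ t → lstar ≤ l → t + l ≤ T → 0 ≤ r →
    Metric.closedBall x r ⊆ Metric.closedBall 0 ρ →
    ∫⁻ ω in X T t ⁻¹' Metric.closedBall x r ∩ X T (t + l) ⁻¹' Metric.closedBall x r,
      ‖R T t ω‖ₑ * ‖R T (t + l) ω‖ₑ ∂P ≤ ENNReal.ofReal (C * ((2 * r) ^ d) ^ 2)

/-- Balls of the sup norm are cubes of volume `(2 r)^d`, and a pair of them has the squared volume,
so the pointwise bounds on one large compact ball are integrated over cubes inside it. -/
theorem DensityCondition.exists_localMoments [IsProbabilityMeasure P] {d : ℕ}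
    {X : ℕ → ℕ → Ω → Fin d → ℝ} {R : ℕ → ℕ → Ω → ℝ} {s : ℝ}
    (hX : ∀ T t, 1 ≤ t → t ≤ T → Measurable (X T t))
    (hR : ∀ T t, 1 ≤ t → t ≤ T → Measurable (R T t))
    (hK3 : DensityCondition P X R s) (ρ : ℝ) :
    ∃ C lstar, LocalMoments P X R s ρ C lstar := by
  obtain ⟨C, lstar, h1, h2, h3⟩ := hK3.bounds _ (isCompact_closedBall 0 ρ)
  have hle : ENNReal.ofReal C ≤ ENNReal.ofReal (max C 0) :=
    ENNReal.ofReal_le_ofReal (le_max_left _ _)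
  have hvol : ∀ (x : Fin d → ℝ) (r : ℝ), 0 ≤ r →
      volume (Metric.closedBall x r) = ENNReal.ofReal ((2 * r) ^ d) := fun x r hr => by
    rw [Real.volume_pi_closedBall x hr, Fintype.card_fin]
  refine ⟨max C 0, lstar, le_max_right _ _, ?_, ?_, ?_⟩
  · intro T t x r ht htT hr hsub
    have := hK3.hasPDF T t ht htT
    rw [← Measure.map_apply (hX T t ht htT) Metric.isClosed_closedBall.measurableSet,
      map_eq_withDensity_pdf (X T t) P volume, withDensity_apply _
      Metric.isClosed_closedBall.measurableSet, ENNReal.ofReal_mul (le_max_right _ _), ← hvol x r hr,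
      ← setLIntegral_const]
    exact setLIntegral_mono_ae' Metric.isClosed_closedBall.measurableSet
      ((h1 T t ht htT).mono fun z hz hzQ => (hz (hsub hzQ)).trans hle)
  · intro T t x r ht htT hr hsub
    have := hK3.hasPDF T t ht htT
    rw [ENNReal.ofReal_mul (le_max_right _ _), ← hvol x r hr]
    exact setLIntegral_preimage_le_of_condMean (hX T t ht htT)
      ((hR T t ht htT).enorm.pow_const s) Metric.isClosed_closedBall.measurableSet
      ((h2 T t ht htT).mono fun z hz hzQ => (hz (hsub hzQ)).trans hle)
  · intro T t l x r ht hl hlT hr hsub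
    obtain ⟨hpdf, hb⟩ := h3 T t l ht hl hlT
    rw [ENNReal.ofReal_mul (le_max_right _ _), sq, ENNReal.ofReal_mul (by positivity), ← hvol x r hr,
      ← Measure.prod_prod]
    have := setLIntegral_preimage_le_of_condMean (P := P) (μ := volume)
      (Z := fun ω => (X T t ω, X T (t + l) ω)) (Y := fun ω => ‖R T t ω‖ₑ * ‖R T (t + l) ω‖ₑ)
      ((hX T t ht (by omega)).prodMk (hX T (t + l) (by omega) hlT))
      ((hR T t ht (by omega)).enorm.mul (hR T (t + l) (by omega) hlT).enorm)
      (Q := Metric.closedBall x r ×ˢ Metric.closedBall x r)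
      (Metric.isClosed_closedBall.measurableSet.prod Metric.isClosed_closedBall.measurableSet)
      (hb.mono fun z hz hzQ => (hz (hsub hzQ.1) (hsub hzQ.2)).trans hle)
    exact this

theorem MixingCondition.exists_dependenceLE [IsProbabilityMeasure P] {d : ℕ}
    {X : ℕ → ℕ → Ω → Fin d → ℝ} {R : ℕ → ℕ → Ω → ℝ} {s β : ℝ} (h : MixingCondition P X R s β) :
    ∃ A : ℝ, 0 ≤ A ∧ ∀ T t k : ℕ, 1 ≤ k → 1 ≤ t → t + k ≤ T →
      DependenceLE P (sigmaBetween (fun t ω => (X T t ω, R T t ω)) 1 t)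
        (sigmaBetween (fun t ω => (X T t ω, R T t ω)) (t + k) T) (A * (k : ℝ) ^ (-β)) := by
  obtain ⟨A, hA⟩ := h.2
  -- A nonnegative constant allows the inequality to pass from `ENNReal.ofReal` values back to real
  -- numbers.
  refine ⟨max A 0, le_max_right _ _, fun T t k hk ht htT B C hB hC => ?_⟩
  have h0 : A * (k : ℝ) ^ (-β) ≤ max A 0 * (k : ℝ) ^ (-β) :=
    mul_le_mul_of_nonneg_right (le_max_left _ _) (by positivity)
  have h1 : ENNReal.ofReal |P.real (B ∩ C) - P.real B * P.real C| ≤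
      ENNReal.ofReal (max A 0 * (k : ℝ) ^ (-β)) := by
    refine le_trans ?_ ((hA k hk).trans (ENNReal.ofReal_le_ofReal h0))
    unfold arrayAlpha alphaCoeff
    refine le_iSup_of_le T (le_iSup_of_le t (le_iSup_of_le ⟨ht, htT⟩ ?_))
    exact le_iSup₂_of_le B hB (le_iSup₂_of_le C hC le_rfl)
  exact (ENNReal.ofReal_le_ofReal_iff (by positivity)).1 h1

theorem integral_le_of_lintegral_le {f : Ω → ℝ} {g : Ω → ℝ≥0∞} {c : ℝ} (hf : Measurable f)
    (hf0 : ∀ ω, 0 ≤ f ω) (hfg : ∀ ω, ENNReal.ofReal (f ω) ≤ g ω) (hc : 0 ≤ c)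
    (hg : ∫⁻ ω, g ω ∂P ≤ ENNReal.ofReal c) : ∫ ω, f ω ∂P ≤ c := by
  rw [integral_eq_lintegral_of_nonneg_ae (Eventually.of_forall hf0) hf.aestronglyMeasurable]
  exact ENNReal.toReal_le_of_le_ofReal hc ((lintegral_mono hfg).trans hg)

/-- The weight of lag `l` in the covariance bounds. -/
noncomputable def lagWeight (κ : ℝ) (l : ℕ) : ℝ := ((max l 1 : ℕ) : ℝ) ^ (-κ)

theorem lagWeight_nonneg (κ : ℝ) (l : ℕ) : 0 ≤ lagWeight κ l := by
  unfold lagWeight; positivity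

theorem exists_sum_lagWeight_le {κ : ℝ} (hκ : 1 < κ) :
    ∃ W, ∀ n, ∑ l ∈ Finset.range n, lagWeight κ l ≤ W := by
  have hs : Summable (lagWeight κ) := by
    rw [← summable_nat_add_iff 1]
    have h := (summable_nat_add_iff 1).2 (Real.summable_nat_rpow.2 (by linarith : -κ < -1))
    refine h.congr fun n => ?_
    simp [lagWeight]
  exact ⟨∑' l, lagWeight κ l, fun n => hs.sum_le_tsum _ fun l _ => lagWeight_nonneg κ l⟩

/-- Covariance bound interpolating between a small-ball bound and a mixing bound. -/
theorem DependenceLE.abs_cov_le_interpolate [IsProbabilityMeasure P] {m₁ m₂ : MeasurableSpace Ω}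
    {A C L s v β : ℝ} {l : ℕ} (hl : 1 ≤ l) (h : DependenceLE P m₁ m₂ (A * (l : ℝ) ^ (-β)))
    (h₁ : m₁ ≤ mΩ) (h₂ : m₂ ≤ mΩ) {f g : Ω → ℝ} (hf : Measurable[m₁] f) (hfL : ∀ ω, |f ω| ≤ L)
    (hg : Measurable[m₂] g) (hgL : ∀ ω, |g ω| ≤ L) (hs : 2 < s) (hv : 0 < v)
    (hA : 0 ≤ A) (hC : 0 ≤ C)
    (hfK : ∫ ω, |f ω| ^ s ∂P ≤ C * v) (hgK : ∫ ω, |g ω| ^ s ∂P ≤ C * v)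
    (hfg : |∫ ω, f ω * g ω ∂P - (∫ ω, f ω ∂P) * ∫ ω, g ω ∂P| ≤ C * v ^ 2) :
    |∫ ω, f ω * g ω ∂P - (∫ ω, f ω ∂P) * ∫ ω, g ω ∂P| ≤
      (4 * A + 4 * C) * v * (l : ℝ) ^ (-(β * (1 - 2 / s) / (2 - 2 / s))) := by
  have hl0 : (0 : ℝ) < l := by exact_mod_cast hl
  have hs0 : 0 < s := by linarith
  set x := |∫ ω, f ω * g ω ∂P - (∫ ω, f ω ∂P) * ∫ ω, g ω ∂P|
  have hx0 : 0 ≤ x := abs_nonneg _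
  set D := 4 * A + 4 * C with hDdef
  have hD0 : 0 ≤ D := by positivity
  -- This truncation level balances the two terms `l^(-β) M^2` and `v M^(2-s)` of Davydov's bound;
  -- both become `v^(2/s) l^(-β(1-2/s))`.
  have hM : 0 < (v * (l : ℝ) ^ β) ^ (1 / s) := by positivity
  have hdav := h.abs_cov_le_of_moment h₁ h₂ hf hfL hg hgL hM hs hfK hgK
  have e1 : 4 * (A * (l : ℝ) ^ (-β)) * ((v * (l : ℝ) ^ β) ^ (1 / s)) ^ 2 =
      4 * A * (v ^ (2 / s) * (l : ℝ) ^ (-(β * (1 - 2 / s)))) := by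
    rw [← Real.rpow_natCast, ← Real.rpow_mul (by positivity), Real.mul_rpow hv.le (by positivity),
      ← Real.rpow_mul hl0.le]
    rw [show (l : ℝ) ^ (-(β * (1 - 2 / s))) = (l : ℝ) ^ (-β) * (l : ℝ) ^ (β * (1 / s * (2 : ℕ))) by
      rw [← Real.rpow_add hl0]; congr 1; push_cast; ring]
    rw [show (1 / s * ((2 : ℕ) : ℝ)) = 2 / s by push_cast; ring]
    ring
  have e2 : 4 * (C * v) * ((v * (l : ℝ) ^ β) ^ (1 / s)) ^ (2 - s) =
      4 * C * (v ^ (2 / s) * (l : ℝ) ^ (-(β * (1 - 2 / s)))) := by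
    rw [← Real.rpow_mul (by positivity), Real.mul_rpow hv.le (by positivity),
      ← Real.rpow_mul hl0.le]
    rw [show v ^ (2 / s) = v ^ (1 : ℝ) * v ^ (1 / s * (2 - s)) by
      rw [← Real.rpow_add hv]; congr 1; field_simp; ring]
    rw [show (-(β * (1 - 2 / s))) = β * (1 / s * (2 - s)) by field_simp; ring, Real.rpow_one]
    ring
  rw [e1, e2, ← add_mul] at hdav
  have hx1 : x ≤ D * v ^ (2 : ℝ) := by
    refine hfg.trans ?_
    rw [← Real.rpow_natCast]
    refine mul_le_mul_of_nonneg_right (by linarith) (by positivity)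
  have hx2 : x ≤ D * (v ^ (2 / s) * (l : ℝ) ^ (-(β * (1 - 2 / s)))) :=
    hdav.trans le_rfl
  have h2s : 2 / s < 1 := (div_lt_one hs0).2 hs
  have h2s0 : 0 < 2 / s := by positivity
  -- The geometric mean of the bounds `D v^2` and `D v^(2/s) l^(-β(1-2/s))` with weights `1 - p` and
  -- `p` carries `v` to the power `2 (1 - p) + (2/s) p`, and `p` is chosen to make this `1`.
  set p := 1 / (2 - 2 / s) with hp
  have hpos : 0 < 2 - 2 / s := by linarith
  have hp0 : 0 ≤ p := by positivity
  have hp1 : 0 ≤ 1 - p := by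
    rw [hp, sub_nonneg, div_le_one hpos]; linarith
  calc x = x ^ (1 - p) * x ^ p := by
        rw [← Real.rpow_add_of_nonneg hx0 hp1 hp0]; simp
    _ ≤ (D * v ^ (2 : ℝ)) ^ (1 - p) * (D * (v ^ (2 / s) * (l : ℝ) ^ (-(β * (1 - 2 / s))))) ^ p := by
        gcongr
    _ = D ^ (1 - p) * D ^ p * (v ^ (2 * (1 - p)) * v ^ (2 / s * p)) *
          (l : ℝ) ^ (-(β * (1 - 2 / s)) * p) := by
        rw [Real.mul_rpow hD0 (by positivity), Real.mul_rpow hD0 (by positivity),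
          Real.mul_rpow (by positivity) (by positivity), ← Real.rpow_mul hv.le,
          ← Real.rpow_mul hv.le, ← Real.rpow_mul hl0.le]
        ring
    _ = _ := by
        rw [← Real.rpow_add_of_nonneg hD0 hp1 hp0, ← Real.rpow_add hv]
        have e3 : 2 * (1 - p) + 2 / s * p = 1 := by
          have : p * (2 - 2 / s) = 1 := by rw [hp, one_div, inv_mul_cancel₀ hpos.ne']
          linarith
        rw [e3, sub_add_cancel, Real.rpow_one, Real.rpow_one]
        congr 2
        rw [hp]; ring

end Moments

end LocLin

/-! ### Covariances of functions localised to a small window -/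

namespace LocLin

section Moments

variable {Ω : Type*} {mΩ : MeasurableSpace Ω} {P : Measure Ω}

theorem enorm_rpow_eq_ofReal (y : ℝ) {s : ℝ} (hs : 0 ≤ s) :
    ‖y‖ₑ ^ s = ENNReal.ofReal (|y| ^ s) := by
  rw [Real.enorm_eq_ofReal_abs, ENNReal.ofReal_rpow_of_nonneg (abs_nonneg _) hs]

theorem abs_pow_le_one_add_rpow (y : ℝ) {s : ℝ} {q : ℕ} (hq : (q : ℝ) ≤ s) :
    |y| ^ q ≤ 1 + |y| ^ s := by
  rcases le_total |y| 1 with h | h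
  · exact (pow_le_one₀ (abs_nonneg _) h).trans (le_add_of_nonneg_right (by positivity))
  · rw [← Real.rpow_natCast]
    exact (Real.rpow_le_rpow_of_exponent_le h hq).trans (by linarith)

/-- Functions of `(X_t, R_t)` that are bounded by `b`, and by `B |R_t|` times the indicator of the
ball of radius `r` around `x`. -/
structure IsWindowed {d : ℕ} (ζ : ℕ → (Fin d → ℝ) × ℝ → ℝ) (x : Fin d → ℝ) (r B b : ℝ) :
    Prop where
  measurable : ∀ t, Measurable (ζ t)
  bound : ∀ t p, |ζ t p| ≤ b
  window : ∀ t p, |ζ t p| ≤ B * (Metric.closedBall x r).indicator (fun _ => |p.2|) p.1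

variable {d : ℕ} {X : ℕ → ℕ → Ω → Fin d → ℝ} {R : ℕ → ℕ → Ω → ℝ} {s ρ C : ℝ} {lstar : ℕ}
  {ζ : ℕ → (Fin d → ℝ) × ℝ → ℝ} {x : Fin d → ℝ} {r B b : ℝ} {T t : ℕ}

theorem LocalMoments.lintegral_one_add_le (hL : LocalMoments P X R s ρ C lstar)
    (hR : Measurable (R T t)) (ht : 1 ≤ t) (htT : t ≤ T) (hr : 0 ≤ r)
    (hsub : Metric.closedBall x r ⊆ Metric.closedBall 0 ρ) :
    ∫⁻ ω in X T t ⁻¹' Metric.closedBall x r, (1 + ‖R T t ω‖ₑ ^ s) ∂P ≤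
      ENNReal.ofReal (2 * C * (2 * r) ^ d) := by
  have hC := hL.nonneg
  rw [lintegral_add_right _ (hR.enorm.pow_const s), setLIntegral_one, mul_assoc, two_mul,
    ENNReal.ofReal_add (by positivity) (by positivity)]
  exact add_le_add (hL.prob T t x r ht htT hr hsub) (hL.moment T t x r ht htT hr hsub)

/-- Since `|R|^q ≤ 1 + |R|^s`, a low moment over the ball is bounded by the ball's probability plus
the localised `s`-th moment; this explains the factor `2 C`. -/
theorem LocalMoments.integral_abs_pow_le (hL : LocalMoments P X R s ρ C lstar)
    (hX : Measurable (X T t)) (hR : Measurable (R T t)) (ht : 1 ≤ t) (htT : t ≤ T) (hr : 0 ≤ r)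
    (hsub : Metric.closedBall x r ⊆ Metric.closedBall 0 ρ) {f : Ω → ℝ} (hf : Measurable f)
    (hB : 0 ≤ B) (hfw : ∀ ω, |f ω| ≤
      B * (Metric.closedBall x r).indicator (fun _ => |R T t ω|) (X T t ω))
    {q : ℕ} (hq0 : 1 ≤ q) (hq : (q : ℝ) ≤ s) :
    ∫ ω, |f ω| ^ q ∂P ≤ B ^ q * (2 * C) * (2 * r) ^ d := by
  have hC := hL.nonneg
  have hs : 0 ≤ s := (Nat.cast_nonneg q).trans hq
  have hQ : MeasurableSet (X T t ⁻¹' Metric.closedBall x r) :=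
    hX Metric.isClosed_closedBall.measurableSet
  refine integral_le_of_lintegral_le (g := (X T t ⁻¹' Metric.closedBall x r).indicator fun ω =>
    ENNReal.ofReal (B ^ q) * (1 + ‖R T t ω‖ₑ ^ s)) (hf.abs.pow_const q)
    (fun ω => by positivity) (fun ω => ?_) (by positivity) ?_
  · have h1 := hfw ω
    by_cases hω : X T t ω ∈ Metric.closedBall x r
    · rw [Set.indicator_of_mem (s := X T t ⁻¹' Metric.closedBall x r) hω]
      rw [Set.indicator_of_mem hω] at h1
      rw [enorm_rpow_eq_ofReal _ hs, ← ENNReal.ofReal_one, ← ENNReal.ofReal_add zero_le_one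
        (by positivity), ← ENNReal.ofReal_mul (by positivity)]
      refine ENNReal.ofReal_le_ofReal ?_
      calc |f ω| ^ q ≤ (B * |R T t ω|) ^ q := pow_le_pow_left₀ (abs_nonneg _) h1 q
        _ = B ^ q * |R T t ω| ^ q := mul_pow _ _ _
        _ ≤ _ := by gcongr; exact abs_pow_le_one_add_rpow _ hq
    · rw [Set.indicator_of_notMem hω, mul_zero] at h1
      have : |f ω| = 0 := le_antisymm h1 (abs_nonneg _)
      rw [this, zero_pow (by omega)]
      simp
  · rw [lintegral_indicator hQ, lintegral_const_mul _ ((hR.enorm.pow_const s).const_add 1),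
      mul_assoc, ENNReal.ofReal_mul (by positivity)]
    gcongr
    exact hL.lintegral_one_add_le hR ht htT hr hsub

theorem LocalMoments.integral_abs_rpow_le (hL : LocalMoments P X R s ρ C lstar)
    (hX : Measurable (X T t)) (hR : Measurable (R T t)) (ht : 1 ≤ t) (htT : t ≤ T) (hr : 0 ≤ r)
    (hsub : Metric.closedBall x r ⊆ Metric.closedBall 0 ρ) {f : Ω → ℝ} (hf : Measurable f)
    (hB : 0 ≤ B) (hfw : ∀ ω, |f ω| ≤
      B * (Metric.closedBall x r).indicator (fun _ => |R T t ω|) (X T t ω)) (hs : 0 < s) :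
    ∫ ω, |f ω| ^ s ∂P ≤ B ^ s * C * (2 * r) ^ d := by
  have hC := hL.nonneg
  have hQ : MeasurableSet (X T t ⁻¹' Metric.closedBall x r) :=
    hX Metric.isClosed_closedBall.measurableSet
  refine integral_le_of_lintegral_le (g := (X T t ⁻¹' Metric.closedBall x r).indicator fun ω =>
    ENNReal.ofReal (B ^ s) * ‖R T t ω‖ₑ ^ s) (hf.abs.pow_const s)
    (fun ω => by positivity) (fun ω => ?_) (by positivity) ?_
  · have h1 := hfw ω
    by_cases hω : X T t ω ∈ Metric.closedBall x r
    · rw [Set.indicator_of_mem (s := X T t ⁻¹' Metric.closedBall x r) hω]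
      rw [Set.indicator_of_mem hω] at h1
      rw [enorm_rpow_eq_ofReal _ hs.le, ← ENNReal.ofReal_mul (by positivity)]
      refine ENNReal.ofReal_le_ofReal ?_
      rw [← Real.mul_rpow hB (abs_nonneg _)]
      exact Real.rpow_le_rpow (abs_nonneg _) h1 hs.le
    · rw [Set.indicator_of_notMem hω, mul_zero] at h1
      have : |f ω| = 0 := le_antisymm h1 (abs_nonneg _)
      rw [this, Real.zero_rpow hs.ne']
      simp
  · rw [lintegral_indicator hQ, lintegral_const_mul _ (hR.enorm.pow_const s),
      mul_assoc, ENNReal.ofReal_mul (by positivity)]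
    gcongr
    exact hL.moment T t x r ht htT hr hsub

theorem LocalMoments.integral_abs_mul_le (hL : LocalMoments P X R s ρ C lstar) {l : ℕ}
    (hX : Measurable (X T t)) (hR : Measurable (R T t)) (hX' : Measurable (X T (t + l)))
    (hR' : Measurable (R T (t + l))) (ht : 1 ≤ t) (hl : lstar ≤ l) (htT : t + l ≤ T) (hr : 0 ≤ r)
    (hsub : Metric.closedBall x r ⊆ Metric.closedBall 0 ρ) {f g : Ω → ℝ} (hf : Measurable f)
    (hg : Measurable g) (hB : 0 ≤ B) (hfw : ∀ ω, |f ω| ≤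
      B * (Metric.closedBall x r).indicator (fun _ => |R T t ω|) (X T t ω))
    (hgw : ∀ ω, |g ω| ≤
      B * (Metric.closedBall x r).indicator (fun _ => |R T (t + l) ω|) (X T (t + l) ω)) :
    ∫ ω, |f ω * g ω| ∂P ≤ B ^ 2 * C * ((2 * r) ^ d) ^ 2 := by
  have hC := hL.nonneg
  have hQ : MeasurableSet (X T t ⁻¹' Metric.closedBall x r ∩
      X T (t + l) ⁻¹' Metric.closedBall x r) :=
    (hX Metric.isClosed_closedBall.measurableSet).inter
      (hX' Metric.isClosed_closedBall.measurableSet)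
  refine integral_le_of_lintegral_le (g := (X T t ⁻¹' Metric.closedBall x r ∩
      X T (t + l) ⁻¹' Metric.closedBall x r).indicator fun ω =>
    ENNReal.ofReal (B ^ 2) * (‖R T t ω‖ₑ * ‖R T (t + l) ω‖ₑ)) (hf.mul hg).abs
    (fun ω => by positivity) (fun ω => ?_) (by positivity) ?_
  · have h1 := hfw ω
    have h2 := hgw ω
    by_cases hω : X T t ω ∈ Metric.closedBall x r
    · by_cases hω' : X T (t + l) ω ∈ Metric.closedBall x r
      · rw [Set.indicator_of_mem (s := X T t ⁻¹' Metric.closedBall x r ∩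
          X T (t + l) ⁻¹' Metric.closedBall x r) ⟨hω, hω'⟩]
        rw [Set.indicator_of_mem hω] at h1
        rw [Set.indicator_of_mem hω'] at h2
        rw [Real.enorm_eq_ofReal_abs, Real.enorm_eq_ofReal_abs,
          ← ENNReal.ofReal_mul (abs_nonneg _), ← ENNReal.ofReal_mul (by positivity), abs_mul]
        refine ENNReal.ofReal_le_ofReal ?_
        refine (mul_le_mul h1 h2 (abs_nonneg _) (by positivity)).trans (le_of_eq (by ring))
      · rw [Set.indicator_of_notMem hω', mul_zero] at h2
        have : |g ω| = 0 := le_antisymm h2 (abs_nonneg _)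
        rw [abs_mul, this]; simp
    · rw [Set.indicator_of_notMem hω, mul_zero] at h1
      have : |f ω| = 0 := le_antisymm h1 (abs_nonneg _)
      rw [abs_mul, this]; simp
  · have hRR : Measurable fun ω => ‖R T t ω‖ₑ * ‖R T (t + l) ω‖ₑ := hR.enorm.mul hR'.enorm
    rw [lintegral_indicator hQ, lintegral_const_mul _ hRR,
      mul_assoc, ENNReal.ofReal_mul (by positivity)]
    gcongr
    exact hL.joint T t l x r ht hl htT hr hsub

/-- Covariance bounds for windowed functions of a mixing array. -/
theorem LocalMoments.exists_abs_cov_le [IsProbabilityMeasure P]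
    (hL : LocalMoments P X R s ρ C lstar)
    (hX : ∀ T t, 1 ≤ t → t ≤ T → Measurable (X T t))
    (hR : ∀ T t, 1 ≤ t → t ≤ T → Measurable (R T t)) {A β : ℝ} (hA : 0 ≤ A)
    (hdep : ∀ T t k : ℕ, 1 ≤ k → 1 ≤ t → t + k ≤ T →
      DependenceLE P (sigmaBetween (fun t ω => (X T t ω, R T t ω)) 1 t)
        (sigmaBetween (fun t ω => (X T t ω, R T t ω)) (t + k) T) (A * (k : ℝ) ^ (-β)))
    (hs : 2 < s) (hβ : 0 ≤ β) (hB : 0 ≤ B) :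
    ∃ D, 0 ≤ D ∧ ∀ (T : ℕ) (x : Fin d → ℝ) (r b : ℝ) (ζ : ℕ → (Fin d → ℝ) × ℝ → ℝ), 0 < r →
      (2 * r) ^ d ≤ 1 → Metric.closedBall x r ⊆ Metric.closedBall 0 ρ → IsWindowed ζ x r B b →
      ∀ t ∈ Finset.Icc 1 T, ∀ t' ∈ Finset.Icc 1 T,
        |∫ ω, ζ t (X T t ω, R T t ω) * ζ t' (X T t' ω, R T t' ω) ∂P -
          (∫ ω, ζ t (X T t ω, R T t ω) ∂P) * ∫ ω, ζ t' (X T t' ω, R T t' ω) ∂P| ≤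
        (D * (2 * r) ^ d) *
          lagWeight (β * (1 - 2 / s) / (2 - 2 / s)) ((t - t') + (t' - t)) := by
  have hC := hL.nonneg
  have hs0 : 0 < s := by linarith
  set κ := β * (1 - 2 / s) / (2 - 2 / s) with hκ
  have h2s : 2 / s < 1 := (div_lt_one hs0).2 hs
  have hκ0 : 0 ≤ κ := by
    rw [hκ]; exact div_nonneg (mul_nonneg hβ (by linarith)) (by linarith)
  set D0 := 2 * B ^ 2 * C + (2 * B * C) ^ 2 with hD0
  set C0 := B ^ s * C + D0 with hC0
  -- Below lag `N` no joint density bound is used. These finitely many lags get the crude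
  -- second-moment bound, and the factor `N^κ` in the constant compensates for the lag weight. The
  -- maximum with `1` places lag `0`, the variance, among them.
  set N : ℕ := max lstar 1 with hN
  have hD00 : 0 ≤ D0 := by positivity
  have hC00 : 0 ≤ C0 := by positivity
  refine ⟨D0 * (N : ℝ) ^ κ + (4 * A + 4 * C0), by positivity, ?_⟩
  intro T x r b ζ hr hv1 hsub hζ
  have hv : 0 < (2 * r) ^ d := by positivity
  set v := (2 * r) ^ d with hvdef
  set Z : ℕ → Ω → ℝ := fun t ω => ζ t (X T t ω, R T t ω) with hZ
  have hVm : ∀ t, 1 ≤ t → t ≤ T → Measurable (fun ω => (X T t ω, R T t ω)) := fun t ht htT =>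
    (hX T t ht htT).prodMk (hR T t ht htT)
  have hZm : ∀ t, 1 ≤ t → t ≤ T → Measurable (Z t) := fun t ht htT =>
    (hζ.measurable t).comp (hVm t ht htT)
  have hZw : ∀ t ω, |Z t ω| ≤
      B * (Metric.closedBall x r).indicator (fun _ => |R T t ω|) (X T t ω) := fun t ω =>
    hζ.window t _
  have hZb : ∀ t ω, |Z t ω| ≤ b := fun t ω => hζ.bound t _
  have hE : ∀ t, 1 ≤ t → t ≤ T → |∫ ω, Z t ω ∂P| ≤ 2 * B * C * v := fun t ht htT => by
    refine abs_integral_le_integral_abs.trans ?_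
    have := hL.integral_abs_pow_le (hX T t ht htT) (hR T t ht htT) ht htT hr.le hsub
      (hZm t ht htT) hB (hZw t) le_rfl (by norm_num; linarith)
    simp only [pow_one] at this
    exact this.trans (le_of_eq (by ring))
  have hE2 : ∀ t, 1 ≤ t → t ≤ T → ∀ t', 1 ≤ t' → t' ≤ T →
      |(∫ ω, Z t ω ∂P) * ∫ ω, Z t' ω ∂P| ≤ (2 * B * C) ^ 2 * v ^ 2 := fun t ht htT t' ht' htT' => by
    rw [abs_mul]
    exact (mul_le_mul (hE t ht htT) (hE t' ht' htT') (abs_nonneg _) (by positivity)).trans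
      (le_of_eq (by ring))
  have hsq : ∀ t, 1 ≤ t → t ≤ T → ∫ ω, Z t ω ^ 2 ∂P ≤ 2 * B ^ 2 * C * v := fun t ht htT => by
    have := hL.integral_abs_pow_le (hX T t ht htT) (hR T t ht htT) ht htT hr.le hsub
      (hZm t ht htT) hB (hZw t) one_le_two (by norm_num; linarith)
    simp only [sq_abs] at this
    exact this.trans (le_of_eq (by ring))
  have hsqi : ∀ t, 1 ≤ t → t ≤ T → Integrable (fun ω => Z t ω ^ 2) P := fun t ht htT =>
    integrable_of_abs_le (M := b ^ 2) ((hZm t ht htT).pow_const 2) fun ω => by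
      rw [abs_pow]; exact pow_le_pow_left₀ (abs_nonneg _) (hZb t ω) 2
  have hcrude : ∀ t, 1 ≤ t → t ≤ T → ∀ t', 1 ≤ t' → t' ≤ T →
      |∫ ω, Z t ω * Z t' ω ∂P - (∫ ω, Z t ω ∂P) * ∫ ω, Z t' ω ∂P| ≤ D0 * v := by
    intro t ht htT t' ht' htT'
    have h1 : |∫ ω, Z t ω * Z t' ω ∂P| ≤ 2 * B ^ 2 * C * v := by
      refine (norm_integral_le_of_norm_le (f := fun ω => Z t ω * Z t' ω)
        (((hsqi t ht htT).add (hsqi t' ht' htT')).const_mul (1 / 2))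
        (Eventually.of_forall fun ω => ?_)).trans ?_
      · simp only [Pi.add_apply]
        rw [Real.norm_eq_abs, abs_mul, ← sq_abs (Z t ω), ← sq_abs (Z t' ω)]
        nlinarith [sq_nonneg (|Z t ω| - |Z t' ω|)]
      · rw [integral_const_mul, integral_add' (hsqi t ht htT) (hsqi t' ht' htT')]
        linarith [hsq t ht htT, hsq t' ht' htT']
    have h2 := hE2 t ht htT t' ht' htT'
    have h3 : (2 * B * C) ^ 2 * v ^ 2 ≤ (2 * B * C) ^ 2 * v := by
      gcongr; nlinarith
    refine (abs_sub _ _).trans ?_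
    rw [hD0]; linarith
  have hmain : ∀ t l, 1 ≤ t → t + l ≤ T →
      |∫ ω, Z t ω * Z (t + l) ω ∂P - (∫ ω, Z t ω ∂P) * ∫ ω, Z (t + l) ω ∂P| ≤
        ((D0 * (N : ℝ) ^ κ + (4 * A + 4 * C0)) * v) * lagWeight κ l := by
    intro t l ht htl
    have htT : t ≤ T := by omega
    have ht' : 1 ≤ t + l := by omega
    by_cases hlN : l < N
    · refine (hcrude t ht htT _ ht' htl).trans ?_
      have hNl : (1 : ℝ) ≤ (N : ℝ) ^ κ * lagWeight κ l := by
        have h1 : (0 : ℝ) < ((max l 1 : ℕ) : ℝ) := by positivity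
        have h2 : ((max l 1 : ℕ) : ℝ) ^ κ ≤ (N : ℝ) ^ κ := by
          refine Real.rpow_le_rpow h1.le ?_ hκ0
          exact_mod_cast (by omega : max l 1 ≤ N)
        unfold lagWeight
        rw [Real.rpow_neg h1.le, ← div_eq_mul_inv, one_le_div (by positivity)]
        exact h2
      have hlw := lagWeight_nonneg κ l
      calc D0 * v = D0 * v * 1 := (mul_one _).symm
        _ ≤ D0 * v * ((N : ℝ) ^ κ * lagWeight κ l) := by gcongr
        _ ≤ D0 * v * ((N : ℝ) ^ κ * lagWeight κ l) + (4 * A + 4 * C0) * v * lagWeight κ l :=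
            le_add_of_nonneg_right (by positivity)
        _ = _ := by ring
    · have hl1 : 1 ≤ l := by omega
      have hls : lstar ≤ l := by omega
      have hXt := hX T t ht htT
      have hRt := hR T t ht htT
      have hXt' := hX T (t + l) ht' htl
      have hRt' := hR T (t + l) ht' htl
      have hmom : ∀ t, 1 ≤ t → t ≤ T → ∫ ω, |Z t ω| ^ s ∂P ≤ C0 * v := fun t ht htT => by
        refine (hL.integral_abs_rpow_le (hX T t ht htT) (hR T t ht htT) ht htT hr.le hsub
          (hZm t ht htT) hB (hZw t) hs0).trans ?_
        rw [hC0]; gcongr; linarith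
      have hprod : |∫ ω, Z t ω * Z (t + l) ω ∂P| ≤ B ^ 2 * C * v ^ 2 :=
        abs_integral_le_integral_abs.trans
          (hL.integral_abs_mul_le hXt hRt hXt' hRt' ht hls htl hr.le hsub (hZm t ht htT)
            (hZm _ ht' htl) hB (hZw t) (hZw _))
      -- At these lags the joint density makes the mixed moment of order `v^2`, like the product of
      -- the means; this is the small-ball side of the interpolation.
      have hcov : |∫ ω, Z t ω * Z (t + l) ω ∂P - (∫ ω, Z t ω ∂P) * ∫ ω, Z (t + l) ω ∂P| ≤
          C0 * v ^ 2 := by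
        refine (abs_sub _ _).trans ((add_le_add hprod (hE2 t ht htT _ ht' htl)).trans ?_)
        rw [← add_mul]
        gcongr
        have : 0 ≤ B ^ s * C := by positivity
        have : 0 ≤ B ^ 2 * C := by positivity
        rw [hC0, hD0]; linarith
      have hdepl := (hdep T t l hl1 ht htl).mono
        (comap_le_sigmaBetween (V := fun t ω => (X T t ω, R T t ω)) ht le_rfl)
        (comap_le_sigmaBetween (V := fun t ω => (X T t ω, R T t ω)) le_rfl htl)
      have := hdepl.abs_cov_le_interpolate (f := Z t) (g := Z (t + l)) hl1
        (hVm t ht htT).comap_le (hVm _ ht' htl).comap_le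
        ((hζ.measurable t).comp (comap_measurable _)) (hZb t)
        ((hζ.measurable _).comp (comap_measurable _)) (hZb _) hs hv hA hC00
        (hmom t ht htT) (hmom _ ht' htl) hcov
      refine this.trans ?_
      have e : lagWeight κ l = (l : ℝ) ^ (-κ) := by
        unfold lagWeight; rw [max_eq_left hl1]
      have hDN : 0 ≤ D0 * (N : ℝ) ^ κ := by positivity
      rw [e, ← hκ]
      exact mul_le_mul_of_nonneg_right (mul_le_mul_of_nonneg_right (by linarith) hv.le)
        (by positivity)
  intro t ht t' ht'
  rw [Finset.mem_Icc] at ht ht'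
  rcases le_total t t' with h | h
  · obtain ⟨l, rfl⟩ := Nat.exists_eq_add_of_le h
    rw [show t - (t + l) + (t + l - t) = l by omega]
    exact hmain t l ht.1 ht'.2
  · obtain ⟨l, rfl⟩ := Nat.exists_eq_add_of_le h
    rw [show t' + l - t' + (t' - (t' + l)) = l by omega]
    have := hmain t' l ht'.1 ht.2
    simpa only [mul_comm] using this

end Moments

end LocLin

/-! ### Product weights, active times and the net of centres -/

namespace LocLin

/-- Bounded, Lipschitz continuous and vanishing outside `[-c, c]`. -/
structure IsFactor (k : ℝ → ℝ) (B L c : ℝ) : Prop where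
  bound : ∀ v, |k v| ≤ B
  lipschitz : ∀ v w, |k v - k w| ≤ L * |v - w|
  support : ∀ v, c < |v| → k v = 0

theorem IsFactor.continuous {k : ℝ → ℝ} {B L c : ℝ} (hk : IsFactor k B L c) : Continuous k :=
  (LipschitzWith.of_dist_le_mul (K := Real.toNNReal L) fun v w => by
    rw [Real.dist_eq, Real.dist_eq]
    exact (hk.lipschitz v w).trans
      (mul_le_mul_of_nonneg_right (Real.le_coe_toNNReal L) (abs_nonneg _))).continuous

/-- The weights evaluate `K` at `(x - X) / h` while the design matrix contains `(X - x) / h`, so `-v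
K v` occurs next to `K`. It is bounded and Lipschitz because `K` vanishes off a bounded set. The
radius `|C₁| + 1` is positive whatever the sign of `C₁`, and one triple of constants serves both
factors. -/
theorem IsKernel.exists_isFactor {K : ℝ → ℝ} {C₁ : ℝ} (hK : IsKernel K C₁) :
    ∃ B L c : ℝ, 1 ≤ B ∧ 0 ≤ L ∧ 0 < c ∧ IsFactor K B L c ∧
      IsFactor (fun v => -v * K v) B L c := by
  obtain ⟨B, hB⟩ := hK.bounded
  obtain ⟨L₀, hL₀⟩ := hK.lipschitz
  have hB0 : 0 ≤ B := (abs_nonneg _).trans (hB 0)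
  set L := max L₀ 0
  have hL0 : 0 ≤ L := le_max_right _ _
  have hL : ∀ v w, |K v - K w| ≤ L * |v - w| := fun v w =>
    (hL₀ v w).trans (mul_le_mul_of_nonneg_right (le_max_left _ _) (abs_nonneg _))
  set c := |C₁| + 1
  have hc : 1 ≤ c := le_add_of_nonneg_left (abs_nonneg _)
  have hsupp : ∀ v, c < |v| → K v = 0 := fun v hv =>
    hK.support v (by linarith [le_abs_self C₁])
  have hcB : B ≤ c * B := le_mul_of_one_le_left hB0 hc
  have hcL : L ≤ c * L := le_mul_of_one_le_left hL0 hc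
  refine ⟨c * B + 1, c * L + B, c, by nlinarith, by positivity, by linarith,
    ⟨fun v => (hB v).trans (by linarith), fun v w => (hL v w).trans ?_, hsupp⟩,
    ⟨fun v => ?_, fun v w => ?_, fun v hv => by simp [hsupp v hv]⟩⟩
  · exact mul_le_mul_of_nonneg_right (by linarith) (abs_nonneg _)
  · rcases lt_or_ge c |v| with hv | hv
    · rw [hsupp v hv, mul_zero, abs_zero]; positivity
    · rw [abs_mul, abs_neg]
      have := mul_le_mul hv (hB v) (abs_nonneg _) (by linarith)
      linarith
  · have key : ∀ v w, |w| ≤ c → |-v * K v - -w * K w| ≤ (c * L + B) * |v - w| := by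
      intro v w hw
      have e : -v * K v - -w * K w = -((v - w) * K v + w * (K v - K w)) := by ring
      rw [e, abs_neg]
      refine (abs_add_le _ _).trans ?_
      rw [abs_mul, abs_mul]
      have h1 := mul_le_mul_of_nonneg_left (hB v) (abs_nonneg (v - w))
      have h2 := mul_le_mul hw (hL v w) (abs_nonneg _) (by linarith)
      linarith
    rcases lt_or_ge c |w| with hw | hw
    · rcases lt_or_ge c |v| with hv | hv
      · rw [hsupp v hv, hsupp w hw]; simp; positivity
      · rw [abs_sub_comm, abs_sub_comm v w]; exact key w v hv
    · exact key v w hw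

/-- Factors are exchanged one at a time; `1 ≤ B` allows the same power of `B` at every exchange. -/
theorem abs_prod_sub_prod_le {ι : Type*} (A : Finset ι) {f g : ι → ℝ} {B η : ℝ} (hB : 1 ≤ B)
    (hf : ∀ j, |f j| ≤ B) (hg : ∀ j, |g j| ≤ B) (hfg : ∀ j, |f j - g j| ≤ η) :
    |∏ j ∈ A, f j - ∏ j ∈ A, g j| ≤ A.card * B ^ A.card * η := by
  classical
  have hB0 : 0 ≤ B := by linarith
  induction A using Finset.induction_on with
  | empty => simp
  | insert i A hi ih =>
    have hη : 0 ≤ η := (abs_nonneg _).trans (hfg i)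
    rw [Finset.prod_insert hi, Finset.prod_insert hi, Finset.card_insert_of_notMem hi]
    have e : f i * ∏ j ∈ A, f j - g i * ∏ j ∈ A, g j =
      (f i - g i) * ∏ j ∈ A, f j + g i * (∏ j ∈ A, f j - ∏ j ∈ A, g j) := by ring
    have hp : |∏ j ∈ A, f j| ≤ B ^ A.card := by
      rw [Finset.abs_prod]
      exact (Finset.prod_le_prod (fun _ _ => abs_nonneg _) fun j _ => hf j).trans (by simp)
    have h1 : |(f i - g i) * ∏ j ∈ A, f j| ≤ η * B ^ A.card := by
      rw [abs_mul]; exact mul_le_mul (hfg i) hp (abs_nonneg _) hη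
    have h2 : |g i * (∏ j ∈ A, f j - ∏ j ∈ A, g j)| ≤ B * (A.card * B ^ A.card * η) := by
      rw [abs_mul]; exact mul_le_mul (hg i) ih (abs_nonneg _) hB0
    have h3 : η * B ^ A.card ≤ η * B ^ (A.card + 1) :=
      mul_le_mul_of_nonneg_left (pow_le_pow_right₀ hB (by omega)) hη
    rw [e]
    refine (abs_add_le _ _).trans ((add_le_add (h1.trans h3) h2).trans (le_of_eq ?_))
    push_cast; ring

variable {d : ℕ}

/-- The rescaled time and space differences at which the kernel factors are evaluated. -/
noncomputable def localArg (T : ℕ) (h u : ℝ) (x : Fin d → ℝ) (t : ℕ) (p : Fin d → ℝ) :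
    Fin (d + 1) → ℝ :=
  Fin.cons ((u - t / T) / h) fun j => (x j - p j) / h

/-- The product of univariate factors at the local arguments. -/
noncomputable def localWeight (k : Fin (d + 1) → ℝ → ℝ) (T : ℕ) (h u : ℝ) (x : Fin d → ℝ) (t : ℕ)
    (p : Fin d → ℝ) : ℝ :=
  ∏ j, k j (localArg T h u x t p j)

/-- The univariate factors of the `i`-th coordinate of the kernel average. -/
noncomputable def coordFactor (K : ℝ → ℝ) (i : Fin (d + 2)) (j : Fin (d + 1)) : ℝ → ℝ :=
  if i = j.succ then fun v => -v * K v else K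

/-- Every nonconstant regressor is minus the argument of one kernel factor and merges with it. Each
coordinate is thus a product-kernel sum with at most one factor altered, and the `d + 1` rescalings
give `h^(d+1)`. -/
theorem kernelAverage_apply (K : ℝ → ℝ) {T : ℕ} {h : ℝ} (X : ℕ → Fin d → ℝ) (R : ℕ → ℝ)
    (u : ℝ) (x : Fin d → ℝ) (i : Fin (d + 2)) :
    kernelAverage K T h X R u x i = 1 / (T * h ^ (d + 1)) *
      ∑ t ∈ Finset.Icc 1 T, localWeight (coordFactor K i) T h u x t (X t) * R t := by
  have hdm : ∀ (t : ℕ) (c : ℝ), (Matrix.vecCons (1 : ℝ) (Matrix.vecCons ((t / (T : ℝ) - u) / h)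
      fun j : Fin d => (X t j - x j) / h)) i *
        (scaledKernel K h (u - t / (T : ℝ)) * ∏ j : Fin d, scaledKernel K h (x j - X t j)) * c =
      1 / h ^ (d + 1) * (localWeight (coordFactor K i) T h u x t (X t) * c) := by
    intro t c
    simp only [localWeight, localArg, Fin.prod_univ_succ, Fin.cons_zero, Fin.cons_succ,
      scaledKernel, Finset.prod_mul_distrib, Finset.prod_const, Finset.card_univ, Fintype.card_fin]
    refine Fin.cases ?_ (fun i => ?_) i
    · have h0 : ∀ j : Fin (d + 1), coordFactor K (0 : Fin (d + 2)) j = K := fun j =>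
        if_neg (Fin.succ_ne_zero j).symm
      simp only [h0, Matrix.cons_val_zero, one_div, inv_pow, pow_succ, mul_inv]
      ring
    · refine Fin.cases ?_ (fun i => ?_) i
      · have h0 : coordFactor K (Fin.succ (0 : Fin (d + 1))) (0 : Fin (d + 1)) =
            fun v => -v * K v := if_pos rfl
        have h1 : ∀ j : Fin d, coordFactor K (Fin.succ (0 : Fin (d + 1))) j.succ = K := fun j =>
          if_neg fun e => Fin.succ_ne_zero j (Fin.succ_injective _ e).symm
        simp only [h0, h1, Matrix.cons_val_succ, Matrix.cons_val_zero, one_div, inv_pow, pow_succ,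
          mul_inv]
        ring
      · have h0 : coordFactor K (Fin.succ (Fin.succ i)) (0 : Fin (d + 1)) = K :=
          if_neg fun e => Fin.succ_ne_zero i (Fin.succ_injective _ e)
        have h1 : ∀ j : Fin d, ∀ v, coordFactor K (Fin.succ (Fin.succ i)) j.succ v =
            (if i = j then -v else 1) * K v := fun j v => by
          unfold coordFactor
          simp only [Fin.succ_inj]
          split_ifs <;> simp
        simp only [h0, h1, Matrix.cons_val_succ, Finset.prod_mul_distrib, one_div, inv_pow,
          pow_succ, mul_inv]
        rw [Finset.prod_ite_eq Finset.univ i (fun j => -((x j - X t j) / h))]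
        simp only [Finset.mem_univ, if_true]
        ring
  have hsum : ∑ t ∈ Finset.Icc 1 T, localWeight (coordFactor K i) T h u x t (X t) * R t =
      ∑ j : Fin T, localWeight (coordFactor K i) T h u x ((j : ℕ) + 1) (X ((j : ℕ) + 1)) *
        R ((j : ℕ) + 1) := by
    rw [Fin.sum_univ_eq_sum_range
      (fun j => localWeight (coordFactor K i) T h u x (j + 1) (X (j + 1)) * R (j + 1)) T,
      Finset.range_eq_Ico, Finset.sum_Ico_add'
      (fun j => localWeight (coordFactor K i) T h u x j (X j) * R j) 0 T 1]
    rfl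
  rw [hsum]
  simp only [kernelAverage, Pi.smul_apply, smul_eq_mul, Matrix.mulVec,
    dotProduct, weightMatrix, Matrix.mul_diagonal, Matrix.transpose_apply, designMatrix,
    Matrix.of_apply, hdm]
  rw [← Finset.mul_sum, ← mul_assoc, one_div_mul_one_div]

variable {k : Fin (d + 1) → ℝ → ℝ} {B L c : ℝ} {T : ℕ} {h u : ℝ} {x p : Fin d → ℝ} {t : ℕ}

theorem continuous_localWeight (hk : ∀ j, IsFactor (k j) B L c) :
    Continuous fun p : Fin d → ℝ => localWeight k T h u x t p := by
  unfold localWeight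
  refine continuous_finsetProd _ fun j _ => (hk j).continuous.comp ?_
  refine Fin.cases ?_ (fun j => ?_) j
  · simpa only [localArg, Fin.cons_zero] using continuous_const
  · simp only [localArg, Fin.cons_succ]
    fun_prop

theorem abs_localWeight_le (hk : ∀ j, IsFactor (k j) B L c) :
    |localWeight k T h u x t p| ≤ B ^ (d + 1) := by
  unfold localWeight
  rw [Finset.abs_prod]
  exact (Finset.prod_le_prod (fun _ _ => abs_nonneg _) fun j _ => (hk j).bound _).trans (by simp)

theorem localWeight_eq_zero (hk : ∀ j, IsFactor (k j) B L c) (hh : 0 < h) (hc : 0 < c)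
    (hout : ¬ (|u - t / T| ≤ c * h ∧ p ∈ Metric.closedBall x (c * h))) :
    localWeight k T h u x t p = 0 := by
  by_contra hne
  have hall : ∀ j, |localArg T h u x t p j| ≤ c := fun j => by
    by_contra hj
    exact hne (Finset.prod_eq_zero (Finset.mem_univ j) ((hk j).support _ (not_le.1 hj)))
  refine hout ⟨?_, ?_⟩
  · have := hall 0
    simp only [localArg, Fin.cons_zero] at this
    rwa [abs_div, abs_of_pos hh, div_le_iff₀ hh] at this
  · rw [Metric.mem_closedBall, dist_pi_le_iff (by positivity)]
    intro j
    have := hall j.succ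
    simp only [localArg, Fin.cons_succ] at this
    rw [abs_div, abs_of_pos hh, div_le_iff₀ hh] at this
    rwa [Real.dist_eq, abs_sub_comm]

theorem abs_localWeight_sub_le (hk : ∀ j, IsFactor (k j) B L c) (hB : 1 ≤ B) (hL : 0 ≤ L)
    (hh : 0 < h) {u' a : ℝ} {x' : Fin d → ℝ} (ha : 0 ≤ a) (hu : |u - u'| ≤ a * h)
    (hx : dist x x' ≤ a * h) :
    |localWeight k T h u x t p - localWeight k T h u' x' t p| ≤
      (d + 1) * B ^ (d + 1) * L * a := by
  refine (abs_prod_sub_prod_le (η := L * a) _ hB (fun j => (hk j).bound _)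
    (fun j => (hk j).bound _) fun j => ((hk j).lipschitz _ _).trans
      (mul_le_mul_of_nonneg_left ?_ hL)).trans (le_of_eq ?_)
  · refine Fin.cases ?_ (fun j => ?_) j
    · simp only [localArg, Fin.cons_zero]
      rw [← sub_div, abs_div, abs_of_pos hh, div_le_iff₀ hh, sub_sub_sub_cancel_right]
      exact hu
    · simp only [localArg, Fin.cons_succ]
      rw [← sub_div, abs_div, abs_of_pos hh, div_le_iff₀ hh, sub_sub_sub_cancel_right,
        ← Real.dist_eq]
      exact ((dist_pi_le_iff (by positivity)).1 hx) j
  · simp; ring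

/-- The times whose rescaled distance to `u` is at most `r`. -/
noncomputable def activeTimes (T : ℕ) (u r : ℝ) : Finset ℕ :=
  {t ∈ Finset.Icc 1 T | |u - (t : ℕ) / (T : ℝ)| ≤ r}

theorem card_activeTimes_le {r : ℝ} (hT : 1 ≤ T) (hr : 0 ≤ r) :
    ((activeTimes T u r).card : ℝ) ≤ 2 * r * T + 1 := by
  have hT0 : (0 : ℝ) < T := by exact_mod_cast hT
  have hsub : activeTimes T u r ⊆ Finset.Icc ⌈T * (u - r)⌉₊ ⌊T * (u + r)⌋₊ := by
    intro t ht
    have h1 := abs_le.1 (Finset.mem_filter.1 ht).2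
    have e : (T : ℝ) * (t / T) = t := by field_simp
    rw [Finset.mem_Icc]
    constructor
    · refine Nat.ceil_le.2 ?_
      rw [← e]; gcongr; linarith
    · refine Nat.le_floor ?_
      rw [← e]; gcongr; linarith
  have hcard := Finset.card_le_card hsub
  rw [Nat.card_Icc] at hcard
  rcases Nat.eq_zero_or_pos (activeTimes T u r).card with h0 | h0
  · rw [h0]; simp; positivity
  · have h1 : (activeTimes T u r).card + ⌈T * (u - r)⌉₊ ≤ ⌊T * (u + r)⌋₊ + 1 := by omega
    have h2 : ((activeTimes T u r).card : ℝ) + ⌈T * (u - r)⌉₊ ≤ ⌊T * (u + r)⌋₊ + 1 := by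
      exact_mod_cast h1
    have h3 := Nat.le_ceil (T * (u - r))
    have h4 : (⌊T * (u + r)⌋₊ : ℝ) ≤ max (T * (u + r)) 0 := by
      rcases le_total 0 (T * (u + r)) with h5 | h5
      · exact (Nat.floor_le h5).trans (le_max_left _ _)
      · rw [Nat.floor_of_nonpos h5]; simp
    rcases le_total 0 (T * (u + r)) with h5 | h5
    · rw [max_eq_left h5] at h4
      nlinarith
    · rw [max_eq_right h5] at h4
      have : (0 : ℝ) ≤ ⌈T * (u - r)⌉₊ := by positivity
      nlinarith [mul_nonneg hr hT0.le]

/-- A finite net of the cylinder `[0, 1] × [-ρ, ρ]^d`. -/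
theorem exists_finset_net (d : ℕ) {ρ δ : ℝ} (hρ : 1 ≤ ρ) (hδ : 0 < δ) (hδ1 : δ ≤ 1) :
    ∃ F : Finset (ℝ × (Fin d → ℝ)), (F.card : ℝ) ≤ (5 * ρ) ^ (d + 1) * (δ ^ (d + 1))⁻¹ ∧
      (∀ q ∈ F, q.2 ∈ Metric.closedBall 0 (ρ + 1)) ∧
      ∀ u ∈ Set.Icc (0 : ℝ) 1, ∀ x ∈ Metric.closedBall (0 : Fin d → ℝ) ρ,
        ∃ q ∈ F, |u - q.1| ≤ δ ∧ dist x q.2 ≤ δ := by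
  classical
  -- The centres are multiples `z δ` with `|z| ≤ N`. Their number is `2 N + 1 ≤ 2 ρ / δ + 3 ≤ 5 ρ /
  -- δ` since `ρ / δ ≥ 1`. The same grid serves for the time coordinate because `1 ≤ ρ`.
  set N : ℤ := ⌊ρ / δ⌋ + 1 with hN
  have hN0 : (0 : ℤ) ≤ ⌊ρ / δ⌋ := Int.floor_nonneg.2 (by positivity)
  have hNle : (N : ℝ) ≤ ρ / δ + 1 := by
    rw [hN]; push_cast; linarith [Int.floor_le (ρ / δ)]
  have h1δ : 1 ≤ 1 / δ := by rw [le_div_iff₀ hδ]; linarith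
  have hρδ : 1 / δ ≤ ρ / δ := by gcongr
  set G : Finset ℤ := Finset.Icc (-N) N with hG
  have hGcard : (G.card : ℝ) ≤ 5 * ρ / δ := by
    rw [hG, Int.card_Icc]
    have : ((N + 1 - -N).toNat : ℤ) = 2 * N + 1 := by rw [Int.toNat_of_nonneg (by omega)]; ring
    have h2 : (((N + 1 - -N).toNat : ℕ) : ℝ) = 2 * N + 1 := by exact_mod_cast this
    rw [h2]
    have : 5 * ρ / δ = 5 * (ρ / δ) := by ring
    linarith
  have hcover : ∀ y : ℝ, |y| ≤ ρ → ∃ z ∈ G, |y - z * δ| ≤ δ := by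
    intro y hy
    have hy' := abs_le.1 hy
    refine ⟨⌊y / δ⌋, ?_, ?_⟩
    · rw [hG, Finset.mem_Icc]
      have h1 : y / δ ≤ ρ / δ := by gcongr; exact hy'.2
      have h2 : -(ρ / δ) ≤ y / δ := by rw [← neg_div]; gcongr; exact hy'.1
      constructor
      · rw [Int.le_floor]; push_cast [hN]; linarith [Int.lt_floor_add_one (ρ / δ)]
      · exact (Int.floor_le_floor h1).trans (by omega)
    · have h1 := Int.floor_le (y / δ)
      have h2 := Int.lt_floor_add_one (y / δ)
      rw [le_div_iff₀ hδ] at h1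
      rw [div_lt_iff₀ hδ] at h2
      rw [abs_le]; constructor <;> linarith
  -- Centres outside the ball of radius `ρ + 1` are dropped: one within `δ ≤ 1` of a point of the
  -- ball of radius `ρ` is never lost, and windows around the remaining ones stay in a fixed ball.
  refine ⟨((G ×ˢ Fintype.piFinset fun _ : Fin d => G).image
    fun q => ((q.1 : ℝ) * δ, fun j => (q.2 j : ℝ) * δ)).filter
      fun q => q.2 ∈ Metric.closedBall 0 (ρ + 1), ?_, fun q hq => (Finset.mem_filter.1 hq).2, ?_⟩
  · have h1 := (Finset.card_filter_le (((G ×ˢ Fintype.piFinset fun _ : Fin d => G).image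
      fun q => ((q.1 : ℝ) * δ, fun j => (q.2 j : ℝ) * δ)))
      (fun q => q.2 ∈ Metric.closedBall (0 : Fin d → ℝ) (ρ + 1))).trans Finset.card_image_le
    rw [Finset.card_product, Fintype.card_piFinset_const] at h1
    have h2 : ((G.card * G.card ^ d : ℕ) : ℝ) ≤ (5 * ρ / δ) ^ (d + 1) := by
      push_cast
      rw [← pow_succ']
      gcongr
    refine (Nat.cast_le.2 h1).trans (h2.trans (le_of_eq ?_))
    rw [div_pow, div_eq_mul_inv]
  · intro u hu x hx
    have hx' : ∀ j, |x j| ≤ ρ := fun j => by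
      have := (dist_pi_le_iff (by linarith)).1 (Metric.mem_closedBall.1 hx) j
      simpa [Real.dist_eq] using this
    obtain ⟨z, hz, huz⟩ := hcover u (by rw [abs_of_nonneg hu.1]; linarith [hu.2])
    choose y hy hxy using fun j => hcover (x j) (hx' j)
    have hd : dist x (fun j => (y j : ℝ) * δ) ≤ δ := by
      rw [dist_pi_le_iff hδ.le]; intro j; rw [Real.dist_eq]; exact hxy j
    refine ⟨((z : ℝ) * δ, fun j => (y j : ℝ) * δ), Finset.mem_filter.2
      ⟨Finset.mem_image.2 ⟨(z, y), Finset.mem_product.2 ⟨hz, Fintype.mem_piFinset.2 hy⟩, rfl⟩, ?_⟩,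
      huz, hd⟩
    rw [Metric.mem_closedBall]
    have := dist_triangle (fun j => (y j : ℝ) * δ) x 0
    rw [dist_comm] at hd
    have := Metric.mem_closedBall.1 hx
    simp only
    linarith

end LocLin

/-! ### Arithmetic of the rates -/

namespace LocLin

/-- The equation for `θ` is its definition cleared of the denominator and serves to cancel the
powers of `T` in `mixing_error_le`. The bound `θ ≤ 1 - 2 / s` guarantees blocks of length at least
one. -/
theorem theta_mul_eq {d : ℕ} {s β : ℝ} (hs : 2 < s)
    (hβ : (2 + s * (1 + ((d : ℝ) + 1))) / (s - 2) < β) :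
    (d : ℝ) + 2 < β ∧ 0 < theta d s β ∧
      theta d s β * (β - d + 2) = β * (1 - 2 / s) - 2 / s - 1 - (d + 1) ∧
      theta d s β ≤ 1 - 2 / s := by
  have hs0 : 0 < s := by linarith
  have hd : (0 : ℝ) ≤ d := Nat.cast_nonneg d
  rw [div_lt_iff₀ (by linarith)] at hβ
  have hβd : (d : ℝ) + 2 < β := by
    by_contra hcon
    nlinarith
  have hden : 0 < β + 3 - (d + 1) := by linarith
  have hnum : 0 < β * (1 - 2 / s) - 2 / s - 1 - (d + 1) := by
    have e : β * (1 - 2 / s) - 2 / s - 1 - (d + 1) =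
      (β * (s - 2) - (2 + s * (1 + ((d : ℝ) + 1)))) / s := by field_simp; ring
    rw [e]
    exact div_pos (by linarith) hs0
  have h2s : 2 / s < 1 := (div_lt_one hs0).2 hs
  have h2s0 : 0 < 2 / s := by positivity
  refine ⟨hβd, div_pos hnum hden, ?_, ?_⟩
  · unfold theta
    rw [show β - d + 2 = β + 3 - (d + 1) by ring, div_mul_cancel₀ _ hden.ne']
  · unfold theta
    rw [div_le_iff₀ hden]
    nlinarith

section Rates

variable {T L ρ h θ s β : ℝ} {d : ℕ}

theorem le_mul_pow_of_bandwidth (hT : 1 ≤ T) (hh : 0 < h) (hθ1 : θ ≤ 1)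
    (hband : L * ρ ≤ T ^ θ * h ^ (d + 1)) : L * ρ ≤ T * h ^ (d + 1) := by
  refine hband.trans (mul_le_mul_of_nonneg_right ?_ (by positivity))
  calc T ^ θ ≤ T ^ (1 : ℝ) := Real.rpow_le_rpow_of_exponent_le hT hθ1
    _ = T := Real.rpow_one T

theorem log_bandwidth (hT : 1 ≤ T) (hL : 1 ≤ L) (hρ : 1 ≤ ρ) (hh : 0 < h)
    (hband : L * ρ ≤ T ^ θ * h ^ (d + 1)) :
    Real.log L + Real.log ρ ≤ θ * Real.log T + Real.log (h ^ (d + 1)) := by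
  have hT0 : 0 < T := by linarith
  have h1 := Real.log_le_log (by positivity) hband
  rwa [Real.log_mul (by positivity) (by positivity), Real.log_mul (by positivity) (by positivity),
    Real.log_rpow hT0] at h1

theorem log_rate (hT : 1 ≤ T) (hL : 1 ≤ L) (hh : 0 < h) :
    Real.log (√(L / (T * h ^ (d + 1)))) =
      (Real.log L - Real.log T - Real.log (h ^ (d + 1))) / 2 := by
  have hT0 : 0 < T := by linarith
  have hL0 : 0 < L := by linarith
  rw [Real.log_sqrt (by positivity), Real.log_div (by positivity) (by positivity),
    Real.log_mul (by positivity) (by positivity)]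
  ring

theorem log_truncation_level (hT : 1 ≤ T) (hρ : 1 ≤ ρ) :
    Real.log ((ρ * T) ^ (1 / s)) = (Real.log ρ + Real.log T) / s := by
  rw [Real.log_rpow (by positivity), Real.log_mul (by positivity) (by positivity)]
  ring

/-- This makes the block length `1 / (a τ)` at least one. The bandwidth condition bounds `2 log (a
τ)` by `(θ - 1 + 2/s) log T + (2/s - 1) log ρ`, where neither coefficient is positive. -/
theorem rate_mul_level_le_one (hT : 1 ≤ T) (hL : 1 ≤ L) (hρ : 1 ≤ ρ) (hh : 0 < h) (hs : 2 < s)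
    (hθ : θ ≤ 1 - 2 / s) (hband : L * ρ ≤ T ^ θ * h ^ (d + 1)) :
    √(L / (T * h ^ (d + 1))) * (ρ * T) ^ (1 / s) ≤ 1 := by
  have hT0 : 0 < T := by linarith
  have hL0 : 0 < L := by linarith
  have h1 := log_bandwidth hT hL hρ hh hband
  have hlT := Real.log_nonneg hT
  have hlρ := Real.log_nonneg hρ
  have hs0 : 0 < s := by linarith
  have h2s : 2 / s < 1 := (div_lt_one hs0).2 hs
  rw [← Real.log_nonpos_iff (by positivity), Real.log_mul (by positivity) (by positivity),
    log_rate hT hL hh, log_truncation_level hT hρ]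
  have e : (Real.log ρ + Real.log T) / s = (2 / s) * (Real.log ρ + Real.log T) / 2 := by ring
  rw [e]
  nlinarith [mul_le_mul_of_nonneg_right hθ hlT, mul_le_mul_of_nonneg_right h2s.le hlρ]

/-- The truncation bias is of relative order `τ^(1-s) = (ρ T)^(1/s - 1)`, which is at most
`T^(-1/2)` because `s > 2`, and `a ≥ T^(-1/2)` because `L ≥ 1` and `h ≤ 1`. -/
theorem level_rpow_le_rate (hT : 1 ≤ T) (hL : 1 ≤ L) (hρ : 1 ≤ ρ) (hh : 0 < h) (hh1 : h ≤ 1)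
    (hs : 2 < s) : ((ρ * T) ^ (1 / s)) ^ (1 - s) ≤ √(L / (T * h ^ (d + 1))) := by
  have hT0 : 0 < T := by linarith
  have hL0 : 0 < L := by linarith
  have hlT := Real.log_nonneg hT
  have hlρ := Real.log_nonneg hρ
  have hlL := Real.log_nonneg hL
  have hs0 : 0 < s := by linarith
  have h2s : 2 / s < 1 := (div_lt_one hs0).2 hs
  have hlH : Real.log (h ^ (d + 1)) ≤ 0 := Real.log_nonpos (by positivity) (pow_le_one₀ hh.le hh1)
  rw [← Real.log_le_log_iff (by positivity) (by positivity), Real.log_rpow (by positivity),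
    log_rate hT hL hh, log_truncation_level hT hρ]
  have e : (1 - s) * ((Real.log ρ + Real.log T) / s) =
    (2 / s) * (Real.log ρ + Real.log T) / 2 - (Real.log ρ + Real.log T) := by field_simp
  rw [e]
  nlinarith [mul_le_mul_of_nonneg_right h2s.le (add_nonneg hlρ hlT)]

/-- The size of the net is polynomial in `T`: both `a` and `h^(d+1)` are at least `1 / T`. -/
theorem inv_rate_pow_le (hT : 1 ≤ T) (hL : 1 ≤ L) (hh : 0 < h) (hh1 : h ≤ 1)
    (hn : 1 ≤ T * h ^ (d + 1)) :
    ((√(L / (T * h ^ (d + 1))) * h) ^ (d + 1))⁻¹ ≤ T ^ (d + 2) := by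
  have hT0 : 0 < T := by linarith
  have hL0 : 0 < L := by linarith
  have h1 : T⁻¹ ≤ √(L / (T * h ^ (d + 1))) := by
    refine Real.le_sqrt_of_sq_le ?_
    rw [le_div_iff₀ (by positivity)]
    calc T⁻¹ ^ 2 * (T * h ^ (d + 1)) = T⁻¹ * h ^ (d + 1) := by field_simp
      _ ≤ 1 * 1 := mul_le_mul (inv_le_one_of_one_le₀ hT) (pow_le_one₀ hh.le hh1) (by positivity)
          zero_le_one
      _ ≤ L := by linarith
  have h2 : T⁻¹ ≤ h ^ (d + 1) := by
    rw [inv_le_iff_one_le_mul₀ hT0, mul_comm]; exact hn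
  rw [mul_pow]
  refine inv_le_of_inv_le₀ (by positivity) ?_
  calc (T ^ (d + 2))⁻¹ = T⁻¹ ^ (d + 1) * T⁻¹ := by rw [← inv_pow, pow_succ]
    _ ≤ _ := by gcongr

theorem half_le_floor {y : ℝ} (hy : 1 ≤ y) : y / 2 ≤ (⌊y⌋₊ : ℝ) := by
  have h1 := Nat.lt_floor_add_one y
  have h2 : (1 : ℝ) ≤ ⌊y⌋₊ := by exact_mod_cast (Nat.one_le_floor_iff y).2 hy
  linarith

/-- The mixing error, summed over the net, is negligible. -/
theorem mixing_error_le (hT : 1 ≤ T) (hL : 1 ≤ L) (hρ : 1 ≤ ρ) (hh : 0 < h) (hs : 2 < s)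
    (hβ : (d : ℝ) + 2 < β)
    (hθβ : θ * (β - d + 2) = β * (1 - 2 / s) - 2 / s - 1 - (d + 1)) (hθ0 : 0 < θ)
    (hθ : θ ≤ 1 - 2 / s) (hband : L * ρ ≤ T ^ θ * h ^ (d + 1)) {a τ : ℝ}
    (ha : a = √(L / (T * h ^ (d + 1)))) (hτ : τ = (ρ * T) ^ (1 / s)) :
    ((a * h) ^ (d + 1))⁻¹ * ((⌊1 / (a * τ)⌋₊ : ℝ) ^ (-β) * τ * T / (a * (T * h ^ (d + 1)))) ≤
      2 ^ β * (L ^ 2)⁻¹ := by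
  have hT0 : 0 < T := by linarith
  have hL0 : 0 < L := by linarith
  have hs0 : 0 < s := by linarith
  have hd : (0 : ℝ) ≤ d := Nat.cast_nonneg d
  have ha0 : 0 < a := by rw [ha]; positivity
  have hτ0 : 0 < τ := by rw [hτ]; positivity
  have haτ : a * τ ≤ 1 := by rw [ha, hτ]; exact rate_mul_level_le_one hT hL hρ hh hs hθ hband
  have hy : 1 ≤ 1 / (a * τ) := by rw [le_div_iff₀ (by positivity)]; linarith
  -- Rounding down loses at most a factor `2`, hence the constant `2^β`.
  have hm : (⌊1 / (a * τ)⌋₊ : ℝ) ^ (-β) ≤ (1 / (a * τ) / 2) ^ (-β) :=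
    Real.rpow_le_rpow_of_nonpos (by positivity) (half_le_floor hy) (by linarith)
  calc ((a * h) ^ (d + 1))⁻¹ * ((⌊1 / (a * τ)⌋₊ : ℝ) ^ (-β) * τ * T / (a * (T * h ^ (d + 1))))
      ≤ ((a * h) ^ (d + 1))⁻¹ * ((1 / (a * τ) / 2) ^ (-β) * τ * T / (a * (T * h ^ (d + 1)))) := by
        gcongr
    _ ≤ 2 ^ β * (L ^ 2)⁻¹ := by
        have h1 := log_bandwidth hT hL hρ hh hband
        have hla := log_rate (d := d) hT hL hh
        rw [← ha] at hla
        have hlτ := log_truncation_level (s := s) hT hρ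
        rw [← hτ] at hlτ
        have hlρ := Real.log_nonneg hρ
        rw [← Real.log_le_log_iff (by positivity) (by positivity)]
        rw [Real.log_mul (by positivity) (by positivity), Real.log_inv, mul_pow,
          Real.log_mul (by positivity) (by positivity), Real.log_div (by positivity) (by positivity),
          Real.log_mul (by positivity) (by positivity), Real.log_mul (by positivity) (by positivity),
          Real.log_rpow (by positivity), Real.log_div (by positivity) (by positivity), one_div,
          Real.log_inv, Real.log_mul ha0.ne' hτ0.ne',
          Real.log_mul (by positivity) (by positivity),
          Real.log_mul (by positivity) (by positivity),
          Real.log_mul (by positivity) (by positivity), Real.log_rpow (by positivity), Real.log_inv,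
          Real.log_pow L, Real.log_pow a, hla, hlτ]
        push_cast
        set lL := Real.log L
        set lT := Real.log T
        set lρ := Real.log ρ
        set lH := Real.log (h ^ (d + 1))
        set σ := 1 / s with hσ
        have e2 : 2 / s = 2 * σ := by rw [hσ]; ring
        have e1 : (lρ + lT) / s = σ * (lρ + lT) := by rw [hσ]; ring
        rw [e2] at hθβ hθ
        rw [e1]
        -- In logarithms the left side contains `log (h^(d+1))` with coefficient `-(β - d + 2) / 2`,
        -- so this multiple of the bandwidth condition removes it. Then `log T` cancels by the
        -- equation for `θ`, `log L` keeps the coefficient `-2`, and the coefficient of `log ρ` is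
        -- nonpositive by `k3`.
        have hq : 0 < (β - d + 2) / 2 := by linarith
        have k1 := mul_le_mul_of_nonneg_left h1 hq.le
        have k2 : θ * (β - d + 2) * lT = (β * (1 - 2 * σ) - 2 * σ - 1 - (d + 1)) * lT := by
          rw [hθβ]
        have k3 : 0 ≤ ((β - d + 2) / 2 - (β + 1) * σ) * lρ := by
          refine mul_nonneg ?_ hlρ
          have : 0 < θ * (β - d + 2) := mul_pos hθ0 (by linarith)
          rw [hθβ] at this
          nlinarith
        nlinarith

end Rates

end LocLin

/-! ### Pathwise reduction to the net, truncation and envelope -/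

namespace LocLin

section Pathwise

variable {Ω : Type*} {mΩ : MeasurableSpace Ω} {P : Measure Ω}

/-- Split `f` into `g`, `e` and a remainder. The remainder vanishes at `ω₀` and enters only through
its mean, at most `Q'`. The part `e` is dominated by `η z`, whose sum is at most `Q + ε` at `ω₀` and
`Q` in mean, so `e` itself needs no deviation bound. -/
theorem abs_sum_centered_le_of_approx {I : Finset ℕ} {f g e z : ℕ → Ω → ℝ} {ω₀ : Ω}
    {η ε Q Q' : ℝ} (hf : ∀ t ∈ I, Integrable (f t) P) (hg : ∀ t ∈ I, Integrable (g t) P)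
    (he : ∀ t ∈ I, Integrable (e t) P) (hz : ∀ t ∈ I, Integrable (z t) P)
    (hω : ∀ t ∈ I, f t ω₀ = g t ω₀ + e t ω₀) (hη : 0 ≤ η)
    (hez : ∀ t ∈ I, ∀ ω, |e t ω| ≤ η * z t ω)
    (hg' : |∑ t ∈ I, (g t ω₀ - ∫ ω, g t ω ∂P)| ≤ ε)
    (hz' : |∑ t ∈ I, (z t ω₀ - ∫ ω, z t ω ∂P)| ≤ ε)
    (hQ : ∑ t ∈ I, ∫ ω, z t ω ∂P ≤ Q)
    (hQ' : ∑ t ∈ I, ∫ ω, |f t ω - g t ω - e t ω| ∂P ≤ Q') :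
    |∑ t ∈ I, (f t ω₀ - ∫ ω, f t ω ∂P)| ≤ ε + η * (2 * Q + ε) + Q' := by
  have hdec : ∑ t ∈ I, (f t ω₀ - ∫ ω, f t ω ∂P) = ∑ t ∈ I, (g t ω₀ - ∫ ω, g t ω ∂P) +
      ∑ t ∈ I, e t ω₀ - ∑ t ∈ I, ∫ ω, e t ω ∂P - ∑ t ∈ I, ∫ ω, (f t ω - g t ω - e t ω) ∂P := by
    rw [← Finset.sum_add_distrib, ← Finset.sum_sub_distrib, ← Finset.sum_sub_distrib]
    refine Finset.sum_congr rfl fun t ht => ?_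
    have h1 : Integrable (fun ω => f t ω - g t ω) P := (hf t ht).sub (hg t ht)
    rw [integral_sub h1 (he t ht), integral_sub (hf t ht) (hg t ht), hω t ht]
    ring
  have hz1 : ∑ t ∈ I, z t ω₀ ≤ Q + ε := by
    rw [Finset.sum_sub_distrib] at hz'
    linarith [(abs_le.1 hz').2]
  have he1 : |∑ t ∈ I, e t ω₀| ≤ η * (Q + ε) := by
    refine (Finset.abs_sum_le_sum_abs _ _).trans
      ((Finset.sum_le_sum fun t ht => hez t ht ω₀).trans ?_)
    rw [← Finset.mul_sum]
    exact mul_le_mul_of_nonneg_left hz1 hη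
  have he2 : |∑ t ∈ I, ∫ ω, e t ω ∂P| ≤ η * Q := by
    refine (Finset.abs_sum_le_sum_abs _ _).trans ((Finset.sum_le_sum (g := fun t =>
      η * ∫ ω, z t ω ∂P) fun t ht => ?_).trans ?_)
    · rw [← integral_const_mul]
      exact norm_integral_le_of_norm_le (f := e t) ((hz t ht).const_mul η)
        (Eventually.of_forall (hez t ht))
    · rw [← Finset.mul_sum]
      exact mul_le_mul_of_nonneg_left hQ hη
  have he3 : |∑ t ∈ I, ∫ ω, (f t ω - g t ω - e t ω) ∂P| ≤ Q' :=
    (Finset.abs_sum_le_sum_abs _ _).trans ((Finset.sum_le_sum fun t _ =>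
      abs_integral_le_integral_abs).trans hQ')
  rw [hdec]
  have h1 := abs_le.1 hg'
  have h2 := abs_le.1 he1
  have h3 := abs_le.1 he2
  have h4 := abs_le.1 he3
  exact abs_le.2 ⟨by linarith, by linarith⟩

variable {d : ℕ}

/-- Enlarging the window radius from `c h` to `(c + 1) h` makes one window around the centre valid
for all points within distance `h` of it. -/
theorem localWeight_eq_zero_of_near {k : Fin (d + 1) → ℝ → ℝ} {B L c : ℝ} {T : ℕ}
    {h u u' : ℝ} {x x' p : Fin d → ℝ} {t : ℕ} (hk : ∀ j, IsFactor (k j) B L c) (hh : 0 < h)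
    (hc : 0 < c) (hu : |u - u'| ≤ h) (hx : dist x x' ≤ h)
    (hout : ¬ (|u' - t / T| ≤ (c + 1) * h ∧ p ∈ Metric.closedBall x' ((c + 1) * h))) :
    localWeight k T h u x t p = 0 := by
  refine localWeight_eq_zero hk hh hc fun hin => hout ⟨?_, ?_⟩
  · have h1 := abs_le.1 hin.1
    have h2 := abs_le.1 hu
    exact abs_le.2 ⟨by linarith, by linarith⟩
  · have h1 := Metric.mem_closedBall.1 hin.2
    have h2 := dist_triangle p x x'
    rw [Metric.mem_closedBall]
    linarith

/-- The truncated summands of a coordinate of the kernel average. -/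
noncomputable def coordTerm (k : Fin (d + 1) → ℝ → ℝ) (T : ℕ) (h u : ℝ) (x : Fin d → ℝ) (τ : ℝ)
    (t : ℕ) (q : (Fin d → ℝ) × ℝ) : ℝ :=
  localWeight k T h u x t q.1 * trunc τ q.2

/-- The truncated absolute responses in a window of radius `r`. -/
noncomputable def envTerm (T : ℕ) (u : ℝ) (x : Fin d → ℝ) (r τ : ℝ) (t : ℕ)
    (q : (Fin d → ℝ) × ℝ) : ℝ :=
  if |u - t / T| ≤ r then (Metric.closedBall x r).indicator (fun _ => |trunc τ q.2|) q.1 else 0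

variable {k : Fin (d + 1) → ℝ → ℝ} {B L c : ℝ} {T : ℕ} {h u u' : ℝ} {x x' p : Fin d → ℝ} {t : ℕ}
  {τ r : ℝ}

theorem isWindowed_coordTerm (hk : ∀ j, IsFactor (k j) B L c) (hB : 1 ≤ B) (hh : 0 < h)
    (hc : 0 < c) (hτ : 0 ≤ τ) :
    IsWindowed (coordTerm k T h u x τ) x ((c + 1) * h) (B ^ (d + 1)) (B ^ (d + 1) * τ) where
  measurable t := ((continuous_localWeight hk).measurable.comp measurable_fst).mul
    ((measurable_trunc τ).comp measurable_snd)
  bound t q := by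
    rw [coordTerm, abs_mul]
    exact mul_le_mul (abs_localWeight_le hk) (abs_trunc_le hτ _) (abs_nonneg _) (by positivity)
  window t q := by
    by_cases hq : q.1 ∈ Metric.closedBall x ((c + 1) * h)
    · rw [Set.indicator_of_mem hq, coordTerm, abs_mul]
      exact mul_le_mul (abs_localWeight_le hk) (abs_trunc_le_abs _ _) (abs_nonneg _)
        (by positivity)
    · rw [coordTerm, localWeight_eq_zero_of_near (u' := u) (x' := x) hk hh hc
        (by simpa using hh.le) (by simpa using hh.le) fun hin => hq hin.2]
      rw [Set.indicator_of_notMem hq]; simp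

theorem coordTerm_eq_zero (hk : ∀ j, IsFactor (k j) B L c) (hh : 0 < h) (hc : 0 < c)
    (ht : t ∈ Finset.Icc 1 T) (hta : t ∉ activeTimes T u ((c + 1) * h)) (q : (Fin d → ℝ) × ℝ) :
    coordTerm k T h u x τ t q = 0 := by
  rw [coordTerm, localWeight_eq_zero_of_near (u' := u) (x' := x) hk hh hc
    (by simpa using hh.le) (by simpa using hh.le), zero_mul]
  exact fun hin => hta (Finset.mem_filter.2 ⟨ht, hin.1⟩)

theorem isWindowed_envTerm (hB : 1 ≤ B) (hτ : 0 ≤ τ) :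
    IsWindowed (envTerm T u x r τ) x r (B ^ (d + 1)) (B ^ (d + 1) * τ) where
  measurable t := by
    have hm : Measurable fun q : (Fin d → ℝ) × ℝ =>
        (Metric.closedBall x r).indicator (fun _ => |trunc τ q.2|) q.1 :=
      ((measurable_trunc τ).comp measurable_snd).abs.indicator
        (measurable_fst Metric.isClosed_closedBall.measurableSet)
    unfold envTerm
    split_ifs
    · exact hm
    · exact measurable_const
  bound t q := by
    have h1 : τ ≤ B ^ (d + 1) * τ := le_mul_of_one_le_left hτ (one_le_pow₀ hB)
    unfold envTerm
    split_ifs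
    · by_cases hq : q.1 ∈ Metric.closedBall x r
      · rw [Set.indicator_of_mem hq, abs_abs]; exact (abs_trunc_le hτ _).trans h1
      · rw [Set.indicator_of_notMem hq, abs_zero]; positivity
    · rw [abs_zero]; positivity
  window t q := by
    unfold envTerm
    split_ifs
    · by_cases hq : q.1 ∈ Metric.closedBall x r
      · rw [Set.indicator_of_mem hq, Set.indicator_of_mem hq, abs_abs]
        exact (abs_trunc_le_abs _ _).trans
          (le_mul_of_one_le_left (abs_nonneg _) (one_le_pow₀ hB))
      · rw [Set.indicator_of_notMem hq, Set.indicator_of_notMem hq]; simp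
    · rw [abs_zero]
      refine mul_nonneg (by positivity) (Set.indicator_nonneg (fun _ _ => abs_nonneg _) _)

theorem envTerm_eq_zero (ht : t ∈ Finset.Icc 1 T) (hta : t ∉ activeTimes T u r)
    (q : (Fin d → ℝ) × ℝ) : envTerm T u x r τ t q = 0 :=
  if_neg fun hin => hta (Finset.mem_filter.2 ⟨ht, hin⟩)

theorem envTerm_nonneg (q : (Fin d → ℝ) × ℝ) : 0 ≤ envTerm T u x r τ t q := by
  unfold envTerm
  split_ifs
  · exact Set.indicator_nonneg (fun _ _ => abs_nonneg _) _
  · exact le_rfl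

theorem abs_sub_trunc_le {s : ℝ} (hτ : 0 < τ) (hs : 1 < s) (y : ℝ) :
    |y - trunc τ y| ≤ τ ^ (1 - s) * |y| ^ s := by
  unfold trunc
  split_ifs with hy
  · simp; positivity
  · have hy0 : 0 < |y| := hτ.trans (not_le.1 hy)
    rw [sub_zero]
    calc |y| = |y| ^ (1 - s) * |y| ^ s := by
          rw [← Real.rpow_add hy0, sub_add_cancel, Real.rpow_one]
      _ ≤ _ := mul_le_mul_of_nonneg_right
          (Real.rpow_le_rpow_of_nonpos hτ (not_le.1 hy).le (by linarith)) (by positivity)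

variable {X : ℕ → ℕ → Ω → Fin d → ℝ} {R : ℕ → ℕ → Ω → ℝ} {s ρ C : ℝ} {lstar : ℕ}

theorem LocalMoments.integral_tail_le (hL : LocalMoments P X R s ρ C lstar)
    (hX : Measurable (X T t)) (hR : Measurable (R T t)) (ht : 1 ≤ t) (htT : t ≤ T) (hr : 0 ≤ r)
    (hsub : Metric.closedBall x r ⊆ Metric.closedBall 0 ρ) {f : Ω → ℝ} (hf : Measurable f)
    {B : ℝ} (hB : 0 ≤ B) (hs : 1 < s) (hτ : 0 < τ) (hfw : ∀ ω, |f ω| ≤ B *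
      (Metric.closedBall x r).indicator (fun _ => |R T t ω - trunc τ (R T t ω)|) (X T t ω)) :
    ∫ ω, |f ω| ∂P ≤ B * τ ^ (1 - s) * C * (2 * r) ^ d := by
  have hC := hL.nonneg
  have hs0 : 0 ≤ s := by linarith
  have hQ : MeasurableSet (X T t ⁻¹' Metric.closedBall x r) :=
    hX Metric.isClosed_closedBall.measurableSet
  refine integral_le_of_lintegral_le (g := (X T t ⁻¹' Metric.closedBall x r).indicator fun ω =>
    ENNReal.ofReal (B * τ ^ (1 - s)) * ‖R T t ω‖ₑ ^ s) hf.abs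
    (fun ω => abs_nonneg _) (fun ω => ?_) (by positivity) ?_
  · have h1 := hfw ω
    by_cases hω : X T t ω ∈ Metric.closedBall x r
    · rw [Set.indicator_of_mem (s := X T t ⁻¹' Metric.closedBall x r) hω]
      rw [Set.indicator_of_mem hω] at h1
      rw [enorm_rpow_eq_ofReal _ hs0, ← ENNReal.ofReal_mul (by positivity), mul_assoc]
      exact ENNReal.ofReal_le_ofReal
        (h1.trans (mul_le_mul_of_nonneg_left (abs_sub_trunc_le hτ hs _) hB))
    · rw [Set.indicator_of_notMem hω, mul_zero] at h1
      rw [le_antisymm h1 (abs_nonneg _)]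
      simp
  · rw [lintegral_indicator hQ, lintegral_const_mul _ (hR.enorm.pow_const s)]
    refine (mul_le_mul' le_rfl (hL.moment T t x r ht htT hr hsub)).trans (le_of_eq ?_)
    rw [← ENNReal.ofReal_mul (by positivity), mul_assoc (B * τ ^ (1 - s))]

/-- Pathwise control of a coordinate of the kernel average near a centre of the net. -/
theorem LocalMoments.abs_sum_localWeight_sub_le [IsProbabilityMeasure P]
    (hL : LocalMoments P X R s ρ C lstar) (hs : 2 < s)
    (hX : ∀ t, 1 ≤ t → t ≤ T → Measurable (X T t)) (hR : ∀ t, 1 ≤ t → t ≤ T → Measurable (R T t))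
    (hRi : ∀ t, 1 ≤ t → t ≤ T → Integrable (R T t) P) (hk : ∀ j, IsFactor (k j) B L c)
    (hB : 1 ≤ B) (hL0 : 0 ≤ L) (hc : 0 < c) (hh : 0 < h) {a ε : ℝ} (ha : 0 ≤ a) (ha1 : a ≤ 1)
    (hτ : 0 < τ) (hu : |u - u'| ≤ a * h) (hx : dist x x' ≤ a * h)
    (hsub : Metric.closedBall x' ((c + 1) * h) ⊆ Metric.closedBall 0 ρ) {ω₀ : Ω}
    (hω : ∀ t ∈ Finset.Icc 1 T, |R T t ω₀| ≤ τ)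
    (hg : |∑ t ∈ Finset.Icc 1 T, (coordTerm k T h u' x' τ t (X T t ω₀, R T t ω₀) -
      ∫ ω, coordTerm k T h u' x' τ t (X T t ω, R T t ω) ∂P)| ≤ ε)
    (hz : |∑ t ∈ Finset.Icc 1 T, (envTerm T u' x' ((c + 1) * h) τ t (X T t ω₀, R T t ω₀) -
      ∫ ω, envTerm T u' x' ((c + 1) * h) τ t (X T t ω, R T t ω) ∂P)| ≤ ε) :
    |∑ t ∈ Finset.Icc 1 T, (localWeight k T h u x t (X T t ω₀) * R T t ω₀ -
      ∫ ω, localWeight k T h u x t (X T t ω) * R T t ω ∂P)| ≤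
      ε + ((d + 1) * B ^ (d + 1) * L * a) *
        (2 * ((activeTimes T u' ((c + 1) * h)).card * (2 * C * (2 * ((c + 1) * h)) ^ d)) + ε) +
      (activeTimes T u' ((c + 1) * h)).card *
        (B ^ (d + 1) * τ ^ (1 - s) * C * (2 * ((c + 1) * h)) ^ d) := by
  have hr : 0 ≤ (c + 1) * h := by positivity
  set r := (c + 1) * h with hrdef
  have hB0 : 0 ≤ B := by linarith
  have hC := hL.nonneg
  have hu1 : |u - u'| ≤ h := hu.trans (mul_le_of_le_one_left hh.le ha1)
  have hx1 : dist x x' ≤ h := hx.trans (mul_le_of_le_one_left hh.le ha1)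
  have hmem : ∀ t ∈ Finset.Icc 1 T, 1 ≤ t ∧ t ≤ T := fun t ht => Finset.mem_Icc.1 ht
  have hV : ∀ t ∈ Finset.Icc 1 T, Measurable fun ω => (X T t ω, R T t ω) := fun t ht =>
    (hX t (hmem t ht).1 (hmem t ht).2).prodMk (hR t (hmem t ht).1 (hmem t ht).2)
  have hw : ∀ (v : ℝ) (y : Fin d → ℝ), ∀ t ∈ Finset.Icc 1 T,
      Measurable fun ω => localWeight k T h v y t (X T t ω) := fun v y t ht =>
    (continuous_localWeight hk).measurable.comp (hX t (hmem t ht).1 (hmem t ht).2)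
  have htr : ∀ t ∈ Finset.Icc 1 T, Measurable fun ω => trunc τ (R T t ω) := fun t ht =>
    (measurable_trunc τ).comp (hR t (hmem t ht).1 (hmem t ht).2)
  have hcw := isWindowed_coordTerm (T := T) (u := u') (x := x') hk hB hh hc hτ.le
  have hew := isWindowed_envTerm (T := T) (u := u') (x := x') (r := r) (d := d) hB hτ.le
  have hcard : ∀ M : ℝ, ∑ t ∈ Finset.Icc 1 T, (if t ∈ activeTimes T u' r then M else 0) =
      (activeTimes T u' r).card * M := fun M => by
    rw [← Finset.sum_filter, Finset.sum_const, Finset.filter_mem_eq_inter, nsmul_eq_mul,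
      Finset.inter_eq_right.2 (show activeTimes T u' r ⊆ Finset.Icc 1 T from
        Finset.filter_subset _ _)]
  have hfi : ∀ t ∈ Finset.Icc 1 T,
      Integrable (fun ω => localWeight k T h u x t (X T t ω) * R T t ω) P := fun t ht =>
    (hRi t (hmem t ht).1 (hmem t ht).2).bdd_mul (hw u x t ht).aestronglyMeasurable
      (Eventually.of_forall fun ω => abs_localWeight_le hk)
  -- Here `g` is the truncated term at the centre, `e` the effect of moving the weight, and the
  -- remainder the part cut off, which vanishes at `ω₀` because all responses there are at most `τ`
  -- in absolute value.
  refine abs_sum_centered_le_of_approx (P := P)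
    (f := fun t ω => localWeight k T h u x t (X T t ω) * R T t ω)
    (g := fun t ω => coordTerm k T h u' x' τ t (X T t ω, R T t ω))
    (e := fun t ω => (localWeight k T h u x t (X T t ω) - localWeight k T h u' x' t (X T t ω)) *
      trunc τ (R T t ω))
    (z := fun t ω => envTerm T u' x' r τ t (X T t ω, R T t ω)) hfi ?_ ?_ ?_ ?_ (by positivity) ?_
    hg hz ?_ ?_
  · exact fun t ht => integrable_of_abs_le ((hcw.measurable t).comp (hV t ht))
      fun ω => hcw.bound t _
  · exact fun t ht => integrable_of_abs_le (M := ((d + 1) * B ^ (d + 1) * L * a) * τ)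
      (((hw u x t ht).sub (hw u' x' t ht)).mul (htr t ht)) fun ω => by
        rw [abs_mul]
        exact mul_le_mul (abs_localWeight_sub_le hk hB hL0 hh ha hu hx) (abs_trunc_le hτ.le _)
          (abs_nonneg _) (by positivity)
  · exact fun t ht => integrable_of_abs_le ((hew.measurable t).comp (hV t ht))
      fun ω => hew.bound t _
  · intro t ht
    have : trunc τ (R T t ω₀) = R T t ω₀ := if_pos (hω t ht)
    simp only [coordTerm, this]
    ring
  · intro t ht ω
    by_cases hin : |u' - t / T| ≤ r ∧ X T t ω ∈ Metric.closedBall x' r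
    · simp only [envTerm, if_pos hin.1, Set.indicator_of_mem hin.2]
      rw [abs_mul]
      exact mul_le_mul_of_nonneg_right (abs_localWeight_sub_le hk hB hL0 hh ha hu hx)
        (abs_nonneg _)
    · rw [localWeight_eq_zero_of_near hk hh hc hu1 hx1 hin, localWeight_eq_zero_of_near
        (u' := u') (x' := x') hk hh hc (by simpa using hh.le) (by simpa using hh.le) hin]
      simp only [sub_self, zero_mul, abs_zero]
      exact mul_nonneg (by positivity) (envTerm_nonneg _)
  · rw [← hcard]
    refine Finset.sum_le_sum fun t ht => ?_
    split_ifs with hta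
    · have := hL.integral_abs_pow_le (hX t (hmem t ht).1 (hmem t ht).2)
        (hR t (hmem t ht).1 (hmem t ht).2) (hmem t ht).1 (hmem t ht).2 hr hsub
        (f := fun ω => envTerm T u' x' r τ t (X T t ω, R T t ω))
        ((hew.measurable t).comp (hV t ht)) zero_le_one
        (fun ω => by simpa using
          (isWindowed_envTerm (d := d) (T := T) (u := u') (x := x') (r := r) le_rfl
            hτ.le).window t (X T t ω, R T t ω)) le_rfl (by norm_num; linarith)
      simpa only [pow_one, one_pow, one_mul, abs_of_nonneg (envTerm_nonneg _)] using this
    · simp only [envTerm_eq_zero ht hta, integral_zero, le_refl]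
  · rw [← hcard]
    refine Finset.sum_le_sum fun t ht => ?_
    have heq : ∀ ω, localWeight k T h u x t (X T t ω) * R T t ω -
        coordTerm k T h u' x' τ t (X T t ω, R T t ω) -
        (localWeight k T h u x t (X T t ω) - localWeight k T h u' x' t (X T t ω)) *
          trunc τ (R T t ω) =
        localWeight k T h u x t (X T t ω) * (R T t ω - trunc τ (R T t ω)) := fun ω => by
      simp only [coordTerm]; ring
    simp only [heq]
    split_ifs with hta
    · refine hL.integral_tail_le (hX t (hmem t ht).1 (hmem t ht).2)
        (hR t (hmem t ht).1 (hmem t ht).2) (hmem t ht).1 (hmem t ht).2 hr hsub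
        (f := fun ω => localWeight k T h u x t (X T t ω) * (R T t ω - trunc τ (R T t ω)))
        ((hw u x t ht).mul ((hR t (hmem t ht).1 (hmem t ht).2).sub (htr t ht)))
        (by positivity) (by linarith) hτ fun ω => ?_
      by_cases hin : X T t ω ∈ Metric.closedBall x' r
      · rw [Set.indicator_of_mem hin, abs_mul]
        exact mul_le_mul_of_nonneg_right (abs_localWeight_le hk) (abs_nonneg _)
      · rw [localWeight_eq_zero_of_near hk hh hc hu1 hx1 fun hcon => hin hcon.2]
        simp only [zero_mul, abs_zero]
        exact mul_nonneg (by positivity) (Set.indicator_nonneg (fun _ _ => abs_nonneg _) _)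
    · have h0 : ∀ ω, localWeight k T h u x t (X T t ω) = 0 := fun ω =>
        localWeight_eq_zero_of_near hk hh hc hu1 hx1 fun hcon =>
          hta (Finset.mem_filter.2 ⟨ht, hcon.1⟩)
      simp only [h0, zero_mul, abs_zero, integral_zero, le_refl]

theorem norm_le_of_abs_apply_le {m : ℕ} {v : EuclideanSpace ℝ (Fin m)} {δ : ℝ} (hδ : 0 ≤ δ)
    (hv : ∀ i, |v i| ≤ δ) : ‖v‖ ≤ m * δ := by
  rw [EuclideanSpace.norm_eq]
  refine Real.sqrt_le_iff.2 ⟨by positivity, ?_⟩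
  calc ∑ i, ‖v i‖ ^ 2 ≤ ∑ _i : Fin m, δ ^ 2 := by
        refine Finset.sum_le_sum fun i _ => ?_
        exact pow_le_pow_left₀ (norm_nonneg _) (hv i) 2
    _ = m * δ ^ 2 := by simp
    _ ≤ (m * δ) ^ 2 := by
        rw [mul_pow]
        refine mul_le_mul_of_nonneg_right ?_ (by positivity)
        rcases Nat.eq_zero_or_pos m with rfl | hm
        · simp
        · have : (1 : ℝ) ≤ m := by exact_mod_cast hm
          nlinarith

/-- The deviation of the kernel average, from the deviations of its coordinates. -/
theorem norm_kernelAverage_sub_integral_le {K : ℝ → ℝ}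
    (hX : ∀ t, 1 ≤ t → t ≤ T → Measurable (X T t))
    (hRi : ∀ t, 1 ≤ t → t ≤ T → Integrable (R T t) P)
    (hk : ∀ (i : Fin (d + 2)) j, IsFactor (coordFactor K i j) B L c) (hh : 0 < h) {ε : ℝ}
    (hε : 0 ≤ ε) {ω₀ : Ω}
    (hdev : ∀ i : Fin (d + 2), |∑ t ∈ Finset.Icc 1 T,
      (localWeight (coordFactor K i) T h u x t (X T t ω₀) * R T t ω₀ -
        ∫ ω, localWeight (coordFactor K i) T h u x t (X T t ω) * R T t ω ∂P)| ≤ ε) :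
    ‖kernelAverage K T h (fun t => X T t ω₀) (fun t => R T t ω₀) u x -
      ∫ ω, kernelAverage K T h (fun t => X T t ω) (fun t => R T t ω) u x ∂P‖ ≤
        (d + 2) * (1 / (T * h ^ (d + 1)) * ε) := by
  have hfi : ∀ i : Fin (d + 2), ∀ t ∈ Finset.Icc 1 T, Integrable (fun ω =>
      localWeight (coordFactor K i) T h u x t (X T t ω) * R T t ω) P := fun i t ht => by
    have hmem := Finset.mem_Icc.1 ht
    exact (hRi t hmem.1 hmem.2).bdd_mul ((continuous_localWeight (hk i)).measurable.comp
      (hX t hmem.1 hmem.2)).aestronglyMeasurable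
      (Eventually.of_forall fun ω => abs_localWeight_le (hk i))
  have hint : ∀ i : Fin (d + 2), Integrable (fun ω =>
      kernelAverage K T h (fun t => X T t ω) (fun t => R T t ω) u x i) P := fun i => by
    simp_rw [kernelAverage_apply]
    exact (integrable_finsetSum _ (hfi i)).const_mul _
  have hfinal := norm_le_of_abs_apply_le (m := d + 2) (δ := 1 / (T * h ^ (d + 1)) * ε)
    (v := kernelAverage K T h (fun t => X T t ω₀) (fun t => R T t ω₀) u x -
      ∫ ω, kernelAverage K T h (fun t => X T t ω) (fun t => R T t ω) u x ∂P)
    (by positivity) fun i => by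
      rw [PiLp.sub_apply, eval_integral_piLp hint]
      simp_rw [kernelAverage_apply]
      rw [integral_const_mul, integral_finsetSum _ (hfi i), ← mul_sub,
        ← Finset.sum_sub_distrib, abs_mul, abs_of_nonneg (by positivity)]
      exact mul_le_mul_of_nonneg_left (hdev i) (by positivity)
  exact hfinal.trans (le_of_eq (by push_cast; ring))

theorem integrable_of_lintegral_rpow_le [IsProbabilityMeasure P] {Y : Ω → ℝ} (hY : Measurable Y)
    (hs : 1 ≤ s) (h : ∫⁻ ω, ‖Y ω‖ₑ ^ s ∂P ≤ ENNReal.ofReal C) : Integrable Y P := by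
  refine ⟨hY.aestronglyMeasurable, ?_⟩
  have hle : ∀ ω, ‖Y ω‖ₑ ≤ 1 + ‖Y ω‖ₑ ^ s := fun ω => by
    rw [enorm_rpow_eq_ofReal _ (by linarith), Real.enorm_eq_ofReal_abs, ← ENNReal.ofReal_one,
      ← ENNReal.ofReal_add zero_le_one (by positivity)]
    refine ENNReal.ofReal_le_ofReal ?_
    simpa using abs_pow_le_one_add_rpow (Y ω) (q := 1) (by simpa using hs)
  refine (lintegral_mono hle).trans_lt ?_
  rw [lintegral_add_left measurable_const]
  simp only [lintegral_const, measure_univ, mul_one]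
  exact ENNReal.add_lt_top.2 ⟨ENNReal.one_lt_top, h.trans_lt ENNReal.ofReal_lt_top⟩

/-- A union bound with Markov's inequality for the `s`-th power; for `τ^s = ρ T` the result is `C /
ρ`. -/
theorem measureReal_exists_lt_abs_le [IsProbabilityMeasure P] {Y : ℕ → Ω → ℝ} (hC : 0 ≤ C)
    (hτ : 0 < τ) (hs : 0 < s) (hY : ∀ t, 1 ≤ t → t ≤ T → Measurable (Y t))
    (h : ∀ t, 1 ≤ t → t ≤ T → ∫⁻ ω, ‖Y t ω‖ₑ ^ s ∂P ≤ ENNReal.ofReal C) :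
    P.real (⋃ t ∈ Finset.Icc 1 T, {ω | τ < |Y t ω|}) ≤ T * (C / τ ^ s) := by
  refine (measureReal_biUnion_finset_le _ _).trans ((Finset.sum_le_sum fun t ht =>
    (?_ : _ ≤ C / τ ^ s)).trans (by simp))
  have hmem := Finset.mem_Icc.1 ht
  have hmark := mul_meas_ge_le_lintegral (μ := P) ((hY t hmem.1 hmem.2).enorm.pow_const s)
    (ENNReal.ofReal (τ ^ s))
  have hsub : {ω | τ < |Y t ω|} ⊆ {ω | ENNReal.ofReal (τ ^ s) ≤ ‖Y t ω‖ₑ ^ s} := fun ω hω => by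
    change ENNReal.ofReal (τ ^ s) ≤ ‖Y t ω‖ₑ ^ s
    rw [enorm_rpow_eq_ofReal _ hs.le]
    exact ENNReal.ofReal_le_ofReal (Real.rpow_le_rpow hτ.le (le_of_lt hω) hs.le)
  have h1 : ENNReal.ofReal (τ ^ s) * P {ω | τ < |Y t ω|} ≤ ENNReal.ofReal C := by
    refine le_trans ?_ (hmark.trans (h t hmem.1 hmem.2))
    gcongr
  have h2 := ENNReal.toReal_mono ENNReal.ofReal_ne_top h1
  rw [ENNReal.toReal_mul, ENNReal.toReal_ofReal (by positivity), ENNReal.toReal_ofReal hC] at h2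
  rw [le_div_iff₀ (by positivity), mul_comm]
  exact h2

end Pathwise

end LocLin

/-! ### The uniform deviation bound at a fixed sample size -/

namespace LocLin

section Uniform

variable {Ω : Type*} {mΩ : MeasurableSpace Ω} {P : Measure Ω} {d : ℕ}
  {X : ℕ → ℕ → Ω → Fin d → ℝ} {R : ℕ → ℕ → Ω → ℝ}

/-- A window contains at most `2 c T h + 1` times, and `1 ≤ T h^(d+1) ≤ T h` absorbs the extra one.
-/
theorem card_activeTimes_mul_le {T : ℕ} {c h u : ℝ} (hT : 1 ≤ T) (hc : 0 ≤ c) (hh : 0 < h)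
    (hh1 : h ≤ 1) (hn : 1 ≤ T * h ^ (d + 1)) :
    ((activeTimes T u (c * h)).card : ℝ) * (2 * (c * h)) ^ d ≤
      (2 * c + 1) * (2 * c) ^ d * (T * h ^ (d + 1)) := by
  have hTh : 1 ≤ T * h := hn.trans (mul_le_mul_of_nonneg_left
    (pow_le_of_le_one hh.le hh1 (Nat.succ_ne_zero d)) (Nat.cast_nonneg T))
  have h1 : ((activeTimes T u (c * h)).card : ℝ) ≤ (2 * c + 1) * (T * h) :=
    (card_activeTimes_le hT (by positivity)).trans (by nlinarith)
  calc ((activeTimes T u (c * h)).card : ℝ) * (2 * (c * h)) ^ d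
      ≤ (2 * c + 1) * (T * h) * (2 * (c * h)) ^ d := by gcongr
    _ = (2 * c + 1) * (2 * c) ^ d * (T * h ^ (d + 1)) := by
        rw [← mul_assoc 2, mul_pow]; ring

/-- Deviation inequality for sums of windowed functions at the scale of the uniform rate. -/
theorem measureReal_window_le [IsProbabilityMeasure P]
    {A β D W κ B c M : ℝ} (hA : 0 ≤ A) (hD : 0 ≤ D) (hB : 0 < B) (hc : 0 ≤ c) (hM : 0 < M)
    (hW : ∀ n, ∑ l ∈ Finset.range n, lagWeight κ l ≤ W)
    (hMB : (1 / (2 * B)) ^ 2 * ((2 * c + 1) * (2 * c) ^ d * (2 * D * W)) + (d + 3) ≤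
      1 / (2 * B) * M / 4)
    {T : ℕ} (hT : 1 ≤ T) (hX : ∀ t, 1 ≤ t → t ≤ T → Measurable (X T t))
    (hR : ∀ t, 1 ≤ t → t ≤ T → Measurable (R T t))
    (hdep : ∀ t k : ℕ, 1 ≤ k → 1 ≤ t → t + k ≤ T →
      DependenceLE P (sigmaBetween (fun t ω => (X T t ω, R T t ω)) 1 t)
        (sigmaBetween (fun t ω => (X T t ω, R T t ω)) (t + k) T) (A * (k : ℝ) ^ (-β)))
    {h u a τ : ℝ} {x : Fin d → ℝ} {ζ : ℕ → (Fin d → ℝ) × ℝ → ℝ} (hh : 0 < h) (hh1 : h ≤ 1)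
    (hn : 1 ≤ T * h ^ (d + 1)) (ha : 0 < a) (han : a ^ 2 * (T * h ^ (d + 1)) = Real.log T)
    (hτ : 0 < τ) (haτ : a * τ ≤ 1) (hζ : IsWindowed ζ x (c * h) B (B * τ))
    (hζ0 : ∀ t ∈ Finset.Icc 1 T, t ∉ activeTimes T u (c * h) → ∀ q, ζ t q = 0)
    (hcov : ∀ t ∈ Finset.Icc 1 T, ∀ t' ∈ Finset.Icc 1 T,
        |∫ ω, ζ t (X T t ω, R T t ω) * ζ t' (X T t' ω, R T t' ω) ∂P -
          (∫ ω, ζ t (X T t ω, R T t ω) ∂P) * ∫ ω, ζ t' (X T t' ω, R T t' ω) ∂P| ≤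
        (D * (2 * (c * h)) ^ d) * lagWeight κ ((t - t') + (t' - t))) :
    P.real {ω | M * (a * (T * h ^ (d + 1))) < |∑ t ∈ Finset.Icc 1 T,
      (ζ t (X T t ω, R T t ω) - ∫ ω', ζ t (X T t ω', R T t ω') ∂P)|} ≤
      4 * ((T : ℝ) ^ (d + 3))⁻¹ + 128 * A * B / M *
        ((⌊1 / (a * τ)⌋₊ : ℝ) ^ (-β) * τ * T / (a * (T * h ^ (d + 1)))) := by
  have hT0 : (0 : ℝ) < T := by exact_mod_cast hT
  have hW0 : 0 ≤ W := by simpa using hW 0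
  set n := (T : ℝ) * h ^ (d + 1) with hndef
  set m := ⌊1 / (a * τ)⌋₊ with hm
  have hy : 1 ≤ 1 / (a * τ) := by rw [le_div_iff₀ (by positivity)]; linarith
  have hm1 : 1 ≤ m := (Nat.one_le_floor_iff _).2 hy
  have hmle : (m : ℝ) ≤ 1 / (a * τ) := Nat.floor_le (by positivity)
  have hV : ∀ t, 1 ≤ t → t ≤ T → Measurable fun ω => (X T t ω, R T t ω) := fun t h1 h2 =>
    (hX t h1 h2).prodMk (hR t h1 h2)
  -- With `lam = a / (2 B)` both terms of the exponent are multiples of `a^2 n = log T`, and `hMB`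
  -- makes their sum at most `-(d + 3) log T`. The block length `m ≤ 1 / (a τ)` is the longest
  -- integer for which the constraint `lam * (2 * B τ * m) ≤ 1` is ensured.
  have key := measureReal_lt_abs_sum_le (P := P) (V := fun t ω => (X T t ω, R T t ω)) (T := T)
    (Z := fun t ω => ζ t (X T t ω, R T t ω)) (a := A * (m : ℝ) ^ (-β)) (b := B * τ)
    (D := D * (2 * (c * h)) ^ d) (W := W) (lam := 1 / (2 * B) * a) (ε := M * (a * n))
    (𝒜 := activeTimes T u (c * h)) hm1 hV
    (fun t _ => (hζ.measurable t).comp (comap_measurable _)) (by positivity)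
    (fun t _ ω => hζ.bound t _) (fun t ht hta ω => hζ0 t ht hta _) (by positivity)
    (lagWeight_nonneg κ) hW hcov (by positivity) (fun t h1 h2 => hdep t m hm1 h1 h2)
    (by positivity) ?_ (by positivity)
  · refine key.trans (add_le_add (mul_le_mul_of_nonneg_left ?_ (by norm_num)) (le_of_eq ?_))
    · have hcard := card_activeTimes_mul_le (d := d) (u := u) hT hc hh hh1 hn
      rw [← hndef] at hcard
      have h1 : ((activeTimes T u (c * h)).card : ℝ) * (2 * (D * (2 * (c * h)) ^ d) * W) ≤
          (2 * c + 1) * (2 * c) ^ d * (2 * D * W) * n := by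
        calc ((activeTimes T u (c * h)).card : ℝ) * (2 * (D * (2 * (c * h)) ^ d) * W)
            = ((activeTimes T u (c * h)).card : ℝ) * (2 * (c * h)) ^ d * (2 * D * W) := by ring
          _ ≤ (2 * c + 1) * (2 * c) ^ d * n * (2 * D * W) := by gcongr
          _ = _ := by ring
      have hlog : 0 ≤ Real.log T := Real.log_nonneg (by exact_mod_cast hT)
      have h2 : (1 / (2 * B) * a) ^ 2 * (((activeTimes T u (c * h)).card : ℝ) *
          (2 * (D * (2 * (c * h)) ^ d) * W)) - 1 / (2 * B) * a * (M * (a * n)) / 4 ≤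
          -((d + 3) * Real.log T) := by
        calc (1 / (2 * B) * a) ^ 2 * (((activeTimes T u (c * h)).card : ℝ) *
              (2 * (D * (2 * (c * h)) ^ d) * W)) - 1 / (2 * B) * a * (M * (a * n)) / 4
            ≤ (1 / (2 * B) * a) ^ 2 * ((2 * c + 1) * (2 * c) ^ d * (2 * D * W) * n) -
              1 / (2 * B) * a * (M * (a * n)) / 4 := by gcongr
          _ = ((1 / (2 * B)) ^ 2 * ((2 * c + 1) * (2 * c) ^ d * (2 * D * W)) -
              1 / (2 * B) * M / 4) * (a ^ 2 * n) := by ring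
          _ ≤ -(d + 3) * Real.log T := by
              rw [han]
              exact mul_le_mul_of_nonneg_right (by linarith) hlog
          _ = _ := by ring
      refine (Real.exp_le_exp.2 h2).trans (le_of_eq ?_)
      rw [Real.exp_neg, ← Real.exp_log (pow_pos hT0 (d + 3)), Real.log_pow]
      push_cast; rfl
    · field_simp
  · calc 1 / (2 * B) * a * (2 * (B * τ) * m) = a * τ * m := by field_simp
      _ ≤ a * τ * (1 / (a * τ)) := by gcongr
      _ = 1 := by field_simp

set_option maxHeartbeats 1000000 in
/-- Uniform deviations of the kernel average at a fixed sample size. -/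
theorem exists_uniform_deviation_le [IsProbabilityMeasure P]
    (hX : ∀ T t, 1 ≤ t → t ≤ T → Measurable (X T t))
    (hR : ∀ T t, 1 ≤ t → t ≤ T → Measurable (R T t)) {s β : ℝ} (hK1 : MomentCondition P R s)
    (hK2 : MixingCondition P X R s β) (hK3 : DensityCondition P X R s)
    (hβ : (2 + s * (1 + ((d : ℝ) + 1))) / (s - 2) < β) {K : ℝ → ℝ} {C₁ : ℝ}
    (hK : IsKernel K C₁) {S : Set (Fin d → ℝ)} (hS : IsCompact S) :
    ∃ h₀ M C : ℝ, 0 < h₀ ∧ 0 < M ∧ 0 ≤ C ∧ ∀ (T : ℕ) (h L ρ : ℝ), 1 ≤ T → 0 < h → h ≤ h₀ →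
      L = Real.log T → 1 ≤ L → 1 ≤ ρ → L * ρ ≤ (T : ℝ) ^ theta d s β * h ^ (d + 1) →
      P {ω | ENNReal.ofReal (M * √(L / (T * h ^ (d + 1)))) < ⨆ u ∈ Set.Icc (0 : ℝ) 1, ⨆ x ∈ S,
        ‖kernelAverage K T h (fun t => X T t ω) (fun t => R T t ω) u x -
          ∫ ω', kernelAverage K T h (fun t => X T t ω') (fun t => R T t ω') u x ∂P‖ₑ} ≤
        ENNReal.ofReal (C * (1 / ρ + 1 / T + (L ^ 2)⁻¹)) := by
  obtain ⟨hs, CR, hCR⟩ := hK1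
  have hs0 : 0 < s := by linarith
  obtain ⟨hβd, hθ0, hθβ, hθ⟩ := theta_mul_eq hs hβ
  have hd0 : (0 : ℝ) ≤ d := Nat.cast_nonneg d
  have hβ0 : 0 ≤ β := by linarith
  have h2s : 2 / s < 1 := (div_lt_one hs0).2 hs
  have h2s0 : 0 < 2 / s := by positivity
  obtain ⟨A, hA, hdep⟩ := hK2.exists_dependenceLE
  obtain ⟨B₀, L₀, c, hB₀, hL₀, hc, hf₁, hf₂⟩ := hK.exists_isFactor
  have hk : ∀ (i : Fin (d + 2)) j, IsFactor (coordFactor K i j) B₀ L₀ c := fun i j => by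
    unfold coordFactor; split_ifs
    · exact hf₂
    · exact hf₁
  obtain ⟨ρ₀, hρ₀, hSρ⟩ := hS.isBounded.subset_closedBall_lt 1 0
  -- The centres lie in the ball of radius `ρ₀ + 1`, and the windows around them have radius at most
  -- `c + 1` once `h ≤ 1`.
  obtain ⟨C, lstar, hLM⟩ := hK3.exists_localMoments hX hR (ρ₀ + 1 + (c + 1))
  have hC := hLM.nonneg
  set B := B₀ ^ (d + 1) with hBdef
  have hB1 : 1 ≤ B := one_le_pow₀ hB₀
  have hB : 0 < B := by linarith
  obtain ⟨D, hD, hcov⟩ := hLM.exists_abs_cov_le hX hR hA hdep hs hβ0 hB.le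
  set κ := β * (1 - 2 / s) / (2 - 2 / s) with hκ
  -- As `κ = β (s - 2) / (2 s - 2)`, summability over the lags is exactly the lower bound on `β` in
  -- the mixing condition.
  have hκ1 : 1 < κ := by
    have h1 := hK2.1
    rw [div_lt_iff₀ (by linarith)] at h1
    have e1 : β * (1 - 2 / s) = β * (s - 2) / s := by field_simp
    have e2 : 2 - 2 / s = (2 * s - 2) / s := by field_simp
    rw [hκ, one_lt_div (by linarith), e1, e2]
    exact div_lt_div_of_pos_right h1 hs0
  obtain ⟨W, hW⟩ := exists_sum_lagWeight_le hκ1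
  set c' := c + 1 with hc'
  have hc'0 : 0 < c' := by linarith
  set V := (1 / (2 * B)) ^ 2 * ((2 * c' + 1) * (2 * c') ^ d * (2 * D * W)) with hV
  have hW0 : 0 ≤ W := by simpa using hW 0
  have hV0 : 0 ≤ V := by positivity
  -- Chosen so that the exponential term is `T^(-(d+3))`, one power of `T` better than needed
  -- against the `T^(d+2)` bound for the net.
  set M := 8 * B * (V + (d + 3)) with hM
  have hM0 : 0 < M := by positivity
  have hMB : V + (d + 3) ≤ 1 / (2 * B) * M / 4 := by
    rw [hM]; exact le_of_eq (by field_simp; ring)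
  set Qc := (2 * c' + 1) * (2 * c') ^ d * (2 * C) with hQc
  have hQc0 : 0 ≤ Qc := by positivity
  set η₀ := (d + 1) * B * L₀ with hη₀
  have hη₀0 : 0 ≤ η₀ := by positivity
  -- The three terms are the deviation at a centre, the discretisation error and the truncation
  -- bias.
  set M₁ := M + η₀ * (2 * Qc + M) + B * Qc with hM₁
  have hM₁0 : 0 < M₁ := by positivity
  set CK := max CR 0 with hCK
  have hCK0 : 0 ≤ CK := le_max_right _ _
  have hCRK : ∀ T t, 1 ≤ t → t ≤ T → ∫⁻ ω, ‖R T t ω‖ₑ ^ s ∂P ≤ ENNReal.ofReal CK :=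
    fun T t h1 h2 => (hCR T t h1 h2).trans (ENNReal.ofReal_le_ofReal (le_max_left _ _))
  set CN := (5 * ρ₀) ^ (d + 1) with hCN
  have hCN0 : 0 ≤ CN := by positivity
  set Cq := 128 * A * B / M with hCq
  have hCq0 : 0 ≤ Cq := by positivity
  set Cf := CK + CN * (d + 3) * (4 + Cq * 2 ^ β) with hCf
  -- The bound on `h` makes the side `2 c' h` of a window at most `1`, as the covariance bound
  -- requires.
  refine ⟨1 / (2 * c'), (d + 2) * M₁, Cf, by positivity, by positivity, by positivity, ?_⟩
  intro T h L ρ hT hh hhle hLdef hL hρ hband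
  have hT1 : (1 : ℝ) ≤ T := by exact_mod_cast hT
  have hT0 : (0 : ℝ) < T := by linarith
  have hch : 2 * (c' * h) ≤ 1 := by
    rw [le_div_iff₀ (by positivity)] at hhle; linarith
  have hc'1 : 1 ≤ c' := by linarith
  have hhc : h ≤ c' * h := le_mul_of_one_le_left hh.le hc'1
  have hh1 : h ≤ 1 := by linarith
  have hLρ := le_mul_pow_of_bandwidth hT1 hh (by linarith) hband
  have hLL : L ≤ L * ρ := le_mul_of_one_le_right (by linarith) hρ
  have hn : 1 ≤ T * h ^ (d + 1) := by linarith
  set n := (T : ℝ) * h ^ (d + 1) with hndef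
  have hn0 : 0 < n := by linarith
  set a := √(L / n) with ha
  set τ := (ρ * T) ^ (1 / s) with hτ
  have ha0 : 0 < a := by positivity
  have hτ0 : 0 < τ := by positivity
  have haτ : a * τ ≤ 1 := rate_mul_level_le_one hT1 hL hρ hh hs hθ hband
  have hτa : τ ^ (1 - s) ≤ a := level_rpow_le_rate hT1 hL hρ hh hh1 hs
  have ha2 : a ^ 2 * n = L := by rw [ha, Real.sq_sqrt (by positivity)]; field_simp
  have ha1 : a ≤ 1 := by
    exact Real.sqrt_le_one.2 ((div_le_one hn0).2 (by linarith))
  have hτs : τ ^ s = ρ * T := by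
    rw [hτ, ← Real.rpow_mul (by positivity), one_div, inv_mul_cancel₀ hs0.ne', Real.rpow_one]
  obtain ⟨F, hFcard, hFball, hFcover⟩ := exists_finset_net d hρ₀.le (δ := a * h) (by positivity)
    (mul_le_one₀ ha1 hh.le hh1)
  have hsub : ∀ q ∈ F, Metric.closedBall q.2 (c' * h) ⊆
      Metric.closedBall 0 (ρ₀ + 1 + c') := fun q hq =>
    Metric.closedBall_subset_closedBall' (by
      have := Metric.mem_closedBall.1 (hFball q hq)
      have := mul_le_of_le_one_right hc'0.le hh1
      linarith)
  have hRi : ∀ t, 1 ≤ t → t ≤ T → Integrable (R T t) P := fun t h1 h2 =>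
    integrable_of_lintegral_rpow_le (hR T t h1 h2) (by linarith) (hCRK T t h1 h2)
  set ε := M * (a * n) with hε
  set dev : (ℕ → (Fin d → ℝ) × ℝ → ℝ) → Set Ω := fun ζ => {ω | ε < |∑ t ∈ Finset.Icc 1 T,
      (ζ t (X T t ω, R T t ω) - ∫ ω', ζ t (X T t ω', R T t ω') ∂P)|} with hdevdef
  set q₀ := (⌊1 / (a * τ)⌋₊ : ℝ) ^ (-β) * τ * T / (a * n) with hq₀
  have hv1 : (2 * (c' * h)) ^ d ≤ 1 := pow_le_one₀ (by positivity) hch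
  have hdev : ∀ q ∈ F, ∀ ζ : ℕ → (Fin d → ℝ) × ℝ → ℝ, IsWindowed ζ q.2 (c' * h) B (B * τ) →
      (∀ t ∈ Finset.Icc 1 T, t ∉ activeTimes T q.1 (c' * h) → ∀ p, ζ t p = 0) →
      P.real (dev ζ) ≤ 4 * ((T : ℝ) ^ (d + 3))⁻¹ + Cq * q₀ := fun q hq ζ hζ hζ0 =>
    measureReal_window_le hA hD hB hc'0.le hM0 hW hMB hT (hX T) (hR T) (hdep T) hh hh1 hn ha0
      (ha2.trans hLdef) hτ0 haτ hζ hζ0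
      (hcov T q.2 (c' * h) (B * τ) ζ (by positivity) hv1 (hsub q hq) hζ)
  -- Each centre contributes `d + 3` deviation events: one for each of the `d + 2` coordinates and
  -- one for the envelope.
  set bad : Set Ω := (⋃ t ∈ Finset.Icc 1 T, {ω | τ < |R T t ω|}) ∪
    ⋃ q ∈ F, ((⋃ i : Fin (d + 2), dev (coordTerm (coordFactor K i) T h q.1 q.2 τ)) ∪
      dev (envTerm T q.1 q.2 (c' * h) τ)) with hbad
  have hbadle : P.real bad ≤ Cf * (1 / ρ + 1 / T + (L ^ 2)⁻¹) := by
    have h1 : P.real (⋃ t ∈ Finset.Icc 1 T, {ω | τ < |R T t ω|}) ≤ CK * (1 / ρ) := by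
      refine (measureReal_exists_lt_abs_le hCK0 hτ0 hs0 (hR T) (hCRK T)).trans (le_of_eq ?_)
      rw [hτs]; field_simp
    have h2 : ∀ q ∈ F, P.real ((⋃ i : Fin (d + 2),
        dev (coordTerm (coordFactor K i) T h q.1 q.2 τ)) ∪ dev (envTerm T q.1 q.2 (c' * h) τ)) ≤
        (d + 3) * (4 * ((T : ℝ) ^ (d + 3))⁻¹ + Cq * q₀) := fun q hq => by
      refine (measureReal_union_le _ _).trans ((add_le_add ((measureReal_iUnion_fintype_le _).trans
        (Finset.sum_le_sum fun i _ => hdev q hq _ (isWindowed_coordTerm (hk i) hB₀ hh hc hτ0.le)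
          fun t ht hta p => coordTerm_eq_zero (hk i) hh hc ht hta p))
        (hdev q hq _ (isWindowed_envTerm hB₀ hτ0.le)
          fun t ht hta p => envTerm_eq_zero ht hta p)).trans (le_of_eq ?_))
      rw [Finset.sum_const, Finset.card_univ, Fintype.card_fin, nsmul_eq_mul]
      push_cast; ring
    have hq₀0 : 0 ≤ q₀ := by positivity
    have h3 : ((a * h) ^ (d + 1))⁻¹ * (4 * ((T : ℝ) ^ (d + 3))⁻¹ + Cq * q₀) ≤
        4 * (1 / T) + Cq * (2 ^ β * (L ^ 2)⁻¹) := by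
      have e1 : ((a * h) ^ (d + 1))⁻¹ * ((T : ℝ) ^ (d + 3))⁻¹ ≤ 1 / T := by
        calc ((a * h) ^ (d + 1))⁻¹ * ((T : ℝ) ^ (d + 3))⁻¹
            ≤ (T : ℝ) ^ (d + 2) * ((T : ℝ) ^ (d + 3))⁻¹ :=
              mul_le_mul_of_nonneg_right (inv_rate_pow_le hT1 hL hh hh1 hn) (by positivity)
          _ = 1 / T := by rw [pow_succ (T : ℝ) (d + 2)]; field_simp
      have e2 : ((a * h) ^ (d + 1))⁻¹ * q₀ ≤ 2 ^ β * (L ^ 2)⁻¹ :=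
        mixing_error_le hT1 hL hρ hh hs hβd hθβ hθ0 hθ hband ha hτ
      calc ((a * h) ^ (d + 1))⁻¹ * (4 * ((T : ℝ) ^ (d + 3))⁻¹ + Cq * q₀)
          = 4 * (((a * h) ^ (d + 1))⁻¹ * ((T : ℝ) ^ (d + 3))⁻¹) +
            Cq * (((a * h) ^ (d + 1))⁻¹ * q₀) := by ring
        _ ≤ _ := by gcongr
    calc P.real bad ≤ CK * (1 / ρ) +
          ∑ _q ∈ F, (d + 3) * (4 * ((T : ℝ) ^ (d + 3))⁻¹ + Cq * q₀) :=
          (measureReal_union_le _ _).trans (add_le_add h1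
            ((measureReal_biUnion_finset_le _ _).trans (Finset.sum_le_sum h2)))
      _ = CK * (1 / ρ) + F.card * ((d + 3) * (4 * ((T : ℝ) ^ (d + 3))⁻¹ + Cq * q₀)) := by
          rw [Finset.sum_const, nsmul_eq_mul]
      _ ≤ CK * (1 / ρ) + CN * ((a * h) ^ (d + 1))⁻¹ *
            ((d + 3) * (4 * ((T : ℝ) ^ (d + 3))⁻¹ + Cq * q₀)) := by gcongr
      _ = CK * (1 / ρ) + CN * (d + 3) * (((a * h) ^ (d + 1))⁻¹ *
            (4 * ((T : ℝ) ^ (d + 3))⁻¹ + Cq * q₀)) := by ring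
      _ ≤ CK * (1 / ρ) + CN * (d + 3) * (4 * (1 / T) + Cq * (2 ^ β * (L ^ 2)⁻¹)) := by gcongr
      _ ≤ _ := by
          have k1 : 0 ≤ 1 / ρ := by positivity
          have k2 : 0 ≤ 1 / (T : ℝ) := by positivity
          have k3 : 0 ≤ (L ^ 2)⁻¹ := by positivity
          have k4 : (0 : ℝ) ≤ Cq * 2 ^ β := by positivity
          have k5 : 0 ≤ CN * (d + 3) := by positivity
          have k6 : 4 * (1 / (T : ℝ)) + Cq * (2 ^ β * (L ^ 2)⁻¹) ≤
              (4 + Cq * 2 ^ β) * (1 / ρ + 1 / T + (L ^ 2)⁻¹) := by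
            have e : (4 + Cq * 2 ^ β) * (1 / ρ + 1 / T + (L ^ 2)⁻¹) =
                4 * (1 / (T : ℝ)) + Cq * (2 ^ β * (L ^ 2)⁻¹) + (4 * (1 / ρ) + 4 * (L ^ 2)⁻¹ +
                  Cq * 2 ^ β * (1 / ρ) + Cq * 2 ^ β * (1 / T)) := by ring
            rw [e]
            exact le_add_of_nonneg_right (by positivity)
          have k7 := mul_le_mul_of_nonneg_left k6 k5
          have k8 : CK * (1 / ρ) ≤ CK * (1 / ρ + 1 / T + (L ^ 2)⁻¹) := by gcongr; linarith
          rw [hCf]; linarith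
  -- The event with the uncountable supremum is included in the finite union `bad`, so its
  -- measurability is not needed.
  refine le_trans (measure_mono fun ω hω => ?_) ((ENNReal.le_ofReal_iff_toReal_le
    (measure_ne_top P bad) (by positivity)).2 hbadle)
  by_contra hgood
  rw [Set.mem_ofPred_eq] at hω
  refine absurd hω (not_lt.2 (iSup₂_le fun u hu => iSup₂_le fun x hx => ?_))
  obtain ⟨q, hq, huq, hxq⟩ := hFcover u hu x (hSρ hx)
  simp only [hbad, hdevdef, Set.mem_union, Set.mem_iUnion, Set.mem_ofPred_eq, not_or, not_exists,
    not_lt] at hgood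
  have hcardQ := card_activeTimes_mul_le (d := d) (u := q.1) hT hc'0.le hh hh1 hn
  rw [← hndef] at hcardQ
  have hcoord : ∀ i : Fin (d + 2), |∑ t ∈ Finset.Icc 1 T,
      (localWeight (coordFactor K i) T h u x t (X T t ω) * R T t ω -
        ∫ ω, localWeight (coordFactor K i) T h u x t (X T t ω) * R T t ω ∂P)| ≤
      a * n * M₁ := fun i => by
    have hpath := hLM.abs_sum_localWeight_sub_le hs (hX T) (hR T) hRi (hk i) hB₀ hL₀ hc hh ha0.le
      ha1 hτ0 huq hxq (hsub q hq) hgood.1 ((hgood.2 q hq).1 i) (hgood.2 q hq).2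
    refine hpath.trans ?_
    have e1 : ((activeTimes T q.1 (c' * h)).card : ℝ) * (2 * C * (2 * (c' * h)) ^ d) ≤
        Qc * n := by
      calc ((activeTimes T q.1 (c' * h)).card : ℝ) * (2 * C * (2 * (c' * h)) ^ d)
          = ((activeTimes T q.1 (c' * h)).card : ℝ) * (2 * (c' * h)) ^ d * (2 * C) := by ring
        _ ≤ (2 * c' + 1) * (2 * c') ^ d * n * (2 * C) := by gcongr
        _ = _ := by rw [hQc]; ring
    have e2 : ((activeTimes T q.1 (c' * h)).card : ℝ) *
        (B * τ ^ (1 - s) * C * (2 * (c' * h)) ^ d) ≤ B * Qc * (a * n) := by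
      calc ((activeTimes T q.1 (c' * h)).card : ℝ) * (B * τ ^ (1 - s) * C * (2 * (c' * h)) ^ d)
          = B * τ ^ (1 - s) *
            (((activeTimes T q.1 (c' * h)).card : ℝ) * (C * (2 * (c' * h)) ^ d)) := by ring
        _ ≤ B * a * (((activeTimes T q.1 (c' * h)).card : ℝ) *
            (2 * C * (2 * (c' * h)) ^ d)) := by gcongr; linarith
        _ ≤ B * a * (Qc * n) := by gcongr
        _ = _ := by ring
    calc ε + (d + 1) * B * L₀ * a * (2 * (((activeTimes T q.1 (c' * h)).card : ℝ) *
            (2 * C * (2 * (c' * h)) ^ d)) + ε) + ((activeTimes T q.1 (c' * h)).card : ℝ) *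
            (B * τ ^ (1 - s) * C * (2 * (c' * h)) ^ d)
        ≤ ε + (d + 1) * B * L₀ * a * (2 * (Qc * n) + ε) + B * Qc * (a * n) := by gcongr
      _ = a * n * (M + η₀ * (2 * Qc + M * a) + B * Qc) := by rw [hε, hη₀]; ring
      _ ≤ a * n * (M + η₀ * (2 * Qc + M * 1) + B * Qc) := by gcongr
      _ = a * n * M₁ := by rw [hM₁, mul_one]
  have hnorm := norm_kernelAverage_sub_integral_le (u := u) (x := x) (hX T) hRi hk hh
    (by positivity) hcoord
  rw [← ofReal_norm]
  refine ENNReal.ofReal_le_ofReal (hnorm.trans (le_of_eq ?_))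
  rw [← hndef]
  field_simp

end Uniform

end LocLin

/-! ### Passage to the limit in the sample size -/

theorem theorem3p1 {Ω : Type*} [MeasurableSpace Ω] (P : Measure Ω) [IsProbabilityMeasure P]
    (d : ℕ) (hd : 1 ≤ d)
    (X : ℕ → ℕ → Ω → Fin d → ℝ) (R : ℕ → ℕ → Ω → ℝ)
    (hX : ∀ T t, 1 ≤ t → t ≤ T → Measurable (X T t))
    (hR : ∀ T t, 1 ≤ t → t ≤ T → Measurable (R T t))
    (s β : ℝ)
    (hK1 : LocLin.MomentCondition P R s)
    (hK2 : LocLin.MixingCondition P X R s β)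
    (hK3 : LocLin.DensityCondition P X R s)
    (hβ : (2 + s * (1 + ((d : ℝ) + 1))) / (s - 2) < β)
    (K : ℝ → ℝ) (C₁ : ℝ) (hK : LocLin.IsKernel K C₁)
    (h : ℕ → ℝ) (hpos : ∀ T, 1 ≤ T → 0 < h T)
    (hpoly : ∃ ξ C : ℝ, 0 < ξ ∧ 0 < C ∧ ∀ T : ℕ, 1 ≤ T → h T ≤ C * (T : ℝ) ^ (-ξ))
    (hband : Tendsto (fun T : ℕ => Real.log (Real.log T) * Real.log T /
      ((T : ℝ) ^ LocLin.theta d s β * h T ^ (d + 1))) atTop (𝓝 0))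
    (S : Set (Fin d → ℝ)) (hS : IsCompact S) (hSreg : LocLin.SetRegular S C₁) :
    LocLin.IsBigOInProb P
      (fun T ω => ⨆ u ∈ Set.Icc (0 : ℝ) 1, ⨆ x ∈ S,
        ‖LocLin.kernelAverage K T (h T) (fun t => X T t ω) (fun t => R T t ω) u x -
          ∫ ω', LocLin.kernelAverage K T (h T) (fun t => X T t ω') (fun t => R T t ω') u x ∂P‖ₑ)
      (fun T => Real.sqrt (Real.log T / (T * h T ^ (d + 1)))) := by
  obtain ⟨h₀, M, C, hh₀, hM, -, hdev⟩ :=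
    LocLin.exists_uniform_deviation_le hX hR hK1 hK2 hK3 hβ hK hS
  have hcast : Tendsto (fun T : ℕ => (T : ℝ)) atTop atTop := tendsto_natCast_atTop_atTop
  have hlog : Tendsto (fun T : ℕ => Real.log T) atTop atTop := Real.tendsto_log_atTop.comp hcast
  have hloglog : Tendsto (fun T : ℕ => Real.log (Real.log T)) atTop atTop :=
    Real.tendsto_log_atTop.comp hlog
  have hh0 : ∀ᶠ T : ℕ in atTop, h T ≤ h₀ := by
    obtain ⟨ξ, Ch, hξ, -, hle⟩ := hpoly
    have ht : Tendsto (fun T : ℕ => Ch * (T : ℝ) ^ (-ξ)) atTop (𝓝 0) := by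
      simpa using ((tendsto_rpow_neg_atTop hξ).comp hcast).const_mul Ch
    filter_upwards [ht.eventually (gt_mem_nhds hh₀), eventually_ge_atTop 1] with T h1 h2
    exact (hle T h2).trans h1.le
  have hsmall : Tendsto (fun T : ℕ => C * (1 / Real.log (Real.log T) + 1 / (T : ℝ) +
      (Real.log T ^ 2)⁻¹)) atTop (𝓝 0) := by
    have h1 : Tendsto (fun T : ℕ => 1 / Real.log (Real.log T)) atTop (𝓝 0) := by
      simp only [one_div]; exact tendsto_inv_atTop_zero.comp hloglog
    have h2 : Tendsto (fun T : ℕ => 1 / (T : ℝ)) atTop (𝓝 0) := by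
      simp only [one_div]; exact tendsto_inv_atTop_zero.comp hcast
    have h3 : Tendsto (fun T : ℕ => (Real.log T ^ 2)⁻¹) atTop (𝓝 0) :=
      tendsto_inv_atTop_zero.comp ((tendsto_pow_atTop two_ne_zero).comp hlog)
    simpa using ((h1.add h2).add h3).const_mul C
  intro ε hε
  -- The exceedance probability tends to zero, so one `M` serves every `ε`.
  refine ⟨M, hM, ?_⟩
  filter_upwards [hsmall.eventually (gt_mem_nhds hε), hh0, eventually_ge_atTop 1,
    hlog.eventually_ge_atTop 1, hloglog.eventually_ge_atTop 1,
    hband.eventually (gt_mem_nhds one_pos)] with T h1 h2 h3 h4 h5 h6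
  have hT0 : (0 : ℝ) < T := by exact_mod_cast h3
  have hhT := hpos T h3
  -- The deviation bound is used with `L = log T` and `ρ = log log T`: the iterated logarithm in the
  -- bandwidth condition pays for the raised truncation level, whose exceedance probability is
  -- `O(1/ρ)`.
  rw [div_lt_one (by positivity), mul_comm (Real.log (Real.log T))] at h6
  exact (hdev T (h T) _ _ h3 hhT h2 rfl h4 h5 h6.le).trans (ENNReal.ofReal_le_ofReal h1.le)
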